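/- Let $a,b,c,k\ge 0$ be integers, let $H=U(a)\times U(b)\times U(c)$, and let $H$ act on $\mathrm{Sym}^k(\mathbb C^{abc})$, $\mathbb C^{abc}=\mathbb C^a\otimes\mathbb C^b\otimes\mathbb C^c$, through the homomorphism $H\to U(abc)$, $(U,V,W)\mapsto U\otimes V\otimes W$. Weights of $H$ are identified with triples $\delta=(\delta^A,\delta^B,\delta^C)\in\mathbb Z^a\oplus\mathbb Z^b\oplus\mathbb Z^c$: the triple of diagonal unitary matrices with entries $(s_l),(t_m),(u_n)$ acts on a vector of weight $\delta$ by the scalar $\prod_l s_l^{\delta^A_l}\prod_m t_m^{\delta^B_m}\prod_n u_n^{\delta^C_n}$. The set $R_{H,+}$ of positive roots consists of the weights $(e_i-e_j,0,0)$, $(0,e_i-e_j,0)$, $(0,0,e_i-e_j)$ with $i<j$. For a weight $\delta$ let $$\Delta(k,\delta)=\Big\{(x_{l,m,n})\in\mathbb R_{\ge0}^{abc}:\ \sum_{l,m,n}x_{l,m,n}=k,\ \sum_{m,n}x_{l,m,n}=\delta^A_l,\ \sum_{l,n}x_{l,m,n}=\delta^B_m,\ \sum_{l,m}x_{l,m,n}=\delta^C_n\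 \text{ for all } l,m,n\Big\}.$$ 1. For every weight $\delta$, the multiplicity of $\delta$ in $\mathrm{Sym}^k(\mathbb C^{abc})$ (the dimension of its weight space) equals $\#(\Delta(k,\delta)\cap\mathbb Z^{abc})$. 2. Let $\lambda,\mu,\nu$ be Young diagrams with $k$ boxes each and at most $a$, $b$ and $c$ rows, respectively. They are identified with the integer vectors of their row lengths, padded by zeros. Let the Kronecker coefficient $g_{\lambda,\mu,\nu}$ be the multiplicity in $\mathrm{Sym}^k(\mathbb C^{abc})$ of the irreducible $H$-representation with highest weight $(\lambda,\mu,\nu)$, i.e. the number of summands with this highest weight in a decomposition of $\mathrm{Sym}^k(\mathbb C^{abc})$ into irreducible $H$-representations; such a decomposition exists, and the number does not depend on it. Write $\prod_{\alpha\in R_{H,+}}(1-e^{-\alpha})=\sum_{\gamma\in\Gamma_H}c_\gamma e^{-\gamma}$ in the group ring of the weight lattice, with $\Gamma_H$ finite and all $c_\gamma\ne0$. Then $$g_{\lambda,\mu,\nu}=\sum_{\gamma\in\Gamma_H}c_\gamma\,\#\big(\Delta(k,(\lambda,\mu,\nu)+\gamma)\cap\mathbb Z^{abc}\big).$$ -/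

import Mathlib

open scoped TensorProduct Kronecker BigOperators

noncomputable section

namespace Kron

/-! ### Symmetric powers as representations of unitary groups -/

/-- The linear map `Sym^k(f) : Sym^k(M) → Sym^k(N)` induced by a linear map `f : M → N`,
`v₁ ⋯ v_k ↦ f(v₁) ⋯ f(v_k)`. -/
def symMap (k : ℕ) {M N : Type} [AddCommGroup M] [Module ℂ M] [AddCommGroup N] [Module ℂ N]
    (f : M →ₗ[ℂ] N) : (Sym[ℂ]^k M) →ₗ[ℂ] (Sym[ℂ]^k N) where
  __ := AddCon.lift (addConGen (SymmetricPower.Rel ℂ (Fin k) M))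
    ((SymmetricPower.mk ℂ (Fin k) N).toAddMonoidHom.comp
      (PiTensorProduct.map (fun _ : Fin k => f)).toAddMonoidHom)
    (AddCon.addConGen_le.2 (by
      rintro _ _ ⟨e, v⟩
      simp only [AddCon.ker_rel, AddMonoidHom.coe_comp, LinearMap.toAddMonoidHom_coe,
        Function.comp_apply, PiTensorProduct.map_tprod]
      exact (SymmetricPower.tprod_equiv e (fun i => f (v i))).symm))
  map_smul' r x := by
    induction x using AddCon.induction_on with
    | H x =>
      change SymmetricPower.mk ℂ (Fin k) N (PiTensorProduct.map (fun _ : Fin k => f) (r • x)) =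
        r • SymmetricPower.mk ℂ (Fin k) N (PiTensorProduct.map (fun _ : Fin k => f) x)
      simp

lemma symMap_mk (k : ℕ) {M N : Type} [AddCommGroup M] [Module ℂ M] [AddCommGroup N] [Module ℂ N]
    (f : M →ₗ[ℂ] N) (x : ⨂[ℂ] (_ : Fin k), M) :
    symMap k f (SymmetricPower.mk ℂ (Fin k) M x) =
      SymmetricPower.mk ℂ (Fin k) N (PiTensorProduct.map (fun _ : Fin k => f) x) := rfl

lemma symMap_tprod (k : ℕ) {M N : Type} [AddCommGroup M] [Module ℂ M] [AddCommGroup N]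
    [Module ℂ N] (f : M →ₗ[ℂ] N) (v : Fin k → M) :
    symMap k f (SymmetricPower.tprod ℂ v) = SymmetricPower.tprod ℂ (fun i => f (v i)) := by
  change symMap k f (SymmetricPower.mk ℂ (Fin k) M (PiTensorProduct.tprod ℂ v)) = _
  rw [symMap_mk, PiTensorProduct.map_tprod]
  rfl

lemma mk_surjective (k : ℕ) (M : Type) [AddCommGroup M] [Module ℂ M] :
    Function.Surjective (SymmetricPower.mk ℂ (Fin k) M) :=
  LinearMap.range_eq_top.1 (SymmetricPower.range_mk (R := ℂ) (ι := Fin k) (M := M))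

instance finite_symmetricPower (k : ℕ) (M : Type) [AddCommGroup M] [Module ℂ M]
    [Module.Finite ℂ M] : Module.Finite ℂ (Sym[ℂ]^k M) :=
  Module.Finite.of_surjective _ (mk_surjective k M)

/-- The representation of the unitary group `U(I)` on `Sym^k(ℂ^I)` induced by its defining
representation on `ℂ^I`. -/
def symRep (I : Type) [Fintype I] [DecidableEq I] (k : ℕ) :
    Representation ℂ (Matrix.unitaryGroup I ℂ) (Sym[ℂ]^k (I → ℂ)) where
  toFun U := symMap k (Matrix.toLin' (U : Matrix I I ℂ))
  map_one' := by
    refine LinearMap.ext fun x => ?_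
    obtain ⟨x, rfl⟩ := mk_surjective k _ x
    simp [symMap_mk]
  map_mul' U V := by
    refine LinearMap.ext fun x => ?_
    obtain ⟨x, rfl⟩ := mk_surjective k _ x
    simp [symMap_mk, Matrix.toLin'_mul, PiTensorProduct.map_comp]

/-- The group `H = U(a) × U(b) × U(c)`. -/
abbrev H (a b c : ℕ) : Type :=
  Matrix.unitaryGroup (Fin a) ℂ × Matrix.unitaryGroup (Fin b) ℂ × Matrix.unitaryGroup (Fin c) ℂ

/-- The homomorphism `f : U(a) × U(b) × U(c) → U(abc)`, `(U, V, W) ↦ U ⊗ V ⊗ W`. -/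
def tensorHom (a b c : ℕ) :
    H a b c →* Matrix.unitaryGroup (Fin a × Fin b × Fin c) ℂ where
  toFun g := ⟨(g.1 : Matrix (Fin a) (Fin a) ℂ) ⊗ₖ
      ((g.2.1 : Matrix (Fin b) (Fin b) ℂ) ⊗ₖ (g.2.2 : Matrix (Fin c) (Fin c) ℂ)),
    Matrix.kronecker_mem_unitary g.1.2 (Matrix.kronecker_mem_unitary g.2.1.2 g.2.2.2)⟩
  map_one' := by
    apply Subtype.ext
    simp
  map_mul' g h := by
    apply Subtype.ext
    simp [Matrix.mul_kronecker_mul]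

/-- The restriction of the `U(abc)`-representation `Sym^k(ℂ^{abc})` to `U(a) × U(b) × U(c)`
along `(U, V, W) ↦ U ⊗ V ⊗ W`. -/
def symRes (a b c k : ℕ) : Representation ℂ (H a b c) (Sym[ℂ]^k (Fin a × Fin b × Fin c → ℂ)) :=
  (symRep (Fin a × Fin b × Fin c) k).comp (tensorHom a b c)

/-! ### Weights, roots and highest weights for `U(a) × U(b) × U(c)` -/

/-- The weight lattice `ℤ^a ⊕ ℤ^b ⊕ ℤ^c` of `U(a) × U(b) × U(c)`. -/
abbrev Weight (a b c : ℕ) : Type := (Fin a → ℤ) × (Fin b → ℤ) × (Fin c → ℤ)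

/-- The diagonal unitary matrix with diagonal entries `t`. -/
def diagU {d : ℕ} (t : Fin d → Circle) : Matrix.unitaryGroup (Fin d) ℂ :=
  ⟨Matrix.diagonal (fun i => (t i : ℂ)), by
    rw [Matrix.mem_unitaryGroup_iff, Matrix.star_eq_conjTranspose, Matrix.diagonal_conjTranspose,
      Matrix.diagonal_mul_diagonal, ← Matrix.diagonal_one]
    congr 1
    funext i
    simp [Complex.mul_conj]⟩

/-- The weight space of weight `δ`: the vectors on which each element `(s, t, u)` of the maximal
torus of triples of diagonal unitary matrices acts by
`∏ s_i ^ δ^A_i * ∏ t_i ^ δ^B_i * ∏ u_i ^ δ^C_i`. -/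
def weightSpace {a b c : ℕ} {V : Type} [AddCommGroup V] [Module ℂ V]
    (ρ : Representation ℂ (H a b c) V) (δ : Weight a b c) : Submodule ℂ V :=
  ⨅ (s : Fin a → Circle) (t : Fin b → Circle) (u : Fin c → Circle),
    Module.End.eigenspace (ρ (diagU s, diagU t, diagU u))
      ((∏ i, (s i : ℂ) ^ δ.1 i) * (∏ i, (t i : ℂ) ^ δ.2.1 i) * ∏ i, (u i : ℂ) ^ δ.2.2 i)

/-- The multiplicity of the weight `δ`. -/
def weightMult {a b c : ℕ} {V : Type} [AddCommGroup V] [Module ℂ V]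
    (ρ : Representation ℂ (H a b c) V) (δ : Weight a b c) : ℕ :=
  Module.finrank ℂ (weightSpace ρ δ)

/-- The positive roots `e_i - e_j`, `i < j`, of `U(d)`. -/
def posRootsU (d : ℕ) : Finset (Fin d → ℤ) :=
  (Finset.univ.filter fun p : Fin d × Fin d => p.1 < p.2).image
    fun p => Pi.single p.1 1 - Pi.single p.2 1

/-- The positive roots of `U(a) × U(b) × U(c)`. -/
def posRoots (a b c : ℕ) : Finset (Weight a b c) :=
  (posRootsU a).image (fun α => (α, 0, 0)) ∪ (posRootsU b).image (fun α => (0, α, 0)) ∪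
    (posRootsU c).image (fun α => (0, 0, α))

/-- `ρ` has highest weight `Λ`: `Λ` is a weight of `ρ`, and every weight of `ρ` is obtained from
`Λ` by subtracting a sum of positive roots. -/
def HasHighestWeight {a b c : ℕ} {V : Type} [AddCommGroup V] [Module ℂ V]
    (ρ : Representation ℂ (H a b c) V) (Λ : Weight a b c) : Prop :=
  weightSpace ρ Λ ≠ ⊥ ∧ ∀ β : Weight a b c, weightSpace ρ β ≠ ⊥ →
    Λ - β ∈ AddSubmonoid.closure (posRoots a b c : Set (Weight a b c))

/-- A decomposition of `ρ` as a finite direct sum of irreducible subrepresentations. -/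
structure IrredDecomposition {a b c : ℕ} {V : Type} [AddCommGroup V] [Module ℂ V]
    (ρ : Representation ℂ (H a b c) V) where
  /-- the number of summands -/
  n : ℕ
  /-- the summands -/
  summand : Fin n → Subrepresentation ρ
  isInternal : DirectSum.IsInternal fun i => (summand i).toSubmodule
  irreducible : ∀ i, (summand i).toRepresentation.IsIrreducible

/-- The number of summands of a decomposition into irreducibles which are the irreducible
representation with highest weight `Λ`. -/
def IrredDecomposition.mult {a b c : ℕ} {V : Type} [AddCommGroup V] [Module ℂ V]
    {ρ : Representation ℂ (H a b c) V} (D : IrredDecomposition ρ) (Λ : Weight a b c) : ℕ :=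
  Nat.card {i : Fin D.n // HasHighestWeight (D.summand i).toRepresentation Λ}

/-- `m` is the multiplicity in `ρ` of the irreducible representation with highest weight `Λ`:
`ρ` is a direct sum of irreducible subrepresentations, and every such decomposition contains
exactly `m` summands with highest weight `Λ`. -/
def IsMultiplicity {a b c : ℕ} {V : Type} [AddCommGroup V] [Module ℂ V]
    (ρ : Representation ℂ (H a b c) V) (Λ : Weight a b c) (m : ℕ) : Prop :=
  Nonempty (IrredDecomposition ρ) ∧ ∀ D : IrredDecomposition ρ, D.mult Λ = m

/-- The integer vector `(λ_1, …, λ_d)` of a Young diagram (with at most `d` rows). -/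
def rowVector (d : ℕ) (lam : YoungDiagram) : Fin d → ℤ := fun i => (lam.rowLen i : ℤ)

/-- `g` is the Kronecker coefficient `g_{λ,μ,ν}` of Young diagrams with `k` boxes and at most
`a`, `b`, `c` rows: the multiplicity of the irreducible `U(a) × U(b) × U(c)`-representation with
highest weight `(λ, μ, ν)` in `Sym^k(ℂ^{abc})`. -/
def IsKroneckerCoefficient (a b c k : ℕ) (lam mu nu : YoungDiagram) (g : ℕ) : Prop :=
  IsMultiplicity (symRes a b c k) (rowVector a lam, rowVector b mu, rowVector c nu) g

/-! ### The coefficients `c_γ` -/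

/-- The element `∏_{α > 0} (1 - e^{-α})` of the group ring `ℤ[ℤ^a ⊕ ℤ^b ⊕ ℤ^c]`. -/
def weylDenominator (a b c : ℕ) : AddMonoidAlgebra ℤ (Weight a b c) :=
  ∏ α ∈ posRoots a b c, (1 - AddMonoidAlgebra.single (-α) 1)

/-- The integers `c_γ` in `∏_{α > 0} (1 - e^{-α}) = ∑_γ c_γ e^{-γ}`. -/
def coeffC (a b c : ℕ) (γ : Weight a b c) : ℤ := (weylDenominator a b c).coeff (-γ)

/-- The finite set `Γ_H` of all `γ` with `c_γ ≠ 0`. -/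
def Gam (a b c : ℕ) : Finset (Weight a b c) :=
  (weylDenominator a b c).coeff.support.image fun β => -β

/-! ### The polytope `Δ(k, δ)` -/

/-- The polytope `Δ(k, δ)` of nonnegative real `a × b × c` arrays with total sum `k` and
prescribed marginal sums `δ^A`, `δ^B`, `δ^C`. -/
def Del {a b c : ℕ} (k : ℕ) (δ : Weight a b c) : Set (Fin a × Fin b × Fin c → ℝ) :=
  {x | (∀ l m n, 0 ≤ x (l, m, n)) ∧ ∑ l, ∑ m, ∑ n, x (l, m, n) = k ∧
    (∀ l, ∑ m, ∑ n, x (l, m, n) = δ.1 l) ∧ (∀ m, ∑ l, ∑ n, x (l, m, n) = δ.2.1 m) ∧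
    ∀ n, ∑ l, ∑ m, x (l, m, n) = δ.2.2 n}

/-- The integer points of `ℝ^I`. -/
def intPoints (I : Type) : Set (I → ℝ) := {x | ∀ i, ∃ z : ℤ, x i = z}

/-- The number of integral points of `Δ(k, δ)`. -/
def latticeCount {a b c : ℕ} (k : ℕ) (δ : Weight a b c) : ℕ :=
  (Del k δ ∩ intPoints (Fin a × Fin b × Fin c)).ncard

lemma finite_Del_inter {a b c : ℕ} (k : ℕ) (δ : Weight a b c) :
    (Del k δ ∩ intPoints (Fin a × Fin b × Fin c)).Finite := by
  refine ((Set.finite_Icc (0 : Fin a × Fin b × Fin c → ℤ) (fun _ => (k : ℤ))).image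
    (fun z p => (z p : ℝ))).subset ?_
  rintro x ⟨⟨h0, hk, -⟩, hz⟩
  choose z hz using hz
  refine ⟨z, ⟨fun p => ?_, fun p => ?_⟩, funext fun p => (hz p).symm⟩
  · have := h0 p.1 p.2.1 p.2.2
    rw [hz] at this
    exact_mod_cast this
  · have hle : x p ≤ k := by
      have hs : ∑ q, x q = k := by
        rw [← hk, Fintype.sum_prod_type]
        exact Finset.sum_congr rfl fun l _ => Fintype.sum_prod_type _
      rw [← hs]
      exact Finset.single_le_sum (fun q _ => h0 q.1 q.2.1 q.2.2) (Finset.mem_univ p)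
    rw [hz] at hle
    exact_mod_cast hle

end Kron

end

open scoped TensorProduct Kronecker BigOperators

noncomputable section
namespace Kron

/-! ### The Cauchy determinant -/

/-! The first claim holds because the monomials form a basis of the symmetric power consisting of
weight vectors, and the weight of a monomial is the triple of marginals of its exponent array
(`weightMult_symRes`).

The second claim is a form of Weyl's character formula: for an irreducible constituent, the
alternating sum of weight multiplicities at `Λ + ∑ S`, over sets `S` of positive roots, is `1` at
its highest weight and `0` at every other dominant weight `Λ` of degree `k`. Summing over the
constituents of a decomposition gives the multiplicity. The formula is proved without Lie algebras
or integration, by a duality argument on matrix coefficients.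

The matrix coefficients of the `k`-th tensor power are products of monomials in the entries of `U`,
`V`, `W`. They are linearly independent as functions on `H`, since the unitary group is Zariski
dense in the matrices (Cayley transform, `eq_zero_of_eval_unitary`). The coefficients in a fixed row
`w` span a representation under right translation. Its multiplicity at `δ` is the number
`tripleCount (wt w) δ` of triples of natural matrices with row sums `wt w` and column sums `δ`. By
Frobenius reciprocity (`finrank_hom_rowRep`) an irreducible `t` occurs in it `m t (wt w)` times,
where `m t` denotes weight multiplicity. Hence `tripleCount ε δ = ∑ t, m t ε * m t δ`
(`exists_orthogonal_family`).

Taking alternating sums in both variables makes the left side the identity matrix on dominant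
weights, because of the Cauchy determinant (`sum_matCount_eq`). So the integers `φ t l`, the
alternating sum of `m t` at `l`, satisfy `∑ t, φ t l * φ t l' = [l = l']`. A sum of integer squares
equal to `1` has a single nonzero term, and at a maximal weight of `t` the alternating sum is a
positive multiplicity. This forces `φ t` to be the indicator of one dominant weight, which lies
above all weights of `t` (`exists_highest_of_tripleCount`). -/

lemma exists_prod_sub_mul_eq_sum {R ι : Type*} [CommRing R] (s : Finset ι) (y : ι → R) :
    ∃ A : ℕ → R, ∀ X Y : R,
      ∏ l ∈ s, (Y - X * y l) = ∑ r ∈ Finset.range (s.card + 1), X ^ r * Y ^ (s.card - r) * A r := by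
  classical
  induction s using Finset.induction_on with
  | empty => exact ⟨fun _ => 1, fun X Y => by simp⟩
  | insert a s ha ih =>
    obtain ⟨A, hA⟩ := ih
    refine ⟨fun r => (if r ≤ s.card then A r else 0) - (if r = 0 then 0 else y a * A (r - 1)),
      fun X Y => ?_⟩
    rw [Finset.prod_insert ha, hA, Finset.card_insert_of_notMem ha, sub_mul]
    simp only [mul_sub, Finset.sum_sub_distrib]
    congr 1
    · rw [Finset.sum_range_succ _ (s.card + 1), if_neg (by omega), mul_zero, add_zero, Finset.mul_sum]
      refine Finset.sum_congr rfl fun r hr => ?_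
      have hr' : r ≤ s.card := by simpa [Nat.lt_succ_iff] using hr
      rw [if_pos hr', Nat.sub_add_comm hr', pow_succ]
      ring
    · rw [Finset.sum_range_succ' _ (s.card + 1), Finset.mul_sum]
      simp only [↓reduceIte, mul_zero, add_zero]
      refine Finset.sum_congr rfl fun r hr => ?_
      rw [if_neg (by omega), Nat.add_sub_add_right, Nat.add_sub_cancel, pow_succ]
      ring

lemma prod_prod_Ioi_eq {M : Type*} [CommMonoid M] {n : ℕ} (f : Fin n → Fin n → M) :
    ∏ i, ∏ j ∈ Finset.Ioi i, f i j = ∏ p : Fin n × Fin n with p.1 < p.2, f p.1 p.2 := by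
  rw [Finset.prod_filter, Fintype.prod_prod_type]
  refine Finset.prod_congr rfl fun i _ => ?_
  rw [← Finset.prod_filter]
  refine Finset.prod_congr ?_ fun _ _ => rfl
  ext j
  simp

lemma prod_prod_erase_eq {M : Type*} [CommMonoid M] {n : ℕ} (f : Fin n → Fin n → M) :
    ∏ j, ∏ l ∈ Finset.univ.erase j, f j l =
      (∏ p : Fin n × Fin n with p.1 < p.2, f p.1 p.2) *
        ∏ p : Fin n × Fin n with p.1 < p.2, f p.2 p.1 := by
  have h1 : ∏ p : Fin n × Fin n with p.1 < p.2, f p.2 p.1 =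
      ∏ p : Fin n × Fin n with p.2 < p.1, f p.1 p.2 :=
    Finset.prod_bij (fun p _ => p.swap) (by simp) (by simp) (by simp) (by simp)
  rw [h1, ← Finset.prod_union]
  · have h2 : ∀ j : Fin n, ∏ l ∈ Finset.univ.erase j, f j l = ∏ l, if l ≠ j then f j l else 1 := by
      intro j
      rw [← Finset.prod_filter]
      refine Finset.prod_congr ?_ fun _ _ => rfl
      ext l
      simp
    simp only [h2]
    rw [← Fintype.prod_prod_type' (f := fun j l => if l ≠ j then f j l else 1),
      ← Finset.prod_filter (fun p : Fin n × Fin n => p.2 ≠ p.1) (fun p => f p.1 p.2)]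
    refine Finset.prod_congr ?_ fun _ _ => rfl
    ext p
    simp only [Finset.mem_filter, Finset.mem_univ, true_and, Finset.mem_union]
    exact ⟨fun h => (lt_or_gt_of_ne h).symm, fun h => h.elim ne_of_gt ne_of_lt⟩
  · rw [Finset.disjoint_filter]
    exact fun p _ h1 h2 => absurd h1 h2.asymm

open Matrix in
/-- The polynomial form of the Cauchy determinant. -/
lemma det_prod_one_sub_mul {R : Type*} [CommRing R] [IsDomain R] {n : ℕ} (x y : Fin n → R)
    (hy : Function.Injective y) :
    (Matrix.of fun i j => ∏ l ∈ Finset.univ.erase j, (1 - x i * y l)).det =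
      (∏ p : Fin n × Fin n with p.1 < p.2, (x p.1 - x p.2)) *
        ∏ p : Fin n × Fin n with p.1 < p.2, (y p.1 - y p.2) := by
  -- The coefficients `A` depend on neither `X` nor `Y`, so one matrix `B` factors the products
  -- through the projective Vandermonde matrix for all `v`, `w` at once.
  choose A hA using fun j : Fin n => exists_prod_sub_mul_eq_sum (Finset.univ.erase j) y
  let B : Matrix (Fin n) (Fin n) R := .of fun r j => A j r
  have key : ∀ v w : Fin n → R, projVandermonde v w * B =
      .of fun i j => ∏ l ∈ Finset.univ.erase j, (w i - v i * y l) := by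
    intro v w
    ext i j
    have hn : (Finset.univ.erase j).card + 1 = n := by
      rw [Finset.card_erase_add_one (Finset.mem_univ j), Finset.card_univ, Fintype.card_fin]
    rw [of_apply, hA, hn, Matrix.mul_apply, ← Fin.sum_univ_eq_sum_range
      (fun r => v i ^ r * w i ^ ((Finset.univ.erase j).card - r) * A j r) n]
    refine Finset.sum_congr rfl fun r _ => ?_
    rw [projVandermonde_apply, Fin.val_rev]
    have : (Finset.univ.erase j).card - (r : ℕ) = n - (r + 1) := by omega
    rw [this]
    rfl
  -- At `(x, 1)` the product is the matrix in question. At `(1, y)` it is diagonal, since an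
  -- off-diagonal entry contains the factor `y i - y i`; this second case determines `det B` after
  -- cancelling the Vandermonde product of `y`.
  have h1 := congrArg Matrix.det (key x 1)
  have h2 := congrArg Matrix.det (key 1 y)
  have hdiag : (Matrix.of fun i j => ∏ l ∈ Finset.univ.erase j, (y i - (1 : Fin n → R) i * y l)) =
      Matrix.diagonal fun j => ∏ l ∈ Finset.univ.erase j, (y j - y l) := by
    ext i j
    by_cases h : i = j
    · subst h
      simp
    · rw [of_apply, diagonal_apply_ne _ h]
      exact Finset.prod_eq_zero (Finset.mem_erase.2 ⟨h, Finset.mem_univ i⟩) (by simp)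
  rw [hdiag, det_diagonal, prod_prod_erase_eq, det_mul, det_projVandermonde, prod_prod_Ioi_eq] at h2
  rw [det_mul, det_projVandermonde, prod_prod_Ioi_eq] at h1
  simp only [Pi.one_apply, one_mul, mul_one] at h1 h2
  have hne : ∏ p : Fin n × Fin n with p.1 < p.2, (y p.1 - y p.2) ≠ 0 := by
    rw [Finset.prod_ne_zero_iff]
    intro p hp h
    exact (Finset.mem_filter.1 hp).2.ne (hy (sub_eq_zero.1 h))
  rw [mul_right_inj' hne] at h2
  rw [← h1, h2, ← Finset.prod_mul_distrib, ← Finset.prod_mul_distrib]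
  exact Finset.prod_congr rfl fun p _ => by ring

/-! ### Products of geometric series -/

/-- The geometric series `∑ m, X ^ (m • d)`. -/
def geomSeries {σ : Type*} (d : σ →₀ ℕ) : MvPowerSeries σ ℤ := by
  classical exact fun e => if ∃ m : ℕ, m • d = e then 1 else 0

open scoped Classical in
lemma coeff_geomSeries {σ : Type*} (d e : σ →₀ ℕ) :
    MvPowerSeries.coeff e (geomSeries d) = if ∃ m : ℕ, m • d = e then 1 else 0 := rfl

/-- Telescoping, one coefficient at a time: a nonzero `e` is a multiple of `d` exactly when `d ≤ e`
and `e - d` is a multiple of `d`. -/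
lemma one_sub_mul_geomSeries {σ : Type*} {d : σ →₀ ℕ} (hd : d ≠ 0) :
    (1 - MvPowerSeries.monomial d 1) * geomSeries d = 1 := by
  classical
  ext e
  rw [sub_mul, one_mul, map_sub, MvPowerSeries.coeff_monomial_mul, MvPowerSeries.coeff_one,
    coeff_geomSeries, one_mul, coeff_geomSeries]
  by_cases h0 : e = 0
  · subst h0
    rw [if_pos ⟨0, zero_smul _ _⟩, if_neg (by simpa using hd), if_pos rfl, sub_zero]
  · rw [if_neg h0]
    by_cases hle : d ≤ e
    · rw [if_pos hle, sub_eq_zero]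
      congr 1
      refine propext ⟨?_, ?_⟩
      · rintro ⟨m, rfl⟩
        obtain _ | m := m
        · simp at h0
        · exact ⟨m, by rw [succ_nsmul, add_tsub_cancel_right]⟩
      · rintro ⟨m, hm⟩
        exact ⟨m + 1, by rw [succ_nsmul, hm, tsub_add_cancel_of_le hle]⟩
    · rw [if_neg hle, sub_zero, if_neg]
      rintro ⟨m, rfl⟩
      obtain _ | m := m
      · simp at h0
      · exact hle (by rw [succ_nsmul]; exact le_add_self)

/-- Each `d j` is nonzero, so a multiple of `d j` determines its multiplier, and the ways of writing
`e` as a sum of such multiples correspond to tuples `m`. For `d` running over the exponents of `x_i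
y_j`, such tuples are matrices with prescribed row and column sums. -/
lemma coeff_prod_geomSeries {σ J : Type*} [Fintype J] (d : J → σ →₀ ℕ) (hd : ∀ j, d j ≠ 0)
    (e : σ →₀ ℕ) :
    MvPowerSeries.coeff e (∏ j, geomSeries (d j)) =
      (Nat.card {m : J → ℕ // ∑ j, m j • d j = e} : ℤ) := by
  classical
  rw [MvPowerSeries.coeff_prod]
  simp only [coeff_geomSeries, Finset.prod_ite_zero, Finset.prod_const_one]
  rw [Finset.sum_boole, Nat.cast_inj, ← Fintype.card_coe, ← Nat.card_eq_fintype_card]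
  refine (Nat.card_congr (Equiv.ofBijective (fun m => ⟨Finsupp.equivFunOnFinite.symm
    fun j => m.1 j • d j, Finset.mem_filter.2 ⟨Finset.mem_finsuppAntidiag.2
      ⟨m.2, Finset.subset_univ _⟩, fun j _ => ⟨m.1 j, rfl⟩⟩⟩) ⟨?_, ?_⟩)).symm
  · intro m m' h
    refine Subtype.ext (funext fun j => ?_)
    have hj := DFunLike.congr_fun (Subtype.ext_iff.1 h) j
    obtain ⟨s, hs⟩ := Finsupp.ne_iff.1 (hd j)
    have := DFunLike.congr_fun hj s
    simpa [show d j s ≠ 0 from hs] using this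
  · rintro ⟨l, hl⟩
    simp only [Finset.mem_filter, Finset.mem_finsuppAntidiag] at hl
    choose m hm using fun j => hl.2 j (Finset.mem_univ j)
    refine ⟨⟨m, ?_⟩, Subtype.ext (Finsupp.ext_iff.2 fun j => hm j)⟩
    simp only [hm]
    exact hl.1.1

lemma coeff_monomial_mul_prod_geomSeries {σ J : Type*} [Fintype J] (d : J → σ →₀ ℕ)
    (hd : ∀ j, d j ≠ 0) (u e : σ →₀ ℕ) :
    MvPowerSeries.coeff e (MvPowerSeries.monomial u 1 * ∏ j, geomSeries (d j)) =
      (Nat.card {m : J → ℕ // u + ∑ j, m j • d j = e} : ℤ) := by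
  classical
  rw [MvPowerSeries.coeff_monomial_mul, one_mul, coeff_prod_geomSeries d hd]
  split_ifs with h
  · congr 1
    refine Nat.card_congr (Equiv.subtypeEquivRight fun m => ?_)
    rw [eq_tsub_iff_add_eq_of_le h, add_comm]
  · have : IsEmpty {m : J → ℕ // u + ∑ j, m j • d j = e} :=
      ⟨fun m => h (m.2 ▸ le_self_add)⟩
    simp

end Kron
end

noncomputable section
namespace Kron

/-! ### Orthogonality relations for matrix counts -/

/-- The number of `n × n` matrices of natural numbers with prescribed row and column sums. -/
def matCount (n : ℕ) (δ ε : Fin n → ℤ) : ℕ :=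
  Nat.card {A : Fin n × Fin n → ℕ //
    (∀ i, ∑ j, (A (i, j) : ℤ) = δ i) ∧ ∀ j, ∑ i, (A (i, j) : ℤ) = ε j}

/-- The pairs `i < j`. -/
def pairs (n : ℕ) : Finset (Fin n × Fin n) := {p | p.1 < p.2}

/-- The root `e_i - e_j`. -/
def root {n : ℕ} (p : Fin n × Fin n) : Fin n → ℤ := Pi.single p.1 1 - Pi.single p.2 1

/-- The half sum of the positive roots, up to a multiple of `(1, …, 1)`. -/
def rho {n : ℕ} (i : Fin n) : ℕ := n - 1 - i

lemma rho_strictAnti (n : ℕ) : StrictAnti (rho : Fin n → ℕ) := fun i j h => by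
  have := j.2
  have : (i : ℕ) < j := h
  unfold rho
  omega

/-- The exponent of the term of `∏ (x_i - x_j)` which takes `-x_j` for `(i, j) ∈ S`. -/
def termExp {n : ℕ} (S : Finset (Fin n × Fin n)) (i : Fin n) : ℕ :=
  ∑ p ∈ pairs n \ S, (Pi.single p.1 1 : Fin n → ℕ) i + ∑ p ∈ S, (Pi.single p.2 1 : Fin n → ℕ) i

lemma sum_pairs_single_fst {n : ℕ} (i : Fin n) :
    ∑ p ∈ pairs n, (Pi.single p.1 1 : Fin n → ℕ) i = rho i := by
  simp only [Pi.single_apply, pairs, Finset.sum_boole, Finset.filter_filter, Nat.cast_id]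
  have : (Finset.univ.filter fun p : Fin n × Fin n => p.1 < p.2 ∧ i = p.1) =
      (Finset.Ioi i).map ⟨fun j => (i, j), Prod.mk_right_injective i⟩ := by
    ext ⟨p, q⟩
    simp only [Finset.mem_filter, Finset.mem_univ, true_and, Finset.mem_map, Finset.mem_Ioi,
      Function.Embedding.coeFn_mk, Prod.mk.injEq, exists_eq_right_right]
    constructor
    · rintro ⟨h, rfl⟩
      exact ⟨h, rfl⟩
    · rintro ⟨h, rfl⟩
      exact ⟨h, rfl⟩
  rw [this, Finset.card_map, Fin.card_Ioi]
  unfold rho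
  omega

/-- Choosing `-x_j` instead of `x_i` in the factor of `(i, j)` lowers the exponent by `e_i - e_j`;
choosing no such term gives `rho`. This turns the Vandermonde expansion into a sum over shifts by
sets of positive roots. -/
lemma termExp_add_sum_root {n : ℕ} {S : Finset (Fin n × Fin n)} (hS : S ⊆ pairs n) (i : Fin n) :
    (termExp S i : ℤ) + (∑ p ∈ S, root p) i = rho i := by
  rw [← sum_pairs_single_fst, ← Finset.sum_sdiff hS]
  unfold termExp root
  push_cast
  rw [Finset.sum_apply]
  simp only [Pi.sub_apply, Finset.sum_sub_distrib]
  have h1 : ∀ j : Fin n, (((Pi.single j 1 : Fin n → ℕ) i : ℕ) : ℤ) = (Pi.single j 1 : Fin n → ℤ) i := by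
    intro j
    simp only [Pi.single_apply]
    split_ifs <;> simp
  simp only [h1]
  ring

/-- The exponent `(p, q)` of a monomial in two sets of variables. -/
def biExp {n : ℕ} (p q : Fin n → ℕ) : Fin n ⊕ Fin n →₀ ℕ :=
  Finsupp.equivFunOnFinite.symm (Sum.elim p q)

lemma biExp_add {n : ℕ} (p q p' q' : Fin n → ℕ) :
    biExp p q + biExp p' q' = biExp (p + p') (q + q') := by
  ext (i | i) <;> rfl

lemma biExp_inj {n : ℕ} {p q p' q' : Fin n → ℕ} : biExp p q = biExp p' q' ↔ p = p' ∧ q = q' := by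
  unfold biExp
  rw [Finsupp.equivFunOnFinite.symm.injective.eq_iff, Sum.elim_eq_iff]

lemma sum_smul_biExp {n : ℕ} {J : Type*} [Fintype J] (m : J → ℕ) (p q : J → Fin n → ℕ) :
    ∑ j, m j • biExp (p j) (q j) =
      biExp (fun i => ∑ j, m j * p j i) (fun i => ∑ j, m j * q j i) := by
  ext (i | i) <;> simp [biExp, Finsupp.finsetSum_apply]

lemma prod_pairs_sub {n : ℕ} {R : Type*} [CommRing R] (x : Fin n → R) :
    ∏ p ∈ pairs n, (x p.1 - x p.2) =
      ∑ S ∈ (pairs n).powerset, (-1) ^ S.card * ∏ i, x i ^ termExp S i := by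
  have hs : ∀ j : Fin n, x j = ∏ i, x i ^ (Pi.single j 1 : Fin n → ℕ) i := by
    intro j
    rw [Finset.prod_eq_single j] <;> simp +contextual
  rw [Finset.prod_sub]
  refine Finset.sum_congr rfl fun S _ => ?_
  rw [mul_assoc]
  congr 1
  simp only [termExp, pow_add, Finset.prod_mul_distrib, ← Finset.prod_pow_eq_pow_sum]
  rw [Finset.prod_comm, Finset.prod_comm (s := Finset.univ) (t := S)]
  simp only [← hs]

/-- A monomial in two sets of variables, as a power series. -/
def biMon {n : ℕ} (p q : Fin n → ℕ) : MvPowerSeries (Fin n ⊕ Fin n) ℤ :=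
  MvPowerSeries.monomial (biExp p q) 1

lemma biMon_mul {n : ℕ} (p q p' q' : Fin n → ℕ) :
    biMon p q * biMon p' q' = biMon (p + p') (q + q') := by
  rw [biMon, biMon, MvPowerSeries.monomial_mul_monomial, biExp_add, one_mul, biMon]

lemma biMon_zero (n : ℕ) : biMon (0 : Fin n → ℕ) 0 = 1 := by
  rw [biMon, show biExp (0 : Fin n → ℕ) 0 = 0 by ext (i | i) <;> rfl]
  rfl

lemma biMon_pow {n : ℕ} (p q : Fin n → ℕ) (m : ℕ) : biMon p q ^ m = biMon (m • p) (m • q) := by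
  induction m with
  | zero => simp [biMon_zero]
  | succ m ih => rw [pow_succ, ih, biMon_mul, succ_nsmul, succ_nsmul]

lemma biMon_prod {n : ℕ} {J : Type*} (s : Finset J) (p q : J → Fin n → ℕ) :
    ∏ j ∈ s, biMon (p j) (q j) = biMon (∑ j ∈ s, p j) (∑ j ∈ s, q j) := by
  classical
  induction s using Finset.induction_on with
  | empty => simp [biMon_zero]
  | insert a s ha ih => rw [Finset.prod_insert ha, ih, biMon_mul, Finset.sum_insert ha,
      Finset.sum_insert ha]

lemma prod_biMon_left_pow {n : ℕ} (p : Fin n → ℕ) :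
    ∏ i, biMon (Pi.single i 1) 0 ^ p i = biMon p 0 := by
  simp only [biMon_pow, smul_zero]
  rw [biMon_prod, Finset.sum_const_zero]
  congr 1
  ext j
  simp [Finset.sum_apply, Pi.single_apply]

lemma prod_biMon_right_pow {n : ℕ} (p : Fin n → ℕ) :
    ∏ i, biMon 0 (Pi.single i 1) ^ p i = biMon 0 p := by
  simp only [biMon_pow, smul_zero]
  rw [biMon_prod, Finset.sum_const_zero]
  congr 1
  ext j
  simp [Finset.sum_apply, Pi.single_apply]

lemma biExp_ne_zero {n : ℕ} (i j : Fin n) :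
    biExp (Pi.single i 1) (Pi.single j 1) ≠ 0 := by
  intro h
  have := DFunLike.congr_fun h (Sum.inl i)
  simp [biExp] at this

/-- The geometric series `1 / (1 - x_i y_j)`. -/
def cauchyEntry {n : ℕ} (i j : Fin n) : MvPowerSeries (Fin n ⊕ Fin n) ℤ :=
  geomSeries (biExp (Pi.single i 1) (Pi.single j 1))

lemma one_sub_mul_cauchyEntry {n : ℕ} (i j : Fin n) :
    (1 - biMon (Pi.single i 1) 0 * biMon 0 (Pi.single j 1)) * cauchyEntry i j = 1 := by
  rw [biMon_mul, add_zero, zero_add]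
  exact one_sub_mul_geomSeries (biExp_ne_zero i j)

/-- Multiplying row `i` of the polynomial matrix of `det_prod_one_sub_mul` by `∏ l, 1 / (1 - x_i
y_l)` leaves only the entry `1 / (1 - x_i y_j)`. The two Vandermonde products are then expanded over
sets of pairs. -/
lemma det_cauchyEntry (n : ℕ) :
    (Matrix.of fun i j : Fin n => cauchyEntry i j).det =
      (∑ S ∈ (pairs n).powerset, ∑ S' ∈ (pairs n).powerset,
        (-1) ^ (S.card + S'.card) * biMon (termExp S) (termExp S')) *
        ∏ p : Fin n × Fin n, cauchyEntry p.1 p.2 := by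
  have : IsDomain (MvPowerSeries (Fin n ⊕ Fin n) ℤ) := NoZeroDivisors.to_isDomain _
  let x : Fin n → MvPowerSeries (Fin n ⊕ Fin n) ℤ := fun i => biMon (Pi.single i 1) 0
  let y : Fin n → MvPowerSeries (Fin n ⊕ Fin n) ℤ := fun i => biMon 0 (Pi.single i 1)
  have hy : Function.Injective y := by
    intro i j h
    have h1 := congrArg (MvPowerSeries.coeff (biExp 0 (Pi.single i 1))) h
    simp only [y, biMon, MvPowerSeries.coeff_monomial_same, MvPowerSeries.coeff_monomial] at h1
    split_ifs at h1 with h2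
    · have h3 := congrFun (biExp_inj.1 h2).2 i
      by_contra hij
      simp [Pi.single_eq_of_ne hij] at h3
    · simp at h1
  have hM : (Matrix.of fun i j : Fin n => cauchyEntry i j) = Matrix.of fun i j =>
      (∏ l, cauchyEntry i l) *
        (Matrix.of fun i j => ∏ l ∈ Finset.univ.erase j, (1 - x i * y l)) i j := by
    ext1 i j
    simp only [Matrix.of_apply]
    rw [← Finset.mul_prod_erase _ _ (Finset.mem_univ j), mul_assoc, ← Finset.prod_mul_distrib,
      Finset.prod_congr rfl fun l _ => (mul_comm _ _).trans (one_sub_mul_cauchyEntry i l),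
      Finset.prod_const_one, mul_one]
  rw [hM, Matrix.det_mul_column, det_prod_one_sub_mul x y hy, Fintype.prod_prod_type, mul_comm]
  congr 1
  change (∏ p ∈ pairs n, (x p.1 - x p.2)) * (∏ p ∈ pairs n, (y p.1 - y p.2)) = _
  rw [prod_pairs_sub, prod_pairs_sub, Finset.sum_mul_sum]
  refine Finset.sum_congr rfl fun S _ => Finset.sum_congr rfl fun S' _ => ?_
  simp only [x, y]
  rw [prod_biMon_left_pow, prod_biMon_right_pow, mul_mul_mul_comm, biMon_mul, add_zero, zero_add,
    pow_add]

/-- The product of all `1 / (1 - x_i y_j)` is the generating function of natural matrices by row and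
column sums, and the monomial shifts the exponents by `p`, `q`. The vectors `δ`, `ε` are integral
because shifted weights may have negative entries; both sides are then zero. -/
lemma coeff_biMon_mul_prod_cauchyEntry {n : ℕ} (p q : Fin n → ℕ) (δ ε : Fin n → ℤ)
    (e f : Fin n → ℕ) (hp : ∀ i, (p i : ℤ) + δ i = e i) (hq : ∀ i, (q i : ℤ) + ε i = f i) :
    MvPowerSeries.coeff (biExp e f)
      (biMon p q * ∏ r : Fin n × Fin n, cauchyEntry r.1 r.2) = (matCount n δ ε : ℤ) := by
  unfold biMon cauchyEntry
  rw [coeff_monomial_mul_prod_geomSeries (fun r : Fin n × Fin n => biExp (Pi.single r.1 1)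
    (Pi.single r.2 1)) (fun r => biExp_ne_zero r.1 r.2)]
  congr 1
  refine Nat.card_congr (Equiv.subtypeEquivRight fun A => ?_)
  rw [sum_smul_biExp, biExp_add, biExp_inj, funext_iff, funext_iff]
  refine and_congr (forall_congr' fun i => ?_) (forall_congr' fun j => ?_)
  · have : ∑ r : Fin n × Fin n, A r * (Pi.single r.1 1 : Fin n → ℕ) i = ∑ j, A (i, j) := by
      rw [Fintype.sum_prod_type, Finset.sum_eq_single i] <;> simp +contextual [eq_comm]
    rw [Pi.add_apply, this, ← Nat.cast_inj (R := ℤ), ← hp i]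
    push_cast
    exact add_right_inj _
  · have : ∑ r : Fin n × Fin n, A r * (Pi.single r.2 1 : Fin n → ℕ) j = ∑ i, A (i, j) := by
      rw [Fintype.sum_prod_type_right, Finset.sum_eq_single j] <;>
        simp +contextual [eq_comm]
    rw [Pi.add_apply, this, ← Nat.cast_inj (R := ℤ), ← hq j]
    push_cast
    exact add_right_inj _

/-- In the Leibniz expansion the term of `σ` contains `x^e y^f` exactly when `e ∘ σ = f`. Two
strictly decreasing sequences with the same range are equal, so only `σ = 1` can contribute, with
sign `+1`. -/
lemma coeff_det_cauchyEntry {n : ℕ} {e f : Fin n → ℕ} (he : StrictAnti e) (hf : StrictAnti f) :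
    MvPowerSeries.coeff (biExp e f) (Matrix.of fun i j : Fin n => cauchyEntry i j).det =
      if e = f then 1 else 0 := by
  have hperm : ∀ σ : Equiv.Perm (Fin n), e ∘ σ = f → e = f := by
    intro σ h
    have h1 : StrictMono (OrderDual.toDual ∘ e) := he
    have h2 : StrictMono (OrderDual.toDual ∘ f) := hf
    have h3 : Set.range (OrderDual.toDual ∘ e) = Set.range (OrderDual.toDual ∘ f) := by
      rw [Set.range_comp, Set.range_comp, ← h, Set.range_comp e, σ.surjective.range_eq,
        Set.image_univ]
    exact (h1.range_inj h2).1 h3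
  have hterm : ∀ σ : Equiv.Perm (Fin n), MvPowerSeries.coeff (biExp e f)
      (∏ i, cauchyEntry (σ i) i) = if e ∘ σ = f then 1 else 0 := by
    intro σ
    unfold cauchyEntry
    rw [coeff_prod_geomSeries _ (fun i => biExp_ne_zero (σ i) i)]
    have key : ∀ m : Fin n → ℕ, ∑ i, m i • biExp (Pi.single (σ i) 1) (Pi.single i 1) = biExp e f ↔
        m = e ∘ σ ∧ m = f := by
      intro m
      rw [sum_smul_biExp, biExp_inj]
      refine and_congr ?_ ?_
      · have : (fun i => ∑ j, m j * (Pi.single (σ j) 1 : Fin n → ℕ) i) = m ∘ σ.symm := by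
          ext i
          rw [Finset.sum_eq_single (σ.symm i)]
          · simp
          · intro b _ hb
            rw [Pi.single_eq_of_ne (fun h => hb (by rw [h, Equiv.symm_apply_apply])), mul_zero]
          · simp
        rw [this, Equiv.comp_symm_eq]
      · have : (fun i => ∑ j, m j * (Pi.single j 1 : Fin n → ℕ) i) = m := by
          ext i
          simp [Pi.single_apply]
        rw [this]
    split_ifs with h
    · have : Unique {m : Fin n → ℕ //
          ∑ i, m i • biExp (Pi.single (σ i) 1) (Pi.single i 1) = biExp e f} :=
        ⟨⟨⟨f, (key f).2 ⟨h.symm, rfl⟩⟩⟩, fun m => Subtype.ext ((key m.1).1 m.2).2⟩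
      simp
    · have : IsEmpty {m : Fin n → ℕ //
          ∑ i, m i • biExp (Pi.single (σ i) 1) (Pi.single i 1) = biExp e f} :=
        ⟨fun m => h (((key m.1).1 m.2).1.symm.trans ((key m.1).1 m.2).2)⟩
      simp
  rw [Matrix.det_apply, map_sum]
  simp only [Matrix.of_apply, Units.smul_def, map_zsmul, hterm]
  split_ifs with h
  · subst h
    rw [Finset.sum_eq_single 1]
    · simp
    · intro σ _ hσ
      rw [if_neg, smul_zero]
      intro h
      exact hσ (Equiv.ext fun i => he.injective (congrFun h i))
    · simp
  · refine Finset.sum_eq_zero fun σ _ => ?_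
    rw [if_neg fun h' => h (hperm σ h'), smul_zero]

/-- Antisymmetrized matrix counts are orthonormal. -/
theorem sum_matCount_eq {n : ℕ} {lam mu : Fin n → ℕ} (hl : Antitone lam) (hm : Antitone mu) :
    ∑ S ∈ (pairs n).powerset, ∑ S' ∈ (pairs n).powerset, (-1) ^ (S.card + S'.card) *
      (matCount n ((fun i => (lam i : ℤ)) + ∑ p ∈ S, root p)
        ((fun i => (mu i : ℤ)) + ∑ p ∈ S', root p) : ℤ) = if lam = mu then 1 else 0 := by
  -- The coefficient of `x^(lam + rho) y^(mu + rho)` in the Cauchy determinant is computed twice: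
  -- the Leibniz formula gives the right side, the product formula gives the double alternating sum.
  have h := coeff_det_cauchyEntry (hl.add_strictAnti (rho_strictAnti n))
    (hm.add_strictAnti (rho_strictAnti n))
  rw [det_cauchyEntry, Finset.sum_mul, map_sum] at h
  have h2 : (fun i => lam i + rho i) = (fun i => mu i + rho i) ↔ lam = mu := by
    simp [funext_iff]
  rw [if_congr h2 rfl rfl] at h
  rw [← h]
  refine Finset.sum_congr rfl fun S hS => ?_
  rw [Finset.sum_mul, map_sum]
  refine Finset.sum_congr rfl fun S' hS' => ?_
  have h3 : ((-1) ^ (S.card + S'.card) : MvPowerSeries (Fin n ⊕ Fin n) ℤ) =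
      MvPowerSeries.C ((-1) ^ (S.card + S'.card)) := by simp
  rw [h3, mul_assoc, MvPowerSeries.coeff_C_mul]
  congr 1
  refine (coeff_biMon_mul_prod_cauchyEntry _ _ _ _ _ _ (fun i => ?_) fun i => ?_).symm
  · have := termExp_add_sum_root (Finset.mem_powerset.1 hS) i
    rw [Pi.add_apply]
    push_cast
    linarith
  · have := termExp_add_sum_root (Finset.mem_powerset.1 hS') i
    rw [Pi.add_apply]
    push_cast
    linarith

end Kron
end

noncomputable section
namespace Kron

/-! ### The Weyl functional -/

/-- The sum of the roots indexed by a triple of sets of pairs. -/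
def rootSum {a b c : ℕ} (S : Finset (Fin a × Fin a)) (S' : Finset (Fin b × Fin b))
    (S'' : Finset (Fin c × Fin c)) : Weight a b c :=
  (∑ p ∈ S, root p, ∑ p ∈ S', root p, ∑ p ∈ S'', root p)

/-- The alternating sum `∑ (-1)^|S| F(Λ + ∑ S)` over the sets `S` of positive roots. -/
def weylSum {a b c : ℕ} (F : Weight a b c → ℤ) (Λ : Weight a b c) : ℤ :=
  ∑ s ∈ (pairs a).powerset ×ˢ (pairs b).powerset ×ˢ (pairs c).powerset,
    (-1) ^ (s.1.card + (s.2.1.card + s.2.2.card)) * F (Λ + rootSum s.1 s.2.1 s.2.2)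

/-- The number of triples of matrices of natural numbers with prescribed row and column sums. -/
def tripleCount {a b c : ℕ} (δ ε : Weight a b c) : ℕ :=
  matCount a δ.1 ε.1 * (matCount b δ.2.1 ε.2.1 * matCount c δ.2.2 ε.2.2)

lemma root_apply_eq_one {n : ℕ} {p : Fin n × Fin n} (hp : p ∈ pairs n) {i : Fin n} :
    root p i = 1 ↔ i = p.1 := by
  have hne : p.1 ≠ p.2 := (Finset.mem_filter.1 hp).2.ne
  simp only [root, Pi.sub_apply, Pi.single_apply]
  split_ifs <;> simp_all

lemma root_apply_eq_neg_one {n : ℕ} {p : Fin n × Fin n} (hp : p ∈ pairs n) {i : Fin n} :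
    root p i = -1 ↔ i = p.2 := by
  have hne : p.1 ≠ p.2 := (Finset.mem_filter.1 hp).2.ne
  simp only [root, Pi.sub_apply, Pi.single_apply]
  split_ifs <;> simp_all

lemma root_injOn (n : ℕ) : Set.InjOn (root : Fin n × Fin n → Fin n → ℤ) (pairs n) := by
  intro p hp q hq h
  refine Prod.ext ?_ ?_
  · rw [← root_apply_eq_one hq, ← h, root_apply_eq_one hp]
  · rw [← root_apply_eq_neg_one hq, ← h, root_apply_eq_neg_one hp]

lemma root_ne_zero {n : ℕ} {p : Fin n × Fin n} (hp : p ∈ pairs n) : root p ≠ 0 := by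
  intro h
  have := (root_apply_eq_one hp).2 rfl
  simp [h] at this

lemma posRootsU_eq (n : ℕ) : posRootsU n = (pairs n).image root := rfl

/-- `∏ (1 - e^{-α})` over the images of the positive roots of a factor. -/
lemma prod_one_sub_single {n : ℕ} {M : Type*} [AddCommGroup M] (f : (Fin n → ℤ) →+ M) :
    ∏ p ∈ pairs n, (1 - AddMonoidAlgebra.single (-f (root p)) 1 : AddMonoidAlgebra ℤ M) =
      ∑ S ∈ (pairs n).powerset, AddMonoidAlgebra.single (-f (∑ p ∈ S, root p)) ((-1) ^ S.card) := by
  have hs : ∀ S : Finset (Fin n × Fin n),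
      ∏ p ∈ S, (AddMonoidAlgebra.single (-f (root p)) 1 : AddMonoidAlgebra ℤ M) =
        AddMonoidAlgebra.single (-f (∑ p ∈ S, root p)) 1 := by
    intro S
    classical
    induction S using Finset.induction_on with
    | empty => simp [AddMonoidAlgebra.one_def]
    | insert p S hp ih =>
      rw [Finset.prod_insert hp, ih, AddMonoidAlgebra.single_mul_single, Finset.sum_insert hp,
        map_add, neg_add, one_mul]
  rw [Finset.prod_sub]
  refine Finset.sum_congr rfl fun S _ => ?_
  rw [hs, Finset.prod_const_one, mul_one]
  obtain h | h := S.card.even_or_odd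
  · rw [h.neg_one_pow, h.neg_one_pow, one_mul]
  · rw [h.neg_one_pow, h.neg_one_pow, neg_one_mul, AddMonoidAlgebra.single_neg]

/-- The terms are left uncollected: different sets of roots may have the same sum, and only the
linear pairing below is applied to this expansion. -/
lemma weylDenominator_eq (a b c : ℕ) : weylDenominator a b c =
    ∑ S ∈ (pairs a).powerset, ∑ S' ∈ (pairs b).powerset, ∑ S'' ∈ (pairs c).powerset,
      AddMonoidAlgebra.single (-rootSum S S' S'') ((-1) ^ (S.card + (S'.card + S''.card))) := by
  let fa : (Fin a → ℤ) →+ Weight a b c := AddMonoidHom.inl _ _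
  let fb : (Fin b → ℤ) →+ Weight a b c := (AddMonoidHom.inr _ _).comp (AddMonoidHom.inl _ _)
  let fc : (Fin c → ℤ) →+ Weight a b c := (AddMonoidHom.inr _ _).comp (AddMonoidHom.inr _ _)
  have h : weylDenominator a b c =
      (∏ p ∈ pairs a, (1 - AddMonoidAlgebra.single (-fa (root p)) 1)) *
      (∏ p ∈ pairs b, (1 - AddMonoidAlgebra.single (-fb (root p)) 1)) *
      ∏ p ∈ pairs c, (1 - AddMonoidAlgebra.single (-fc (root p)) 1) := by
    unfold weylDenominator posRoots
    have hfa : (posRootsU a).image (fun α => ((α, 0, 0) : Weight a b c)) =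
      (pairs a).image (fun p => fa (root p)) := by rw [posRootsU_eq, Finset.image_image]; rfl
    have hfb : (posRootsU b).image (fun α => ((0, α, 0) : Weight a b c)) =
      (pairs b).image (fun p => fb (root p)) := by rw [posRootsU_eq, Finset.image_image]; rfl
    have hfc : (posRootsU c).image (fun α => ((0, 0, α) : Weight a b c)) =
      (pairs c).image (fun p => fc (root p)) := by rw [posRootsU_eq, Finset.image_image]; rfl
    rw [hfa, hfb, hfc, Finset.prod_union, Finset.prod_union, Finset.prod_image, Finset.prod_image,
      Finset.prod_image]
    · intro p hp q hq h
      exact root_injOn c hp hq (congrArg (fun x : Weight a b c => x.2.2) h)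
    · intro p hp q hq h
      exact root_injOn b hp hq (congrArg (fun x : Weight a b c => x.2.1) h)
    · intro p hp q hq h
      exact root_injOn a hp hq (congrArg (fun x : Weight a b c => x.1) h)
    · rw [Finset.disjoint_left]
      intro x hx hx'
      obtain ⟨p, hp, rfl⟩ := Finset.mem_image.1 hx
      obtain ⟨q, hq, h⟩ := Finset.mem_image.1 hx'
      exact root_ne_zero hp (congrArg (fun x : Weight a b c => x.1) h).symm
    · rw [Finset.disjoint_left]
      intro x hx hx'
      obtain ⟨q, hq, rfl⟩ := Finset.mem_image.1 hx'
      obtain hx | hx := Finset.mem_union.1 hx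
      all_goals
        obtain ⟨p, hp, h⟩ := Finset.mem_image.1 hx
        exact root_ne_zero hq (congrArg (fun x : Weight a b c => x.2.2) h).symm
  rw [h, prod_one_sub_single, prod_one_sub_single, prod_one_sub_single, Finset.sum_mul_sum,
    Finset.sum_mul]
  refine Finset.sum_congr rfl fun S _ => ?_
  rw [Finset.sum_mul_sum]
  refine Finset.sum_congr rfl fun S' _ => Finset.sum_congr rfl fun S'' _ => ?_
  rw [AddMonoidAlgebra.single_mul_single, AddMonoidAlgebra.single_mul_single, pow_add, pow_add, mul_assoc]
  congr 1
  rw [← neg_add, ← neg_add]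
  congr 1
  refine Prod.ext ?_ (Prod.ext ?_ ?_)
  all_goals simp [fa, fb, fc, rootSum, Prod.fst_sum, Prod.snd_sum]

/-- The additive functional `e^β ↦ F (Λ - β)`. Evaluated on the two expressions for the Weyl
denominator, by coefficients and by sets of roots, it identifies the sum over `Γ_H` with the
alternating sum. The sign in `Λ - β` matches `γ = -β`. -/
lemma exists_weylPairing {M : Type*} [AddCommGroup M] (F : M → ℤ) (Λ : M) :
    ∃ L : AddMonoidAlgebra ℤ M →+ ℤ, (∀ x, L x = x.coeff.sum fun β z => z * F (Λ - β)) ∧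
      ∀ β z, L (AddMonoidAlgebra.single β z) = z * F (Λ - β) := by
  have h : ∀ x, ((Finsupp.liftAddHom fun β => AddMonoidHom.mulRight (F (Λ - β))).comp
      AddMonoidAlgebra.coeffAddEquiv.toAddMonoidHom) x =
        (x : AddMonoidAlgebra ℤ M).coeff.sum fun β z => z * F (Λ - β) := fun _ => rfl
  refine ⟨_, h, fun β z => ?_⟩
  rw [h, AddMonoidAlgebra.coeff_single, Finsupp.sum_single_index (zero_mul _)]

lemma sum_coeffC_eq_weylSum {a b c : ℕ} (F : Weight a b c → ℤ) (Λ : Weight a b c) :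
    ∑ γ ∈ Gam a b c, coeffC a b c γ * F (Λ + γ) = weylSum F Λ := by
  obtain ⟨L, hLx, hL⟩ := exists_weylPairing F Λ
  have h1 : ∑ γ ∈ Gam a b c, coeffC a b c γ * F (Λ + γ) = L (weylDenominator a b c) := by
    unfold Gam
    rw [Finset.sum_image (fun x _ y _ h => neg_injective h), hLx, Finsupp.sum]
    simp only [coeffC, neg_neg, ← sub_eq_add_neg]
  rw [h1, weylDenominator_eq]
  simp only [map_sum, hL, sub_neg_eq_add]
  rw [weylSum, Finset.sum_product]
  refine Finset.sum_congr rfl fun S _ => ?_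
  rw [Finset.sum_product]

lemma weylSum_sum {a b c : ℕ} {T : Type*} (s : Finset T) (F : T → Weight a b c → ℤ) (z : T → ℤ)
    (Λ : Weight a b c) :
    weylSum (fun δ => ∑ t ∈ s, z t * F t δ) Λ = ∑ t ∈ s, z t * weylSum (F t) Λ := by
  simp only [weylSum, Finset.mul_sum]
  rw [Finset.sum_comm]
  exact Finset.sum_congr rfl fun _ _ => Finset.sum_congr rfl fun _ _ => by ring

lemma sum_product_mul_sum_product {A B A' B' : Type*} (s : Finset A) (t : Finset B)
    (s' : Finset A') (t' : Finset B') (f : A → A' → ℤ) (g : B → B' → ℤ) :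
    ∑ x ∈ s ×ˢ t, ∑ y ∈ s' ×ˢ t', f x.1 y.1 * g x.2 y.2 =
      (∑ x ∈ s, ∑ y ∈ s', f x y) * ∑ x ∈ t, ∑ y ∈ t', g x y := by
  rw [Finset.sum_mul_sum, Finset.sum_product]
  refine Finset.sum_congr rfl fun x _ => Finset.sum_congr rfl fun y _ => ?_
  rw [Finset.sum_mul_sum, Finset.sum_product]

/-- The weight given by a triple of vectors of natural numbers. -/
def natWeight {a b c : ℕ} (l : (Fin a → ℕ) × (Fin b → ℕ) × (Fin c → ℕ)) : Weight a b c :=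
  (fun i => l.1 i, fun i => l.2.1 i, fun i => l.2.2 i)

/-- Dominance of a triple of vectors of natural numbers. -/
def NatDominant {a b c : ℕ} (l : (Fin a → ℕ) × (Fin b → ℕ) × (Fin c → ℕ)) : Prop :=
  Antitone l.1 ∧ Antitone l.2.1 ∧ Antitone l.2.2

/-- Signs, root sums and counts all factor over the three unitary groups, so this is the product of
three instances of `sum_matCount_eq`. -/
theorem weylSum_weylSum_tripleCount {a b c : ℕ} {l m : (Fin a → ℕ) × (Fin b → ℕ) × (Fin c → ℕ)}
    (hl : NatDominant l) (hm : NatDominant m) :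
    weylSum (fun δ => weylSum (fun ε => (tripleCount δ ε : ℤ)) (natWeight m)) (natWeight l) =
      if l = m then 1 else 0 := by
  have h1 := sum_matCount_eq hl.1 hm.1
  have h2 := sum_matCount_eq hl.2.1 hm.2.1
  have h3 := sum_matCount_eq hl.2.2 hm.2.2
  have h4 : (if l = m then 1 else 0 : ℤ) = (if l.1 = m.1 then 1 else 0) *
      ((if l.2.1 = m.2.1 then 1 else 0) * if l.2.2 = m.2.2 then 1 else 0) := by
    simp only [Prod.ext_iff]
    split_ifs <;> simp_all
  rw [h4, ← h1, ← h2, ← h3]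
  rw [← sum_product_mul_sum_product, ← sum_product_mul_sum_product]
  simp only [weylSum, Finset.mul_sum]
  refine Finset.sum_congr rfl fun S _ => Finset.sum_congr rfl fun S' _ => ?_
  simp only [tripleCount, natWeight, rootSum, Prod.fst_add, Prod.snd_add]
  push_cast
  ring

end Kron
end

noncomputable section
namespace Kron

/-! ### The dominance order -/

/-- The cone of sums of positive roots. -/
def rootCone (a b c : ℕ) : AddSubmonoid (Weight a b c) :=
  AddSubmonoid.closure (posRoots a b c : Set (Weight a b c))

/-- A linear functional which is positive on the positive roots. -/
def heightU (n : ℕ) : (Fin n → ℤ) →+ ℤ where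
  toFun δ := ∑ i : Fin n, -(i : ℤ) * δ i
  map_zero' := by simp
  map_add' x y := by simp [mul_add, Finset.sum_add_distrib]

/-- A linear functional which is positive on the positive roots. -/
def height (a b c : ℕ) : Weight a b c →+ ℤ :=
  (heightU a).coprod ((heightU b).coprod (heightU c))

lemma heightU_root_pos {n : ℕ} {p : Fin n × Fin n} (hp : p ∈ pairs n) : 0 < heightU n (root p) := by
  have hlt : p.1 < p.2 := (Finset.mem_filter.1 hp).2
  have : heightU n (root p) = (p.2 : ℤ) - p.1 := by
    simp [heightU, root, Pi.single_apply, mul_sub, Finset.sum_sub_distrib]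
  rw [this, sub_pos]
  exact_mod_cast hlt

lemma mem_posRoots {a b c : ℕ} {α : Weight a b c} : α ∈ posRoots a b c ↔
    (∃ p ∈ pairs a, α = (root p, 0, 0)) ∨ (∃ p ∈ pairs b, α = (0, root p, 0)) ∨
      ∃ p ∈ pairs c, α = (0, 0, root p) := by
  simp only [posRoots, posRootsU_eq, Finset.mem_union, Finset.mem_image, exists_exists_and_eq_and,
    eq_comm (a := α), or_assoc]

lemma height_pos_of_mem_posRoots {a b c : ℕ} {α : Weight a b c} (hα : α ∈ posRoots a b c) :
    0 < height a b c α := by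
  obtain ⟨p, hp, rfl⟩ | ⟨p, hp, rfl⟩ | ⟨p, hp, rfl⟩ := mem_posRoots.1 hα <;>
    simpa [height] using heightU_root_pos hp

/-- A strictly positive functional on the cone makes the dominance order antisymmetric and lets
maximal weights be found by maximizing the height. -/
lemma height_pos {a b c : ℕ} {γ : Weight a b c} (hγ : γ ∈ rootCone a b c) (h0 : γ ≠ 0) :
    0 < height a b c γ := by
  have h : γ = 0 ∨ 0 < height a b c γ := by
    clear h0
    induction hγ using AddSubmonoid.closure_induction with
    | mem x hx => exact .inr (height_pos_of_mem_posRoots (by simpa using hx))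
    | zero => exact .inl rfl
    | add x y _ _ hx hy =>
      obtain rfl | hx := hx
      · simpa using hy
      · obtain rfl | hy := hy
        · simpa using Or.inr hx
        · exact .inr (by rw [map_add]; exact add_pos hx hy)
  exact h.resolve_left h0

lemma root_mem_rootCone₁ {a b c : ℕ} {p : Fin a × Fin a} (hp : p ∈ pairs a) :
    ((root p, 0, 0) : Weight a b c) ∈ rootCone a b c :=
  AddSubmonoid.subset_closure (mem_posRoots.2 (.inl ⟨p, hp, rfl⟩))

lemma root_mem_rootCone₂ {a b c : ℕ} {p : Fin b × Fin b} (hp : p ∈ pairs b) :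
    ((0, root p, 0) : Weight a b c) ∈ rootCone a b c :=
  AddSubmonoid.subset_closure (mem_posRoots.2 (.inr (.inl ⟨p, hp, rfl⟩)))

lemma root_mem_rootCone₃ {a b c : ℕ} {p : Fin c × Fin c} (hp : p ∈ pairs c) :
    ((0, 0, root p) : Weight a b c) ∈ rootCone a b c :=
  AddSubmonoid.subset_closure (mem_posRoots.2 (.inr (.inr ⟨p, hp, rfl⟩)))

lemma rootSum_eq {a b c : ℕ} (S : Finset (Fin a × Fin a)) (S' : Finset (Fin b × Fin b))
    (S'' : Finset (Fin c × Fin c)) : (rootSum S S' S'' : Weight a b c) =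
      ∑ p ∈ S, (root p, 0, 0) + ∑ p ∈ S', (0, root p, 0) + ∑ p ∈ S'', (0, 0, root p) := by
  refine Prod.ext ?_ (Prod.ext ?_ ?_) <;> simp [rootSum, Prod.fst_sum, Prod.snd_sum]

lemma rootSum_mem_rootCone {a b c : ℕ} {S : Finset (Fin a × Fin a)} {S' : Finset (Fin b × Fin b)}
    {S'' : Finset (Fin c × Fin c)} (hS : S ⊆ pairs a) (hS' : S' ⊆ pairs b) (hS'' : S'' ⊆ pairs c) :
    (rootSum S S' S'' : Weight a b c) ∈ rootCone a b c := by
  rw [rootSum_eq]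
  exact add_mem (add_mem (sum_mem fun p hp => root_mem_rootCone₁ (hS hp))
    (sum_mem fun p hp => root_mem_rootCone₂ (hS' hp)))
    (sum_mem fun p hp => root_mem_rootCone₃ (hS'' hp))

lemma heightU_sum_root_pos {n : ℕ} {S : Finset (Fin n × Fin n)} (hS : S ⊆ pairs n) :
    0 ≤ heightU n (∑ p ∈ S, root p) ∧ (heightU n (∑ p ∈ S, root p) = 0 → S = ∅) := by
  rw [map_sum]
  refine ⟨Finset.sum_nonneg fun p hp => (heightU_root_pos (hS hp)).le, fun h => ?_⟩
  rw [Finset.sum_eq_zero_iff_of_nonneg fun p hp => (heightU_root_pos (hS hp)).le] at h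
  exact Finset.eq_empty_of_forall_notMem fun p hp => (heightU_root_pos (hS hp)).ne' (h p hp)

lemma rootSum_ne_zero {a b c : ℕ} {S : Finset (Fin a × Fin a)} {S' : Finset (Fin b × Fin b)}
    {S'' : Finset (Fin c × Fin c)} (hS : S ⊆ pairs a) (hS' : S' ⊆ pairs b) (hS'' : S'' ⊆ pairs c)
    (h : (rootSum S S' S'' : Weight a b c) = 0) : S = ∅ ∧ S' = ∅ ∧ S'' = ∅ := by
  simp only [rootSum, Prod.mk_eq_zero] at h
  refine ⟨(heightU_sum_root_pos hS).2 ?_, (heightU_sum_root_pos hS').2 ?_,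
    (heightU_sum_root_pos hS'').2 ?_⟩
  · rw [h.1, map_zero]
  · rw [h.2.1, map_zero]
  · rw [h.2.2, map_zero]

/-- If `β` is maximal in the support of `F`, then the alternating sum at `β` is `F β`. -/
lemma weylSum_eq_of_maximal {a b c : ℕ} {F : Weight a b c → ℤ} {β : Weight a b c}
    (h : ∀ γ ∈ rootCone a b c, γ ≠ 0 → F (β + γ) = 0) : weylSum F β = F β := by
  rw [weylSum, Finset.sum_eq_single (∅, ∅, ∅)]
  · simp [rootSum, show ((0, 0, 0) : Weight a b c) = 0 from rfl]
  · rintro ⟨S, S', S''⟩ hs hne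
    simp only [Finset.mem_product, Finset.mem_powerset] at hs
    rw [h _ (rootSum_mem_rootCone hs.1 hs.2.1 hs.2.2), mul_zero]
    intro h0
    obtain ⟨rfl, rfl, rfl⟩ := rootSum_ne_zero hs.1 hs.2.1 hs.2.2 h0
    exact hne rfl
  · intro h
    simp at h

lemma comp_swap_eq {n : ℕ} (δ : Fin n → ℤ) (i j : Fin n) :
    δ ∘ Equiv.swap i j = δ + (δ j - δ i) • root (i, j) := by
  ext x
  by_cases hij : i = j
  · subst hij
    simp
  by_cases hi : x = i
  · subst hi
    simp [root, Pi.single_eq_of_ne hij]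
  by_cases hj : x = j
  · subst hj
    simp [root, Pi.single_eq_of_ne (Ne.symm hij)]
  · simp [root, Equiv.swap_apply_of_ne_of_ne hi hj, Pi.single_eq_of_ne hi, Pi.single_eq_of_ne hj]

/-- Swapping an ascent `δ i < δ j`, `i < j`, raises `δ` by `δ j - δ i` copies of the root `e_i -
e_j`. Hence a maximal weight of a permutation-invariant set is dominant. -/
lemma exists_comp_swap_eq {n : ℕ} {δ : Fin n → ℤ} (h : ¬ Antitone δ) :
    ∃ p ∈ pairs n, ∃ z : ℕ, z ≠ 0 ∧ δ ∘ Equiv.swap p.1 p.2 = δ + z • root p := by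
  rw [Antitone] at h
  push Not at h
  obtain ⟨i, j, hij, hlt⟩ := h
  have hne : i ≠ j := by
    rintro rfl
    exact lt_irrefl _ hlt
  refine ⟨(i, j), Finset.mem_filter.2 ⟨Finset.mem_univ _, lt_of_le_of_ne hij hne⟩,
    (δ j - δ i).toNat, by omega, ?_⟩
  rw [comp_swap_eq, ← natCast_zsmul, Int.toNat_of_nonneg (by omega)]

/-- All three components of `δ` sum to `k`. -/
def HasDegree {a b c : ℕ} (k : ℕ) (δ : Weight a b c) : Prop :=
  ∑ i, δ.1 i = k ∧ ∑ i, δ.2.1 i = k ∧ ∑ i, δ.2.2 i = k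

lemma sum_apply_sum_root {n : ℕ} (S : Finset (Fin n × Fin n)) : ∑ i, (∑ p ∈ S, root p) i = 0 := by
  simp only [Finset.sum_apply]
  rw [Finset.sum_comm]
  exact Finset.sum_eq_zero fun p _ => by simp [root, Finset.sum_sub_distrib]

lemma HasDegree.add_rootSum {a b c k : ℕ} {δ : Weight a b c} (h : HasDegree k δ)
    (S : Finset (Fin a × Fin a)) (S' : Finset (Fin b × Fin b)) (S'' : Finset (Fin c × Fin c)) :
    HasDegree k (δ + rootSum S S' S'') := by
  refine ⟨?_, ?_, ?_⟩ <;>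
    simp only [rootSum, Prod.fst_add, Prod.snd_add, Pi.add_apply, Finset.sum_add_distrib,
      sum_apply_sum_root, add_zero]
  exacts [h.1, h.2.1, h.2.2]

/-- Root sums have degree zero, so an alternating sum at a weight of degree `k` only sees degree
`k`, where the orthogonality relation is available. -/
lemma weylSum_congr_of_hasDegree {a b c k : ℕ} {F F' : Weight a b c → ℤ}
    (h : ∀ δ, HasDegree k δ → F δ = F' δ) {Λ : Weight a b c} (hΛ : HasDegree k Λ) :
    weylSum F Λ = weylSum F' Λ :=
  Finset.sum_congr rfl fun s _ => by rw [h _ (hΛ.add_rootSum _ _ _)]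

/-- Let `m t` be the weight multiplicities of a finite family `T` for which the orthogonality
relations hold. If the support of `m t₀` is finite, nonempty, symmetric and consists of
nonnegative weights of degree `k`, then it has a highest weight, which is dominant, and
the alternating sum detects it. -/
theorem exists_highest_of_tripleCount {a b c k : ℕ} {T : Type} [Fintype T]
    (m : T → Weight a b c → ℕ)
    (hN : ∀ ε δ, HasDegree k ε → HasDegree k δ → tripleCount ε δ = ∑ t, m t ε * m t δ)
    (t₀ : T) (hfin : {δ | m t₀ δ ≠ 0}.Finite) (hne : ∃ δ, m t₀ δ ≠ 0)
    (hnat : ∀ δ, m t₀ δ ≠ 0 → HasDegree k δ ∧ ∃ l, δ = natWeight l)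
    (hsym₁ : ∀ (σ : Equiv.Perm (Fin a)) δ, m t₀ δ ≠ 0 → m t₀ (δ.1 ∘ σ, δ.2) ≠ 0)
    (hsym₂ : ∀ (σ : Equiv.Perm (Fin b)) δ, m t₀ δ ≠ 0 → m t₀ (δ.1, δ.2.1 ∘ σ, δ.2.2) ≠ 0)
    (hsym₃ : ∀ (σ : Equiv.Perm (Fin c)) δ, m t₀ δ ≠ 0 → m t₀ (δ.1, δ.2.1, δ.2.2 ∘ σ) ≠ 0) :
    ∃ l, NatDominant l ∧ m t₀ (natWeight l) ≠ 0 ∧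
      (∀ β, m t₀ β ≠ 0 → natWeight l - β ∈ rootCone a b c) ∧
      ∀ l', NatDominant l' → HasDegree k (natWeight l' : Weight a b c) →
        weylSum (fun δ => (m t₀ δ : ℤ)) (natWeight l') = if l' = l then 1 else 0 := by
  classical
  let φ : T → (Fin a → ℕ) × (Fin b → ℕ) × (Fin c → ℕ) → ℤ :=
    fun t l => weylSum (fun δ => (m t δ : ℤ)) (natWeight l)
  -- Alternating sums in both variables of `hN`: the vectors `(φ t l)` indexed by `t` are
  -- orthonormal.
  have horth : ∀ l l', NatDominant l → NatDominant l' → HasDegree k (natWeight l : Weight a b c) →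
      HasDegree k (natWeight l' : Weight a b c) → ∑ t, φ t l * φ t l' = if l = l' then 1 else 0 := by
    intro l l' hl hl' hd hd'
    rw [← weylSum_weylSum_tripleCount hl hl']
    symm
    calc weylSum (fun δ => weylSum (fun ε => (tripleCount δ ε : ℤ)) (natWeight l')) (natWeight l)
        = weylSum (fun δ => ∑ t, φ t l' * (m t δ : ℤ)) (natWeight l) := by
          refine weylSum_congr_of_hasDegree (fun δ hδ => ?_) hd
          rw [weylSum_congr_of_hasDegree (F' := fun ε => ∑ t, (m t δ : ℤ) * (m t ε : ℤ))
            (fun ε hε => by rw [hN δ ε hδ hε]; push_cast; rfl) hd', weylSum_sum]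
          exact Finset.sum_congr rfl fun t _ => mul_comm _ _
      _ = ∑ t, φ t l * φ t l' := by
          rw [weylSum_sum]
          exact Finset.sum_congr rfl fun t _ => mul_comm _ _
  -- Above any weight of `t₀` there is one of greatest height. Maximality leaves only the empty set
  -- of roots in its alternating sum, and symmetry makes it dominant.
  have hmax : ∀ β, m t₀ β ≠ 0 → ∃ l, NatDominant l ∧ HasDegree k (natWeight l : Weight a b c) ∧
      m t₀ (natWeight l) ≠ 0 ∧ natWeight l - β ∈ rootCone a b c ∧
      φ t₀ l = (m t₀ (natWeight l) : ℤ) := by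
    intro β hβ
    obtain ⟨β', ⟨hβ', hc⟩, hle⟩ := Set.exists_max_image
      {δ | m t₀ δ ≠ 0 ∧ δ - β ∈ rootCone a b c} (height a b c)
      (hfin.subset fun δ h => h.1) ⟨β, hβ, by rw [sub_self]; exact zero_mem _⟩
    have hmx : ∀ γ ∈ rootCone a b c, γ ≠ 0 → m t₀ (β' + γ) = 0 := by
      intro γ hγ h0
      by_contra h
      have h1 := hle (β' + γ) ⟨h, by rw [add_sub_right_comm]; exact add_mem hc hγ⟩
      have h2 := height_pos hγ h0
      rw [map_add] at h1
      omega
    obtain ⟨hdeg, l, rfl⟩ := hnat β' hβ'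
    have hz : ∀ {n : ℕ} {p : Fin n × Fin n} {z : ℕ}, p ∈ pairs n → z ≠ 0 → z • root p ≠ 0 :=
      fun hp hz h => (smul_eq_zero.1 h).elim hz (root_ne_zero hp)
    refine ⟨l, ⟨?_, ?_, ?_⟩, hdeg, hβ', hc, ?_⟩
    · have : Antitone (natWeight l : Weight a b c).1 := by
        by_contra h
        obtain ⟨p, hp, z, hz0, h⟩ := exists_comp_swap_eq h
        refine hsym₁ (Equiv.swap p.1 p.2) _ hβ' ?_
        rw [h]
        have := hmx (z • (root p, 0, 0)) (nsmul_mem (root_mem_rootCone₁ hp) z)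
          (fun h => hz hp hz0 (congrArg Prod.fst h))
        simpa [Prod.add_def] using this
      exact fun i j hij => Nat.cast_le.1 (this hij)
    · have : Antitone (natWeight l : Weight a b c).2.1 := by
        by_contra h
        obtain ⟨p, hp, z, hz0, h⟩ := exists_comp_swap_eq h
        refine hsym₂ (Equiv.swap p.1 p.2) _ hβ' ?_
        rw [h]
        have := hmx (z • (0, root p, 0)) (nsmul_mem (root_mem_rootCone₂ hp) z)
          (fun h => hz hp hz0 (congrArg (fun x : Weight a b c => x.2.1) h))
        simpa [Prod.add_def] using this
      exact fun i j hij => Nat.cast_le.1 (this hij)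
    · have : Antitone (natWeight l : Weight a b c).2.2 := by
        by_contra h
        obtain ⟨p, hp, z, hz0, h⟩ := exists_comp_swap_eq h
        refine hsym₃ (Equiv.swap p.1 p.2) _ hβ' ?_
        rw [h]
        have := hmx (z • (0, 0, root p)) (nsmul_mem (root_mem_rootCone₃ hp) z)
          (fun h => hz hp hz0 (congrArg (fun x : Weight a b c => x.2.2) h))
        simpa [Prod.add_def] using this
      exact fun i j hij => Nat.cast_le.1 (this hij)
    · exact weylSum_eq_of_maximal fun γ hγ h0 => by rw [hmx γ hγ h0, Nat.cast_zero]
  -- A sum of integer squares equal to `1` has exactly one nonzero term.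
  have hothers : ∀ l, NatDominant l → HasDegree k (natWeight l : Weight a b c) → φ t₀ l ≠ 0 →
      φ t₀ l * φ t₀ l = 1 ∧ ∀ t ≠ t₀, φ t l = 0 := by
    intro l hl hd h0
    have h := horth l l hl hl hd hd
    rw [if_pos rfl, ← Finset.add_sum_erase _ _ (Finset.mem_univ t₀)] at h
    have h1 : 0 ≤ ∑ t ∈ Finset.univ.erase t₀, φ t l * φ t l :=
      Finset.sum_nonneg fun t _ => mul_self_nonneg _
    have h2 : 0 < φ t₀ l * φ t₀ l := mul_self_pos.2 h0
    have h3 : ∑ t ∈ Finset.univ.erase t₀, φ t l * φ t l = 0 := by omega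
    refine ⟨by omega, fun t ht => ?_⟩
    rw [Finset.sum_eq_zero_iff_of_nonneg fun t _ => mul_self_nonneg _] at h3
    exact mul_self_eq_zero.1 (h3 t (Finset.mem_erase.2 ⟨ht, Finset.mem_univ _⟩))
  obtain ⟨β, hβ⟩ := hne
  obtain ⟨l, hl, hd, hm, -, hφ⟩ := hmax β hβ
  have hφ0 : φ t₀ l ≠ 0 := by rw [hφ]; exact_mod_cast hm
  -- The vector of `l` is supported at `t₀` alone, so its orthogonality to that of `l'` reads `φ t₀
  -- l' * φ t₀ l = 0`.
  have hzero : ∀ l', NatDominant l' → HasDegree k (natWeight l' : Weight a b c) → l' ≠ l →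
      φ t₀ l' = 0 := by
    intro l' hl' hd' hne
    have h := horth l' l hl' hl hd' hd
    rw [if_neg hne, Finset.sum_eq_single t₀ (fun t _ ht => by
      rw [(hothers l hl hd hφ0).2 t ht, mul_zero]) (by simp)] at h
    exact (mul_eq_zero.1 h).resolve_right hφ0
  refine ⟨l, hl, hm, fun β' hβ' => ?_, fun l' hl' hd' => ?_⟩
  · obtain ⟨l', hl', hd', hm', hc, hφ'⟩ := hmax β' hβ'
    have : l' = l := by
      by_contra h
      have := hzero l' hl' hd' h
      rw [hφ'] at this
      exact hm' (by exact_mod_cast this)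
    rwa [← this]
  · split_ifs with h
    · subst h
      have h1 := (hothers l' hl hd hφ0).1
      -- The value `-1` is excluded because `φ t₀ l` is a multiplicity.
      obtain h2 | h2 := mul_self_eq_one_iff.1 h1
      · exact h2
      · exfalso
        rw [hφ] at h2
        omega
    · exact hzero l' hl' hd' h

end Kron
end

noncomputable section
namespace Kron

/-! ### Semisimple representations -/

section General

open Representation

variable {G V W : Type} [Group G] [AddCommGroup V] [Module ℂ V] [AddCommGroup W] [Module ℂ W]

lemma isIrreducible_of_isAtom {ρ : Representation ℂ G V} {S : Subrepresentation ρ}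
    (hS : IsAtom S) : S.toRepresentation.IsIrreducible := by
  have hU : ∀ U : Subrepresentation S.toRepresentation,
      (U.toSubmodule.map S.toSubmodule.subtype = ⊥) ∨
        (U.toSubmodule.map S.toSubmodule.subtype = S.toSubmodule) := by
    intro U
    let U' : Subrepresentation ρ := ⟨U.toSubmodule.map S.toSubmodule.subtype, by
      rintro g _ ⟨u, hu, rfl⟩
      exact ⟨S.toRepresentation g u, U.apply_mem_toSubmodule g hu, rfl⟩⟩
    have hle : U' ≤ S := by
      rintro _ ⟨u, -, rfl⟩
      exact u.2
    obtain h | h := hS.le_iff.1 hle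
    · exact .inl (congrArg Subrepresentation.toSubmodule h)
    · exact .inr (congrArg Subrepresentation.toSubmodule h)
  have hne : S.toSubmodule ≠ ⊥ := fun h => hS.1 (Subrepresentation.toSubmodule_injective h)
  have hnt : Nontrivial S.toSubmodule := (Submodule.nontrivial_iff_ne_bot).2 hne
  refine { exists_pair_ne := ⟨⊥, ⊤, fun h => ?_⟩, eq_bot_or_eq_top := fun U => ?_ }
  · have := congrArg Subrepresentation.toSubmodule h
    exact bot_ne_top (α := Submodule ℂ S.toSubmodule) this
  · refine (hU U).imp (fun h => ?_) fun h => ?_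
    · apply Subrepresentation.toSubmodule_injective
      exact Submodule.map_injective_of_injective S.toSubmodule.injective_subtype
        (h.trans (Submodule.map_bot _).symm)
    · apply Subrepresentation.toSubmodule_injective
      refine Submodule.map_injective_of_injective S.toSubmodule.injective_subtype (h.trans ?_)
      exact (Submodule.map_subtype_top _).symm

/-- Over the group algebra a semisimple module is an independent sum of simple submodules; finite
dimension makes it Noetherian, so there are finitely many. Simple submodules are the atoms among the
subrepresentations. -/
theorem exists_irreducible_isInternal (ρ : Representation ℂ G V) [Module.Finite ℂ V]
    (hρ : ρ.IsSemisimpleRepresentation) :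
    ∃ (n : ℕ) (S : Fin n → Subrepresentation ρ),
      DirectSum.IsInternal (fun i => (S i).toSubmodule) ∧
        ∀ i, (S i).toRepresentation.IsIrreducible := by
  have hss := (isSemisimpleRepresentation_iff_isSemisimpleModule_asModule ρ).1 hρ
  obtain ⟨s, hind, htop, hsimple⟩ :=
    IsSemisimpleModule.exists_sSupIndep_sSup_simples_eq_top (MonoidAlgebra ℂ G) ρ.asModule
  have : Module.Finite ℂ ρ.asModule := inferInstanceAs (Module.Finite ℂ V)
  have : IsScalarTower ℂ (MonoidAlgebra ℂ G) ρ.asModule := inferInstance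
  have : IsNoetherian (MonoidAlgebra ℂ G) ρ.asModule := isNoetherian_of_tower ℂ inferInstance
  have hfin : Finite s := WellFoundedGT.finite_of_iSupIndep ((sSupIndep_iff _).mp hind)
    fun S => (isSimpleModule_iff_isAtom.1 (hsimple S.1 S.2)).1
  let e := Finite.equivFin s
  refine ⟨Nat.card s, fun i => Subrepresentation.ofSubmodule' (e.symm i).1, ?_, fun i => ?_⟩
  · have h := DirectSum.isInternal_submodule_of_iSupIndep_of_iSup_eq_top
      (A := fun i => (e.symm i).1) (((sSupIndep_iff _).mp hind).comp e.symm.injective) (by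
        rw [e.symm.iSup_comp (g := fun x : s => x.1), ← sSup_eq_iSup', htop])
    exact h
  · refine isIrreducible_of_isAtom ?_
    have := isSimpleModule_iff_isAtom.1 (hsimple (e.symm i).1 (e.symm i).2)
    exact (Subrepresentation.subrepresentationSubmoduleOrderIso (ρ := ρ)).symm.isAtom_iff _ |>.2 this

lemma isSemisimple_of_surjective {ρ : Representation ℂ G V} {σ : Representation ℂ G W}
    (f : IntertwiningMap ρ σ) (hf : Function.Surjective f) (hρ : ρ.IsSemisimpleRepresentation) :
    σ.IsSemisimpleRepresentation := by
  rw [isSemisimpleRepresentation_iff_isSemisimpleModule_asModule] at hρ ⊢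
  exact IsSemisimpleModule.of_surjective (IntertwiningMap.equivLinearMapAsModule ρ σ f) hf

/-- For a unitary action the orthogonal complement of an invariant subspace is invariant. -/
lemma isSemisimple_of_inner {E : Type} [NormedAddCommGroup E] [InnerProductSpace ℂ E]
    [FiniteDimensional ℂ E] (ρ : Representation ℂ G E)
    (h : ∀ g u v, inner ℂ (ρ g u) (ρ g v) = inner ℂ u v) : ρ.IsSemisimpleRepresentation := by
  refine ⟨fun S => ⟨⟨S.toSubmoduleᗮ, fun g v hv => ?_⟩, ?_⟩⟩
  · rw [Submodule.mem_orthogonal] at hv ⊢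
    intro u hu
    have h1 := hv _ (S.apply_mem_toSubmodule g⁻¹ hu)
    rw [← h g, ← Module.End.mul_apply, ← map_mul] at h1
    simpa using h1
  · have hc := S.toSubmodule.isCompl_orthogonal
    rw [isCompl_iff, disjoint_iff, codisjoint_iff] at hc ⊢
    exact ⟨Subrepresentation.toSubmodule_injective hc.1,
      Subrepresentation.toSubmodule_injective hc.2⟩

/-- The equivariant projections of an internal direct sum. -/
lemma exists_projections {ρ : Representation ℂ G V} {n : ℕ} {S : Fin n → Subrepresentation ρ}
    (hS : DirectSum.IsInternal fun i => (S i).toSubmodule) :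
    ∃ p : ∀ i, IntertwiningMap ρ (S i).toRepresentation,
      (∀ v, ∑ i, (p i v : V) = v) ∧
      ∀ i (w : ∀ j, (S j).toSubmodule), p i (∑ j, (w j : V)) = w i := by
  classical
  let e := LinearEquiv.ofBijective (DirectSum.coeLinearMap fun i => (S i).toSubmodule) hS
  have he : ∀ w : ∀ j, (S j).toSubmodule,
      e ((DirectSum.linearEquivFunOnFintype ℂ (Fin n) fun i => (S i).toSubmodule).symm w) =
        ∑ j, (w j : V) := by
    intro w
    change DirectSum.coeLinearMap (fun i => (S i).toSubmodule) _ = _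
    rw [DirectSum.coeLinearMap_eq_dfinsuppSum, DFinsupp.sum_eq_sum_fintype]
    · rfl
    · simp
  let q : ∀ i, V →ₗ[ℂ] (S i).toSubmodule := fun i =>
    LinearMap.proj i ∘ₗ (DirectSum.linearEquivFunOnFintype ℂ (Fin n)
      fun i => (S i).toSubmodule).toLinearMap ∘ₗ e.symm.toLinearMap
  have hq : ∀ i (w : ∀ j, (S j).toSubmodule), q i (∑ j, (w j : V)) = w i := by
    intro i w
    simp only [q, LinearMap.comp_apply, ← he w, LinearEquiv.coe_coe, LinearEquiv.symm_apply_apply,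
      LinearEquiv.apply_symm_apply, LinearMap.proj_apply]
  have hsum : ∀ v, ∃ w : ∀ j, (S j).toSubmodule, ∑ j, (w j : V) = v := by
    intro v
    refine ⟨DirectSum.linearEquivFunOnFintype ℂ (Fin n) (fun i => (S i).toSubmodule) (e.symm v), ?_⟩
    rw [← he, LinearEquiv.symm_apply_apply, LinearEquiv.apply_symm_apply]
  refine ⟨fun i => ⟨q i, fun g => LinearMap.ext fun v => ?_⟩, fun v => ?_, hq⟩
  · obtain ⟨w, rfl⟩ := hsum v
    simp only [LinearMap.comp_apply, hq]
    rw [map_sum]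
    exact hq i fun j => (S j).toRepresentation g (w j)
  · obtain ⟨w, rfl⟩ := hsum v
    exact Finset.sum_congr rfl fun i _ => congrArg Subtype.val (hq i w)

/-- The inclusion of a subrepresentation. -/
def inclusion {ρ : Representation ℂ G V} (S : Subrepresentation ρ) :
    IntertwiningMap S.toRepresentation ρ :=
  ⟨S.toSubmodule.subtype, fun _ => rfl⟩

/-- A homomorphism into a direct sum is the tuple of its compositions with the equivariant
projections. -/
lemma finrank_hom_isInternal [Module.Finite ℂ V] [Module.Finite ℂ W] {ρ : Representation ℂ G V}
    {n : ℕ} {S : Fin n → Subrepresentation ρ}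
    (hS : DirectSum.IsInternal fun i => (S i).toSubmodule) (σ : Representation ℂ G W) :
    Module.finrank ℂ (IntertwiningMap σ ρ) =
      ∑ i, Module.finrank ℂ (IntertwiningMap σ (S i).toRepresentation) := by
  obtain ⟨p, hp, hp'⟩ := exists_projections hS
  rw [← Module.finrank_pi_fintype]
  refine LinearEquiv.finrank_eq (LinearEquiv.ofBijective
    (LinearMap.pi fun i => IntertwiningMap.llcomp σ ρ (S i).toRepresentation (p i)) ⟨?_, ?_⟩)
  · intro f g h
    apply IntertwiningMap.ext
    ext v
    have h1 : ∀ i, p i (f v) = p i (g v) := fun i =>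
      congrArg (fun F : IntertwiningMap σ (S i).toRepresentation => F v) (congrFun h i)
    change f v = g v
    rw [← hp (f v), ← hp (g v)]
    simp only [h1]
  · intro f
    refine ⟨∑ i, (inclusion (S i)).comp (f i), ?_⟩
    funext i
    apply IntertwiningMap.ext
    ext v
    change ((p i ((∑ i, (inclusion (S i)).comp (f i)) v) : (S i).toSubmodule) : V) = f i v
    rw [IntertwiningMap.sum_apply]
    exact congrArg Subtype.val (hp' i fun j => f j v)

/-- Schur's lemma over `ℂ`: an isomorphism transports the space to the endomorphisms of `σ`, which
are scalars. -/
lemma finrank_hom_of_irreducible [Module.Finite ℂ V] [Module.Finite ℂ W]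
    {ρ : Representation ℂ G V} {σ : Representation ℂ G W} (hρ : ρ.IsIrreducible)
    (hσ : σ.IsIrreducible) [Decidable (Nonempty (Representation.Equiv σ ρ))] :
    Module.finrank ℂ (IntertwiningMap σ ρ) = if Nonempty (Representation.Equiv σ ρ) then 1 else 0 := by
  split_ifs with h
  · obtain ⟨e⟩ := h
    rw [← IsIrreducible.finrank_intertwiningMap_self σ]
    refine LinearEquiv.finrank_eq (LinearEquiv.ofBijective
      (IntertwiningMap.llcomp σ ρ σ e.symm.toIntertwiningMap) ⟨?_, ?_⟩)
    · intro f g hfg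
      apply IntertwiningMap.ext
      ext v
      have : e.symm (f v) = e.symm (g v) :=
        congrArg (fun F : IntertwiningMap σ σ => F v) hfg
      exact EquivLike.injective e.symm this
    · intro f
      refine ⟨e.toIntertwiningMap.comp f, ?_⟩
      apply IntertwiningMap.ext
      ext v
      exact e.symm_apply_apply (f v)
  · have : IsEmpty (Representation.Equiv σ ρ) := not_nonempty_iff.1 h
    exact Module.finrank_zero_of_subsingleton

end General

end Kron
end

noncomputable section
namespace Kron

/-! ### The maximal torus and its characters -/

/-- The maximal torus of `U(a) × U(b) × U(c)`. -/
abbrev Torus (a b c : ℕ) : Type := (Fin a → Circle) × (Fin b → Circle) × (Fin c → Circle)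

lemma diagU_one (d : ℕ) : diagU (1 : Fin d → Circle) = 1 := by
  apply Subtype.ext
  simp [diagU]

lemma diagU_mul {d : ℕ} (s t : Fin d → Circle) : diagU (s * t) = diagU s * diagU t := by
  apply Subtype.ext
  simp [diagU]

/-- The inclusion of the maximal torus. -/
def torusHom (a b c : ℕ) : Torus a b c →* H a b c where
  toFun x := (diagU x.1, diagU x.2.1, diagU x.2.2)
  map_one' := by simp [diagU_one]
  map_mul' x y := by simp [diagU_mul]

/-- The character of the torus of weight `δ`. -/
def chi {a b c : ℕ} (δ : Weight a b c) : Torus a b c →* ℂ where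
  toFun x := (∏ i, (x.1 i : ℂ) ^ δ.1 i) * (∏ i, (x.2.1 i : ℂ) ^ δ.2.1 i) *
    ∏ i, (x.2.2 i : ℂ) ^ δ.2.2 i
  map_one' := by simp
  map_mul' x y := by
    simp only [Prod.fst_mul, Prod.snd_mul, Pi.mul_apply, Circle.coe_mul, mul_zpow,
      Finset.prod_mul_distrib]
    ring

lemma chi_apply {a b c : ℕ} (δ : Weight a b c) (x : Torus a b c) :
    chi δ x = (∏ i, (x.1 i : ℂ) ^ δ.1 i) * (∏ i, (x.2.1 i : ℂ) ^ δ.2.1 i) *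
      ∏ i, (x.2.2 i : ℂ) ^ δ.2.2 i := rfl

/-! ### Characters of the torus and weight spaces. -/

section

variable {a b c : ℕ} {V W : Type} [AddCommGroup V] [Module ℂ V] [AddCommGroup W] [Module ℂ W]

lemma mem_weightSpace {ρ : Representation ℂ (H a b c) V} {δ : Weight a b c} {v : V} :
    v ∈ weightSpace ρ δ ↔ ∀ x, ρ (torusHom a b c x) v = chi δ x • v := by
  simp only [weightSpace, Submodule.mem_iInf, Module.End.mem_eigenspace_iff]
  exact ⟨fun h x => h x.1 x.2.1 x.2.2, fun h s t u => h (s, t, u)⟩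

lemma exists_circle_zpow_ne {m n : ℤ} (h : m ≠ n) : ∃ z : Circle, (z : ℂ) ^ m ≠ (z : ℂ) ^ n := by
  have h0 : ((m - n : ℤ) : ℝ) ≠ 0 := by exact_mod_cast sub_ne_zero.2 h
  -- Chosen so that `z ^ (m - n)` is `exp (π i) = -1`.
  let z := Circle.exp (Real.pi / ((m - n : ℤ) : ℝ))
  refine ⟨z, fun he => ?_⟩
  have hz : (z : ℂ) ≠ 0 := Circle.coe_ne_zero z
  have h1 : (z : ℂ) ^ (m - n) = 1 := by rw [zpow_sub₀ hz, he, div_self (zpow_ne_zero _ hz)]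
  have h2 : z ^ (m - n) = Circle.exp Real.pi := by
    rw [← Circle.exp_zsmul]
    congr 1
    rw [zsmul_eq_mul, mul_div_cancel₀ _ h0]
  have h3 : ((z ^ (m - n) : Circle) : ℂ) = -1 := by
    rw [h2]
    simp
  rw [Circle.coe_zpow, h1] at h3
  norm_num at h3

lemma prod_coe_mulSingle_zpow {n : ℕ} (i : Fin n) (z : Circle) (δ : Fin n → ℤ) :
    ∏ j, ((Pi.mulSingle i z : Fin n → Circle) j : ℂ) ^ δ j = (z : ℂ) ^ δ i := by
  rw [Finset.prod_eq_single i]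
  · simp
  · intro j _ hj
    simp [Pi.mulSingle_eq_of_ne hj]
  · simp

lemma chi_injective : Function.Injective (chi : Weight a b c → Torus a b c →* ℂ) := by
  intro δ ε h
  by_contra hne
  have hex : (∃ i, δ.1 i ≠ ε.1 i) ∨ (∃ i, δ.2.1 i ≠ ε.2.1 i) ∨ ∃ i, δ.2.2 i ≠ ε.2.2 i := by
    by_contra hcon
    push Not at hcon
    exact hne (Prod.ext (funext hcon.1) (Prod.ext (funext hcon.2.1) (funext hcon.2.2)))
  obtain ⟨i, hi⟩ | ⟨i, hi⟩ | ⟨i, hi⟩ := hex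
  · obtain ⟨z, hz⟩ := exists_circle_zpow_ne hi
    have := DFunLike.congr_fun h (Pi.mulSingle i z, 1, 1)
    simp only [chi_apply, prod_coe_mulSingle_zpow, Pi.one_apply, Circle.coe_one, one_zpow,
      Finset.prod_const_one, mul_one] at this
    exact hz this
  · obtain ⟨z, hz⟩ := exists_circle_zpow_ne hi
    have := DFunLike.congr_fun h (1, Pi.mulSingle i z, 1)
    simp only [chi_apply, prod_coe_mulSingle_zpow, Pi.one_apply, Circle.coe_one, one_zpow,
      Finset.prod_const_one, mul_one, one_mul] at this
    exact hz this
  · obtain ⟨z, hz⟩ := exists_circle_zpow_ne hi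
    have := DFunLike.congr_fun h (1, 1, Pi.mulSingle i z)
    simp only [chi_apply, prod_coe_mulSingle_zpow, Pi.one_apply, Circle.coe_one, one_zpow,
      Finset.prod_const_one, mul_one, one_mul] at this
    exact hz this

/-- Dedekind's independence of distinct characters. It replaces integration over the torus whenever
Fourier coefficients are compared. -/
lemma linearIndependent_chi :
    LinearIndependent ℂ (fun δ : Weight a b c => (chi δ : Torus a b c → ℂ)) :=
  (linearIndependent_monoidHom (Torus a b c) ℂ).comp chi chi_injective

/-- Coefficients of characters in a vector space are unique. -/
lemma eq_zero_of_sum_chi_smul {D : Finset (Weight a b c)} {w : Weight a b c → V}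
    (h : ∀ x, ∑ δ ∈ D, chi δ x • w δ = 0) : ∀ δ ∈ D, w δ = 0 := by
  intro δ hδ
  rw [← Module.forall_dual_apply_eq_zero_iff ℂ]
  intro l
  refine linearIndependent_iff'.1 linearIndependent_chi D (fun δ => l (w δ)) (funext fun x => ?_) δ hδ
  have := congrArg l (h x)
  simpa [mul_comm] using this

/-- The multiplicity of a weight in terms of a basis of weight vectors. -/
lemma weightMult_eq_card {ι : Type} [Fintype ι] {ρ : Representation ℂ (H a b c) V}
    (B : Module.Basis ι ℂ V) (w : ι → Weight a b c) (hB : ∀ i, B i ∈ weightSpace ρ (w i))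
    (δ : Weight a b c) : weightMult ρ δ = Nat.card {i // w i = δ} := by
  have hspan : weightSpace ρ δ = Submodule.span ℂ (Set.range fun i : {i // w i = δ} => B i) := by
    apply le_antisymm
    · intro v hv
      rw [mem_weightSpace] at hv
      rw [← B.sum_repr v]
      refine Submodule.sum_mem _ fun i _ => ?_
      by_cases hi : w i = δ
      · exact Submodule.smul_mem _ _ (Submodule.subset_span ⟨⟨i, hi⟩, rfl⟩)
      · have h0 : B.repr v i = 0 := by
          by_contra h0
          apply hi
          apply chi_injective
          ext x
          have h1 := hv x
          have h2 : ρ (torusHom a b c x) v = ∑ j, (B.repr v j * chi (w j) x) • B j := by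
            conv_lhs => rw [← B.sum_repr v]
            rw [map_sum]
            refine Finset.sum_congr rfl fun j _ => ?_
            rw [map_smul, mem_weightSpace.1 (hB j), smul_smul]
          rw [h2] at h1
          have h3 := DFunLike.congr_fun (congrArg B.repr h1) i
          rw [B.repr_sum_self, map_smul, Finsupp.smul_apply, smul_eq_mul, mul_comm] at h3
          exact mul_right_cancel₀ h0 h3
        rw [h0, zero_smul]
        exact Submodule.zero_mem _
    · rw [Submodule.span_le]
      rintro _ ⟨⟨i, rfl⟩, rfl⟩
      exact hB i
  classical
  rw [weightMult, hspan, Nat.card_eq_fintype_card]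
  exact finrank_span_eq_card (B.linearIndependent.comp _ Subtype.val_injective)

open Representation

lemma IntertwiningMap_mem_weightSpace {ρ : Representation ℂ (H a b c) V}
    {σ : Representation ℂ (H a b c) W} (f : IntertwiningMap ρ σ) {δ : Weight a b c} {v : V}
    (hv : v ∈ weightSpace ρ δ) : f v ∈ weightSpace σ δ := by
  rw [mem_weightSpace] at hv ⊢
  intro x
  rw [← f.isIntertwining, hv, map_smul]

lemma weightMult_congr {ρ : Representation ℂ (H a b c) V} {σ : Representation ℂ (H a b c) W}
    (e : Representation.Equiv ρ σ) (δ : Weight a b c) : weightMult ρ δ = weightMult σ δ := by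
  refine LinearEquiv.finrank_eq (LinearEquiv.ofLinearMap
    (e.toLinearMap.restrict (p := weightSpace ρ δ) (q := weightSpace σ δ) fun v hv =>
      IntertwiningMap_mem_weightSpace e.toIntertwiningMap hv)
    (e.symm.toLinearMap.restrict fun v hv =>
      IntertwiningMap_mem_weightSpace e.symm.toIntertwiningMap hv) ?_ ?_)
  · ext v
    exact e.apply_symm_apply v.1
  · ext v
    exact e.symm_apply_apply v.1

lemma weightMult_isInternal [Module.Finite ℂ V] {ρ : Representation ℂ (H a b c) V} {n : ℕ}
    {S : Fin n → Subrepresentation ρ} (hS : DirectSum.IsInternal fun i => (S i).toSubmodule)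
    (δ : Weight a b c) : weightMult ρ δ = ∑ i, weightMult (S i).toRepresentation δ := by
  obtain ⟨p, hp, hp'⟩ := exists_projections hS
  unfold weightMult
  rw [← Module.finrank_pi_fintype]
  refine LinearEquiv.finrank_eq (LinearEquiv.ofBijective
    (LinearMap.pi fun i => (p i).toLinearMap.restrict (p := weightSpace ρ δ)
      (q := weightSpace (S i).toRepresentation δ)
      fun v hv => IntertwiningMap_mem_weightSpace (p i) hv) ⟨?_, ?_⟩)
  · intro v w h
    have h1 : ∀ i, p i v.1 = p i w.1 := fun i => congrArg Subtype.val (congrFun h i)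
    apply Subtype.ext
    rw [← hp v.1, ← hp w.1]
    simp only [h1]
  · intro w
    refine ⟨⟨∑ i, ((w i).1 : V), Submodule.sum_mem _ fun i _ =>
      IntertwiningMap_mem_weightSpace (inclusion (S i)) (w i).2⟩, ?_⟩
    funext i
    apply Subtype.ext
    exact hp' i fun j => (w j).1

lemma weightMult_ne_zero_iff [Module.Finite ℂ V] {ρ : Representation ℂ (H a b c) V}
    {δ : Weight a b c} : weightMult ρ δ ≠ 0 ↔ weightSpace ρ δ ≠ ⊥ := by
  rw [weightMult, Ne, Submodule.finrank_eq_zero]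

end

/-! ### Symmetry of the weights -/

/-- A permutation matrix as a unitary matrix. -/
def permU {d : ℕ} (σ : Equiv.Perm (Fin d)) : Matrix.unitaryGroup (Fin d) ℂ :=
  ⟨σ.permMatrix ℂ, by
    rw [Matrix.mem_unitaryGroup_iff, Matrix.star_eq_conjTranspose, Matrix.conjTranspose_permMatrix,
      ← Matrix.permMatrix_mul]
    simp⟩

lemma diagU_mul_permU {d : ℕ} (σ : Equiv.Perm (Fin d)) (t : Fin d → Circle) :
    diagU t * permU σ = permU σ * diagU (t ∘ σ.symm) := by
  apply Subtype.ext
  ext i j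
  simp only [diagU, permU, Submonoid.coe_mul, Matrix.diagonal_mul, Matrix.mul_diagonal,
    Function.comp_apply, Equiv.Perm.permMatrix, PEquiv.toMatrix_apply, Equiv.toPEquiv_apply,
    Option.mem_def, Option.some.injEq]
  split_ifs with h
  · subst h
    simp
  · simp

lemma prod_comp_symm_zpow {d : ℕ} (σ : Equiv.Perm (Fin d)) (t : Fin d → Circle) (δ : Fin d → ℤ) :
    ∏ i, ((t ∘ σ.symm) i : ℂ) ^ δ i = ∏ i, (t i : ℂ) ^ (δ ∘ σ) i :=
  Fintype.prod_equiv σ.symm _ _ fun i => by simp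

section

variable {a b c : ℕ} {V : Type} [AddCommGroup V] [Module ℂ V]

/-- Conjugation by `g` acts on the torus through `θ`, so `ρ g` carries vectors of weight `δ` to
vectors of weight `ε`. With permutation matrices for `g` this is the Weyl group symmetry of the
weights. -/
lemma weightSpace_ne_bot_of_conj {ρ : Representation ℂ (H a b c) V} {δ ε : Weight a b c}
    (g : H a b c) (θ : Torus a b c → Torus a b c)
    (hg : ∀ x, torusHom a b c x * g = g * torusHom a b c (θ x)) (hθ : ∀ x, chi δ (θ x) = chi ε x)
    (h : weightSpace ρ δ ≠ ⊥) : weightSpace ρ ε ≠ ⊥ := by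
  obtain ⟨v, hv, hv0⟩ := Submodule.exists_mem_ne_zero_of_ne_bot h
  rw [Submodule.ne_bot_iff]
  refine ⟨ρ g v, ?_, fun h0 => hv0 ?_⟩
  · rw [mem_weightSpace] at hv ⊢
    intro x
    rw [← Module.End.mul_apply, ← map_mul, hg, map_mul, Module.End.mul_apply, hv, map_smul, hθ]
  · have := congrArg (ρ g⁻¹) h0
    rwa [← Module.End.mul_apply, ← map_mul, inv_mul_cancel, map_one, map_zero] at this

lemma weightSpace_perm₁ {ρ : Representation ℂ (H a b c) V} {δ : Weight a b c}
    (σ : Equiv.Perm (Fin a)) (h : weightSpace ρ δ ≠ ⊥) : weightSpace ρ (δ.1 ∘ σ, δ.2) ≠ ⊥ := by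
  refine weightSpace_ne_bot_of_conj (permU σ, 1, 1) (fun x => (x.1 ∘ σ.symm, x.2)) (fun x => ?_)
    (fun x => ?_) h
  · exact Prod.ext (diagU_mul_permU σ x.1) (Prod.ext (by simp [torusHom]) (by simp [torusHom]))
  · simp only [chi_apply, prod_comp_symm_zpow]

lemma weightSpace_perm₂ {ρ : Representation ℂ (H a b c) V} {δ : Weight a b c}
    (σ : Equiv.Perm (Fin b)) (h : weightSpace ρ δ ≠ ⊥) :
    weightSpace ρ (δ.1, δ.2.1 ∘ σ, δ.2.2) ≠ ⊥ := by
  refine weightSpace_ne_bot_of_conj (1, permU σ, 1) (fun x => (x.1, x.2.1 ∘ σ.symm, x.2.2))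
    (fun x => ?_) (fun x => ?_) h
  · exact Prod.ext (by simp [torusHom]) (Prod.ext (diagU_mul_permU σ x.2.1) (by simp [torusHom]))
  · simp only [chi_apply, prod_comp_symm_zpow]

lemma weightSpace_perm₃ {ρ : Representation ℂ (H a b c) V} {δ : Weight a b c}
    (σ : Equiv.Perm (Fin c)) (h : weightSpace ρ δ ≠ ⊥) :
    weightSpace ρ (δ.1, δ.2.1, δ.2.2 ∘ σ) ≠ ⊥ := by
  refine weightSpace_ne_bot_of_conj (1, 1, permU σ) (fun x => (x.1, x.2.1, x.2.2 ∘ σ.symm))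
    (fun x => ?_) (fun x => ?_) h
  · exact Prod.ext (by simp [torusHom]) (Prod.ext (by simp [torusHom]) (diagU_mul_permU σ x.2.2))
  · simp only [chi_apply, prod_comp_symm_zpow]

end

end Kron
end

noncomputable section
namespace Kron

/-! ### Polynomial representations -/

/-- The words of length `k` in the index set of `ℂ^{abc}`. -/
abbrev Word (a b c k : ℕ) : Type := Fin k → Fin a × Fin b × Fin c

/-- The matrix of `g` on the `k`-th tensor power of `ℂ^{abc}`. -/
def tensorMat {a b c k : ℕ} (g : H a b c) : Matrix (Word a b c k) (Word a b c k) ℂ :=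
  .of fun w w' => ∏ p, (tensorHom a b c g : Matrix _ _ ℂ) (w p) (w' p)

/-- The number of occurrences of each letter. -/
def content {I : Type} [DecidableEq I] {k : ℕ} (u : Fin k → I) (i : I) : ℕ := ∑ p, if u p = i then 1 else 0

/-- The contents of the three components of a word. -/
def wordContent {a b c k : ℕ} (w : Word a b c k) : (Fin a → ℕ) × (Fin b → ℕ) × (Fin c → ℕ) :=
  (content fun p => (w p).1, content fun p => (w p).2.1, content fun p => (w p).2.2)

/-- The weight of a word. -/
def wt {a b c k : ℕ} (w : Word a b c k) : Weight a b c := natWeight (wordContent w)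

/-- The matrix coefficients of the `k`-th tensor power of `ℂ^{abc}`. -/
def polySpace (a b c k : ℕ) : Submodule ℂ (H a b c → ℂ) :=
  Submodule.span ℂ (Set.range fun w : Word a b c k × Word a b c k => fun g => tensorMat g w.1 w.2)

/-- All matrix coefficients of `ρ` are matrix coefficients of the `k`-th tensor power. -/
def IsPoly {a b c : ℕ} {V : Type} [AddCommGroup V] [Module ℂ V] (k : ℕ)
    (ρ : Representation ℂ (H a b c) V) : Prop :=
  ∀ (v : V) (l : Module.Dual ℂ V), (fun g => l (ρ g v)) ∈ polySpace a b c k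

lemma tensorMat_mul {a b c k : ℕ} (g h : H a b c) :
    (tensorMat (g * h) : Matrix (Word a b c k) _ ℂ) = tensorMat g * tensorMat h := by
  ext w w'
  simp only [tensorMat, Matrix.of_apply, map_mul, Submonoid.coe_mul, Matrix.mul_apply,
    Finset.prod_univ_sum, Fintype.piFinset_univ, Finset.prod_mul_distrib]

lemma tensorMat_one {a b c k : ℕ} :
    (tensorMat (1 : H a b c) : Matrix (Word a b c k) _ ℂ) = 1 := by
  ext w w'
  simp only [tensorMat, Matrix.of_apply, map_one, Submonoid.coe_one, Matrix.one_apply,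
    Finset.prod_ite_zero, Finset.prod_const_one, funext_iff, Finset.mem_univ, forall_const]

lemma tensorMat_apply {a b c k : ℕ} (g : H a b c) (w w' : Word a b c k) :
    tensorMat g w w' = (∏ p, (g.1 : Matrix _ _ ℂ) (w p).1 (w' p).1) *
      (∏ p, (g.2.1 : Matrix _ _ ℂ) (w p).2.1 (w' p).2.1) *
      ∏ p, (g.2.2 : Matrix _ _ ℂ) (w p).2.2 (w' p).2.2 := by
  simp [tensorMat, tensorHom, Finset.prod_mul_distrib, mul_assoc]

lemma prod_letters {I R : Type} [Fintype I] [DecidableEq I] [CommMonoid R] {k : ℕ} (u : Fin k → I)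
    (t : I → R) :
    ∏ p, t (u p) = ∏ i, t i ^ content u i := by
  simp only [content, ← Finset.prod_pow_eq_pow_sum]
  rw [Finset.prod_comm]
  refine Finset.prod_congr rfl fun p _ => ?_
  rw [Finset.prod_eq_single (u p)]
  · simp
  · intro i _ hi
    rw [if_neg (Ne.symm hi), pow_zero]
  · simp

lemma chi_wt {a b c k : ℕ} (w : Word a b c k) (x : Torus a b c) :
    chi (wt w) x = (∏ p, (x.1 (w p).1 : ℂ)) * (∏ p, (x.2.1 (w p).2.1 : ℂ)) *
      ∏ p, (x.2.2 (w p).2.2 : ℂ) := by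
  rw [prod_letters (fun p => (w p).1) fun i => (x.1 i : ℂ),
    prod_letters (fun p => (w p).2.1) fun i => (x.2.1 i : ℂ),
    prod_letters (fun p => (w p).2.2) fun i => (x.2.2 i : ℂ), chi_apply]
  simp only [wt, natWeight, wordContent, zpow_natCast]

lemma tensorMat_torusHom {a b c k : ℕ} (x : Torus a b c) :
    (tensorMat (torusHom a b c x) : Matrix (Word a b c k) _ ℂ) =
      Matrix.diagonal fun w => chi (wt w) x := by
  ext w w'
  rw [tensorMat_apply]
  by_cases h : w = w'
  · subst h
    rw [Matrix.diagonal_apply_eq, chi_wt]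
    simp [torusHom, diagU]
  · rw [Matrix.diagonal_apply_ne _ h]
    obtain ⟨p, hp⟩ := Function.ne_iff.1 h
    have hp' : (w p).1 ≠ (w' p).1 ∨ (w p).2.1 ≠ (w' p).2.1 ∨ (w p).2.2 ≠ (w' p).2.2 := by
      by_contra hcon
      push Not at hcon
      exact hp (Prod.ext hcon.1 (Prod.ext hcon.2.1 hcon.2.2))
    obtain hp | hp | hp := hp'
    · rw [Finset.prod_eq_zero (Finset.mem_univ p) (by simp [torusHom, diagU, hp]), zero_mul,
        zero_mul]
    · rw [Finset.prod_eq_zero (s := Finset.univ)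
        (f := fun p => (torusHom a b c x).2.1.1 (w p).2.1 (w' p).2.1) (Finset.mem_univ p)
        (by simp [torusHom, diagU, hp]), mul_zero, zero_mul]
    · rw [Finset.prod_eq_zero (s := Finset.univ)
        (f := fun p => (torusHom a b c x).2.2.1 (w p).2.2 (w' p).2.2) (Finset.mem_univ p)
        (by simp [torusHom, diagU, hp]), mul_zero]

/-! ### Weight projections and weights of polynomial representations. -/

section

variable {a b c k : ℕ} {V W : Type} [AddCommGroup V] [Module ℂ V] [AddCommGroup W] [Module ℂ W]

lemma IsPoly.sub {ρ : Representation ℂ (H a b c) V} (h : IsPoly k ρ) (S : Subrepresentation ρ) :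
    IsPoly k S.toRepresentation := by
  intro v l
  obtain ⟨l', rfl⟩ := LinearMap.exists_extend l
  exact h v.1 l'

lemma IsPoly.of_surjective {ρ : Representation ℂ (H a b c) V} {σ : Representation ℂ (H a b c) W}
    (h : IsPoly k ρ) (f : ρ.IntertwiningMap σ) (hf : Function.Surjective f) : IsPoly k σ := by
  intro v l
  obtain ⟨u, rfl⟩ := hf v
  have h1 := h u (l ∘ₗ f.toLinearMap)
  convert h1 using 2 with g
  exact congrArg l (Representation.IntertwiningMap.isIntertwining _ _ f g u).symm

/-- The finite set of weights of words. -/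
def wordWeights (a b c k : ℕ) : Finset (Weight a b c) :=
  Finset.univ.image (wt : Word a b c k → Weight a b c)

/-- The torus acts diagonally on the tensor power, by the characters of the weights of words;
off-diagonal coefficients vanish there. -/
lemma mem_span_chi_of_mem_polySpace {f : H a b c → ℂ} (hf : f ∈ polySpace a b c k) :
    (fun x => f (torusHom a b c x)) ∈ Submodule.span ℂ
      ((fun δ : Weight a b c => (chi δ : Torus a b c → ℂ)) '' (wordWeights a b c k : Set _)) := by
  have h1 : (LinearMap.funLeft ℂ ℂ (torusHom a b c)) f ∈
      (polySpace a b c k).map (LinearMap.funLeft ℂ ℂ (torusHom a b c)) := ⟨f, hf, rfl⟩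
  refine (?_ : (polySpace a b c k).map (LinearMap.funLeft ℂ ℂ (torusHom a b c)) ≤ _) h1
  rw [polySpace, Submodule.map_span_le]
  rintro _ ⟨⟨w, w'⟩, rfl⟩
  by_cases h : w = w'
  · subst h
    refine Submodule.subset_span ⟨wt w, by simp [wordWeights], ?_⟩
    funext x
    simp [LinearMap.funLeft_apply, tensorMat_torusHom]
  · convert Submodule.zero_mem _
    funext x
    simp [LinearMap.funLeft_apply, tensorMat_torusHom, h]

/-- In a basis every matrix entry of the torus action is a finite combination of characters.
Collecting coefficients gives the operators `E δ`, which play the role of projections onto weight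
spaces. -/
lemma exists_weightOps [Module.Finite ℂ V] {ρ : Representation ℂ (H a b c) V} (h : IsPoly k ρ) :
    ∃ E : Weight a b c → V →ₗ[ℂ] V,
      ∀ x, ρ (torusHom a b c x) = ∑ δ ∈ wordWeights a b c k, chi δ x • E δ := by
  classical
  let B := Module.finBasis ℂ V
  have h1 : ∀ i j, ∃ z : Weight a b c → ℂ, ∀ x, B.repr (ρ (torusHom a b c x) (B j)) i =
      ∑ δ ∈ wordWeights a b c k, z δ * chi δ x := by
    intro i j
    have := mem_span_chi_of_mem_polySpace (h (B j) (B.coord i))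
    rw [Submodule.mem_span_image_finset_iff_exists_fun] at this
    obtain ⟨z, hz⟩ := this
    refine ⟨fun δ => if h : δ ∈ wordWeights a b c k then z ⟨δ, h⟩ else 0, fun x => ?_⟩
    have hx := congrFun hz x
    simp only [Finset.sum_apply, Pi.smul_apply, smul_eq_mul, Module.Basis.coord_apply] at hx
    rw [← hx, ← Finset.sum_coe_sort (wordWeights a b c k)]
    exact Finset.sum_congr rfl fun δ _ => by simp only [δ.2, ↓reduceDIte]
  choose z hz using h1
  refine ⟨fun δ => Matrix.toLin B B (.of fun i j => z i j δ), fun x => ?_⟩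
  refine B.ext fun j => B.ext_elem fun i => ?_
  rw [hz, LinearMap.sum_apply, map_sum, Finsupp.finsetSum_apply]
  refine Finset.sum_congr rfl fun δ _ => ?_
  rw [LinearMap.smul_apply, map_smul, Finsupp.smul_apply, Matrix.toLin_self, B.repr_sum_self,
    smul_eq_mul, mul_comm, Matrix.of_apply]

/-- The functionals of weight `δ`. -/
def dualWeightSpace (ρ : Representation ℂ (H a b c) V) (δ : Weight a b c) :
    Submodule ℂ (Module.Dual ℂ V) where
  carrier := {l | ∀ x v, l (ρ (torusHom a b c x) v) = chi δ x * l v}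
  add_mem' {l l'} h h' x v := by simp [h x v, h' x v, mul_add]
  zero_mem' x v := by simp
  smul_mem' z l h x v := by
    simp only [LinearMap.smul_apply, h x v, smul_eq_mul]
    ring

lemma mem_wordWeights_of_weightSpace {ρ : Representation ℂ (H a b c) V} (h : IsPoly k ρ)
    {δ : Weight a b c} (hδ : weightSpace ρ δ ≠ ⊥) : δ ∈ wordWeights a b c k := by
  obtain ⟨v, hv, hv0⟩ := Submodule.exists_mem_ne_zero_of_ne_bot hδ
  obtain ⟨l, hl⟩ : ∃ l : Module.Dual ℂ V, l v ≠ 0 := by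
    by_contra hcon
    push Not at hcon
    exact hv0 ((Module.forall_dual_apply_eq_zero_iff ℂ v).1 hcon)
  by_contra hmem
  have h1 := mem_span_chi_of_mem_polySpace (h v l)
  refine (linearIndependent_chi (a := a) (b := b) (c := c)).notMem_span_image
    (x := δ) (s := (wordWeights a b c k : Set _)) (by simpa using hmem) ?_
  have h2 := Submodule.smul_mem _ (l v)⁻¹ h1
  convert h2 using 1
  funext x
  rw [Pi.smul_apply, mem_weightSpace.1 hv, map_smul, smul_eq_mul, smul_eq_mul]
  field_simp

lemma mem_wordWeights_of_dualWeightSpace {ρ : Representation ℂ (H a b c) V} (h : IsPoly k ρ)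
    {δ : Weight a b c} (hδ : dualWeightSpace ρ δ ≠ ⊥) : δ ∈ wordWeights a b c k := by
  obtain ⟨l, hl, hl0⟩ := Submodule.exists_mem_ne_zero_of_ne_bot hδ
  obtain ⟨v, hv⟩ : ∃ v, l v ≠ 0 := by
    by_contra hcon
    push Not at hcon
    exact hl0 (LinearMap.ext hcon)
  by_contra hmem
  have h1 := mem_span_chi_of_mem_polySpace (h v l)
  refine (linearIndependent_chi (a := a) (b := b) (c := c)).notMem_span_image
    (x := δ) (s := (wordWeights a b c k : Set _)) (by simpa using hmem) ?_
  have h2 := Submodule.smul_mem _ (l v)⁻¹ h1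
  convert h2 using 1
  funext x
  rw [Pi.smul_apply, hl x v, smul_eq_mul]
  field_simp

/-- Both identities compare the coefficients of `chi δ y`, in `ρ(x) ρ(y) = ρ(xy)` and `ρ(y) ρ(x) =
ρ(yx)` respectively. -/
lemma weightOps_comm {ρ : Representation ℂ (H a b c) V} {E : Weight a b c → V →ₗ[ℂ] V}
    {D : Finset (Weight a b c)} (hE : ∀ x, ρ (torusHom a b c x) = ∑ δ ∈ D, chi δ x • E δ)
    {δ : Weight a b c} (hδ : δ ∈ D) (x : Torus a b c) (v : V) :
    ρ (torusHom a b c x) (E δ v) = chi δ x • E δ v ∧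
      E δ (ρ (torusHom a b c x) v) = chi δ x • E δ v := by
  constructor
  · rw [← sub_eq_zero]
    refine eq_zero_of_sum_chi_smul (D := D)
      (w := fun δ => ρ (torusHom a b c x) (E δ v) - chi δ x • E δ v) (fun y => ?_) δ hδ
    have h1 : ρ (torusHom a b c x) (ρ (torusHom a b c y) v) = ρ (torusHom a b c (x * y)) v := by
      rw [map_mul, map_mul, Module.End.mul_apply]
    rw [hE y, hE (x * y)] at h1
    simp only [LinearMap.sum_apply, LinearMap.smul_apply, map_sum, map_smul, map_mul] at h1
    simp only [smul_sub, Finset.sum_sub_distrib, h1, smul_smul]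
    rw [sub_eq_zero]
    exact Finset.sum_congr rfl fun _ _ => by rw [mul_comm]
  · rw [← sub_eq_zero]
    refine eq_zero_of_sum_chi_smul (D := D)
      (w := fun δ => E δ (ρ (torusHom a b c x) v) - chi δ x • E δ v) (fun y => ?_) δ hδ
    have h1 : ρ (torusHom a b c y) (ρ (torusHom a b c x) v) = ρ (torusHom a b c (y * x)) v := by
      rw [map_mul, map_mul, Module.End.mul_apply]
    rw [hE y, hE (y * x)] at h1
    simp only [LinearMap.sum_apply, LinearMap.smul_apply, map_mul] at h1
    simp only [smul_sub, Finset.sum_sub_distrib, h1, smul_smul, sub_self]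

lemma weightSpace_eq_range {ρ : Representation ℂ (H a b c) V} {E : Weight a b c → V →ₗ[ℂ] V}
    {D : Finset (Weight a b c)} (hE : ∀ x, ρ (torusHom a b c x) = ∑ δ ∈ D, chi δ x • E δ)
    {δ : Weight a b c} (hδ : δ ∈ D) : weightSpace ρ δ = LinearMap.range (E δ) := by
  classical
  apply le_antisymm
  · intro v hv
    rw [mem_weightSpace] at hv
    refine ⟨v, ?_⟩
    rw [← sub_eq_zero]
    have := eq_zero_of_sum_chi_smul (D := D) (w := fun ε => E ε v - if ε = δ then v else 0)
      (fun x => ?_) δ hδ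
    · simpa using this
    · have h1 := hv x
      rw [hE x] at h1
      simp only [LinearMap.sum_apply, LinearMap.smul_apply] at h1
      simp only [smul_sub, Finset.sum_sub_distrib, h1, smul_ite, smul_zero, Finset.sum_ite_eq', hδ,
        if_true, sub_self]
  · rintro _ ⟨v, rfl⟩
    exact mem_weightSpace.2 fun x => (weightOps_comm hE hδ x v).1

lemma dualWeightSpace_eq_range {ρ : Representation ℂ (H a b c) V} {E : Weight a b c → V →ₗ[ℂ] V}
    {D : Finset (Weight a b c)} (hE : ∀ x, ρ (torusHom a b c x) = ∑ δ ∈ D, chi δ x • E δ)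
    {δ : Weight a b c} (hδ : δ ∈ D) : dualWeightSpace ρ δ = LinearMap.range (E δ).dualMap := by
  classical
  apply le_antisymm
  · intro l hl
    refine ⟨l, LinearMap.ext fun v => ?_⟩
    rw [LinearMap.dualMap_apply, ← sub_eq_zero]
    have := eq_zero_of_sum_chi_smul (D := D) (w := fun ε => l (E ε v) - if ε = δ then l v else 0)
      (fun x => ?_) δ hδ
    · simpa using this
    · have h1 := hl x v
      rw [hE x] at h1
      simp only [LinearMap.sum_apply, LinearMap.smul_apply, map_sum, map_smul] at h1
      simp only [smul_sub, Finset.sum_sub_distrib, h1, smul_ite, smul_zero, Finset.sum_ite_eq', hδ,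
        if_true]
      exact sub_self _
  · rintro _ ⟨l, rfl⟩
    intro x v
    rw [LinearMap.dualMap_apply, LinearMap.dualMap_apply, (weightOps_comm hE hδ x v).2, map_smul,
      smul_eq_mul]

/-- The two spaces are the ranges of `E δ` and of its transpose, which have equal rank. For `δ` not
the weight of a word both are zero. -/
lemma finrank_dualWeightSpace [Module.Finite ℂ V] {ρ : Representation ℂ (H a b c) V}
    (h : IsPoly k ρ) (δ : Weight a b c) :
    Module.finrank ℂ (dualWeightSpace ρ δ) = weightMult ρ δ := by
  by_cases hδ : δ ∈ wordWeights a b c k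
  · obtain ⟨E, hE⟩ := exists_weightOps h
    rw [weightMult, weightSpace_eq_range hE hδ, dualWeightSpace_eq_range hE hδ,
      LinearMap.finrank_range_dualMap_eq_finrank_range]
  · have h1 : dualWeightSpace ρ δ = ⊥ := by
      by_contra hne
      exact hδ (mem_wordWeights_of_dualWeightSpace h hne)
    have h2 : weightSpace ρ δ = ⊥ := by
      by_contra hne
      exact hδ (mem_wordWeights_of_weightSpace h hne)
    rw [weightMult, h1, h2, finrank_bot, finrank_bot]

/-- At the identity of the torus the operators `E δ` sum to `1`, so not all of them vanish. -/
lemma exists_weight [Module.Finite ℂ V] [Nontrivial V] {ρ : Representation ℂ (H a b c) V}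
    (h : IsPoly k ρ) : ∃ δ, weightMult ρ δ ≠ 0 := by
  obtain ⟨E, hE⟩ := exists_weightOps h
  by_contra hcon
  push Not at hcon
  have h0 : ∀ δ ∈ wordWeights a b c k, E δ = 0 := by
    intro δ hδ
    have := hcon δ
    rw [weightMult, weightSpace_eq_range hE hδ, Submodule.finrank_eq_zero] at this
    exact LinearMap.range_eq_bot.1 this
  have h1 := hE 1
  rw [map_one, map_one, Finset.sum_eq_zero fun δ hδ => by rw [h0 δ hδ, smul_zero]] at h1
  exact one_ne_zero h1

lemma sum_content {I : Type} [Fintype I] [DecidableEq I] {k : ℕ} (u : Fin k → I) : ∑ i, content u i = k := by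
  unfold content
  rw [Finset.sum_comm]
  simp

lemma hasDegree_wt (w : Word a b c k) : HasDegree k (wt w) := by
  refine ⟨?_, ?_, ?_⟩ <;>
    simp only [wt, natWeight, wordContent] <;> rw [← Nat.cast_sum, sum_content]

end

end Kron
end

noncomputable section
namespace Kron

/-! ### Density of the unitary group -/

/-- The entries of a matrix as a vector. -/
def entries {n : ℕ} {R : Type*} (M : Matrix (Fin n) (Fin n) R) (r : Fin n × Fin n) : R := M r.1 r.2

lemma entries_smul {n : ℕ} (z : ℂ) (M : Matrix (Fin n) (Fin n) ℂ) :
    entries (z • M) = fun r => z * entries M r := rfl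

/-- A polynomial function on matrices which vanishes on skew-Hermitian matrices is zero. -/
lemma eq_zero_of_eval_skewHermitian {n : ℕ} (q : MvPolynomial (Fin n × Fin n) ℂ)
    (h : ∀ X : Matrix (Fin n) (Fin n) ℂ, X.conjTranspose = -X →
      MvPolynomial.eval (entries X) q = 0) : q = 0 := by
  -- With these coefficients `L z` is skew-Hermitian for real `z`, while `L` is invertible over `ℂ`:
  -- each pair of transposed entries has determinant `(1 + i)^2 - (-1 + i)^2 = 4i`. So `q` pulled
  -- back along `L` vanishes at all real points.
  let L : (Fin n × Fin n → ℂ) → Matrix (Fin n) (Fin n) ℂ := fun z =>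
    .of fun i j => (1 + Complex.I) * z (i, j) + (-1 + Complex.I) * z (j, i)
  let l : Fin n × Fin n → MvPolynomial (Fin n × Fin n) ℂ := fun r =>
    MvPolynomial.C (1 + Complex.I) * MvPolynomial.X r +
      MvPolynomial.C (-1 + Complex.I) * MvPolynomial.X r.swap
  have hl : ∀ z, MvPolynomial.eval z (MvPolynomial.bind₁ l q) =
      MvPolynomial.eval (entries (L z)) q := by
    intro z
    rw [MvPolynomial.eval, MvPolynomial.eval₂Hom_bind₁]
    congr 2
    funext r
    simp [l, L, entries, Prod.swap]
  have h0 : MvPolynomial.bind₁ l q = 0 := by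
    refine MvPolynomial.funext_set (fun _ => Set.range ((↑) : ℝ → ℂ))
      (fun _ => Set.infinite_range_of_injective Complex.ofReal_injective) fun z hz => ?_
    rw [hl, map_zero]
    choose x hx using fun r => hz r (Set.mem_univ r)
    apply h
    ext i j
    simp only [L, Matrix.conjTranspose_apply, Matrix.of_apply, Matrix.neg_apply, ← hx]
    simp only [star_add, star_mul', star_neg, star_one, Complex.star_def, Complex.conj_I,
      Complex.conj_ofReal]
    ring
  refine MvPolynomial.funext fun Y => ?_
  let z : Fin n × Fin n → ℂ := fun r =>
    ((1 + Complex.I) * Y r - (-1 + Complex.I) * Y r.swap) / (4 * Complex.I)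
  have hz : entries (L z) = Y := by
    funext r
    simp only [entries, L, z, Matrix.of_apply, Prod.swap]
    have : Complex.I ≠ 0 := Complex.I_ne_zero
    field_simp
    ring_nf
  rw [← hz, ← hl, h0, map_zero, map_zero]

open Matrix in
-- The Cayley transform `(1 + X) (1 - X)⁻¹` of a skew-Hermitian matrix is unitary. The adjugate
-- replaces the inverse so that the entries are polynomials in `X`, at the cost of a scalar factor.
lemma mul_adjugate_eq {n : ℕ} {X : Matrix (Fin n) (Fin n) ℂ} (hX : X.conjTranspose = -X)
    (hd : (1 - X).det ≠ 0) : ∃ U : unitaryGroup (Fin n) ℂ,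
      (1 + X) * (1 - X).adjugate = (1 - X).det • (U : Matrix (Fin n) (Fin n) ℂ) := by
  have hu : IsUnit (1 - X).det := isUnit_iff_ne_zero.2 hd
  have hc : (1 - X)ᴴ = 1 + X := by rw [conjTranspose_sub, hX, conjTranspose_one, sub_neg_eq_add]
  have hc' : (1 + X)ᴴ = 1 - X := by rw [conjTranspose_add, hX, conjTranspose_one, ← sub_eq_add_neg]
  have hu' : IsUnit (1 + X).det := by
    rw [← hc, det_conjTranspose]
    exact hu.star
  have hcomm : (1 + X) * (1 - X) = (1 - X) * (1 + X) := by noncomm_ring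
  refine ⟨⟨(1 + X) * (1 - X)⁻¹, ?_⟩, ?_⟩
  · rw [mem_unitaryGroup_iff, star_eq_conjTranspose, conjTranspose_mul, hc',
      conjTranspose_nonsing_inv, hc]
    calc (1 + X) * (1 - X)⁻¹ * ((1 + X)⁻¹ * (1 - X))
        = (1 + X) * ((1 - X)⁻¹ * (1 + X)⁻¹) * (1 - X) := by noncomm_ring
      _ = (1 + X) * ((1 + X)⁻¹ * (1 - X)⁻¹) * (1 - X) := by
          rw [← Matrix.mul_inv_rev, hcomm, Matrix.mul_inv_rev]
      _ = ((1 + X) * (1 + X)⁻¹) * ((1 - X)⁻¹ * (1 - X)) := by noncomm_ring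
      _ = 1 := by rw [mul_nonsing_inv _ hu', nonsing_inv_mul _ hu, one_mul]
  · simp only
    rw [← Matrix.mul_smul, inv_def, smul_smul, Ring.mul_inverse_cancel _ hu, one_smul]

open Matrix in
/-- A homogeneous polynomial function on matrices which vanishes on unitary matrices is zero. -/
theorem eq_zero_of_eval_unitary {n k : ℕ} (p : MvPolynomial (Fin n × Fin n) ℂ)
    (hp : ∀ (z : ℂ) (M : Fin n × Fin n → ℂ),
      MvPolynomial.eval (fun r => z * M r) p = z ^ k * MvPolynomial.eval M p)
    (h : ∀ U : unitaryGroup (Fin n) ℂ,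
      MvPolynomial.eval (entries (U : Matrix (Fin n) (Fin n) ℂ)) p = 0) : p = 0 := by
  let G : Matrix (Fin n) (Fin n) (MvPolynomial (Fin n × Fin n) ℂ) := mvPolynomialX _ _ ℂ
  -- The pullback of `p` along the Cayley transform with cleared denominators; homogeneity of `p`
  -- absorbs the determinant.
  let q : MvPolynomial (Fin n × Fin n) ℂ :=
    MvPolynomial.bind₁ (entries ((1 + G) * (1 - G).adjugate)) p
  have hG : ∀ X : Matrix (Fin n) (Fin n) ℂ,
      (MvPolynomial.eval (entries X)).mapMatrix G = X :=
    fun X => mvPolynomialX_mapMatrix_eval X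
  have hq : ∀ X : Matrix (Fin n) (Fin n) ℂ, MvPolynomial.eval (entries X) q =
      MvPolynomial.eval (entries ((1 + X) * (1 - X).adjugate)) p := by
    intro X
    have h1 : (MvPolynomial.eval (entries X)).mapMatrix
        ((1 + G) * (1 - G).adjugate) = (1 + X) * (1 - X).adjugate := by
      rw [map_mul, map_add, RingHom.map_adjugate, map_sub, hG, map_one]
    simp only [q]
    rw [MvPolynomial.eval, MvPolynomial.eval₂Hom_bind₁]
    rw [← h1]
    rfl
  have hdet : ∀ X : Matrix (Fin n) (Fin n) ℂ,
      MvPolynomial.eval (entries X) (1 - G).det = (1 - X).det := by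
    intro X
    rw [RingHom.map_det, map_sub, map_one, hG]
  -- The factor `det (1 - X)` disposes of the matrices at which the Cayley transform is undefined.
  have hzero : q * (1 - G).det = 0 := by
    refine eq_zero_of_eval_skewHermitian _ fun X hX => ?_
    rw [map_mul, hq, hdet]
    by_cases hd : (1 - X).det = 0
    · rw [hd, mul_zero]
    · obtain ⟨U, hU⟩ := mul_adjugate_eq hX hd
      rw [hU, entries_smul, hp, h U, mul_zero, zero_mul]
  have hall : ∀ X : Matrix (Fin n) (Fin n) ℂ, (1 - X).det ≠ 0 →
      MvPolynomial.eval (entries ((1 + X) * (1 - X).adjugate)) p = 0 := by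
    intro X hX
    have := congrArg (MvPolynomial.eval (entries X)) hzero
    rw [map_mul, hq, hdet, map_zero] at this
    exact (mul_eq_zero.1 this).resolve_right hX
  have hmul : p * (1 + G).det = 0 := by
    refine MvPolynomial.funext fun Y' => ?_
    let Y : Matrix (Fin n) (Fin n) ℂ := .of fun i j => Y' (i, j)
    have hY' : Y' = entries Y := rfl
    have hdetY : MvPolynomial.eval Y' (1 + G).det = (1 + Y).det := by
      rw [hY', RingHom.map_det, map_add, map_one, hG]
    rw [map_mul, hdetY, map_zero]
    by_cases hd : (1 + Y).det = 0
    · rw [hd, mul_zero]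
    · have hu : IsUnit (1 + Y).det := isUnit_iff_ne_zero.2 hd
      -- The inverse Cayley transform, so that `Y = (1 + X) (1 - X)⁻¹`. It reaches every `Y` with `1
      -- + Y` invertible, and the factor `det (1 + Y)` covers the others.
      let X := (Y - 1) * (1 + Y)⁻¹
      have hi : (1 + Y) * (1 + Y)⁻¹ = 1 := mul_nonsing_inv _ hu
      have h1 : 1 - X = (2 : ℂ) • (1 + Y)⁻¹ := by
        have : 1 - X = (1 + Y) * (1 + Y)⁻¹ - (Y - 1) * (1 + Y)⁻¹ := by rw [hi]
        rw [this, two_smul]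
        noncomm_ring
      have h2 : 1 + X = Y * (1 - X) := by
        have : 1 + X = (1 + Y) * (1 + Y)⁻¹ + (Y - 1) * (1 + Y)⁻¹ := by rw [hi]
        rw [this, h1, two_smul]
        noncomm_ring
      have hdX : (1 - X).det ≠ 0 := by
        rw [h1, det_smul, det_nonsing_inv]
        exact mul_ne_zero (pow_ne_zero _ two_ne_zero) (by
          rw [Ring.inverse_eq_inv']
          exact inv_ne_zero hd)
      have h3 := hall X hdX
      rw [h2, Matrix.mul_assoc, mul_adjugate, Matrix.mul_smul, Matrix.mul_one] at h3
      rw [entries_smul, hp] at h3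
      rw [hY', (mul_eq_zero.1 h3).resolve_left (pow_ne_zero _ hdX), zero_mul]
  refine (mul_eq_zero.1 hmul).resolve_right fun h0 => ?_
  have := congrArg (MvPolynomial.eval (entries (0 : Matrix (Fin n) (Fin n) ℂ))) h0
  rw [RingHom.map_det, map_add, map_one, hG, add_zero, det_one, map_zero] at this
  exact one_ne_zero this

end Kron
end

noncomputable section
namespace Kron

/-! ### Monomials in the matrix entries -/

/-- The exponents of the monomials of degree `k` in the entries of an `n × n` matrix. -/
abbrev MonExp (n k : ℕ) : Type := {A : Fin n × Fin n → ℕ // ∑ r, A r = k}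

instance finite_monExp (n k : ℕ) : Finite (MonExp n k) := by
  refine Set.Finite.to_subtype ((Set.finite_Icc (0 : Fin n × Fin n → ℕ) (fun _ => k)).subset ?_)
  rintro A (hA : ∑ r, A r = k)
  exact ⟨fun r => Nat.zero_le _, fun r => hA ▸ Finset.single_le_sum (f := A)
    (fun _ _ => Nat.zero_le _) (Finset.mem_univ r)⟩

instance fintype_monExp (n k : ℕ) : Fintype (MonExp n k) := Fintype.ofFinite _

/-- A monomial in the entries of a matrix. -/
def mono {n : ℕ} (A : Fin n × Fin n → ℕ) (M : Matrix (Fin n) (Fin n) ℂ) : ℂ :=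
  ∏ r, entries M r ^ A r

/-- The corresponding polynomial is homogeneous of degree `k`, so vanishing on unitary matrices
forces it to be zero. -/
lemma mono_indep {n k : ℕ} (z : MonExp n k → ℂ)
    (h : ∀ U : Matrix.unitaryGroup (Fin n) ℂ, ∑ A, z A * mono A.1 U = 0) : z = 0 := by
  let p : MvPolynomial (Fin n × Fin n) ℂ :=
    ∑ A, MvPolynomial.monomial (Finsupp.equivFunOnFinite.symm A.1) (z A)
  have hev : ∀ M : Fin n × Fin n → ℂ, MvPolynomial.eval M p = ∑ A, z A * ∏ r, M r ^ A.1 r := by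
    intro M
    simp only [p, map_sum, MvPolynomial.eval_monomial]
    refine Finset.sum_congr rfl fun A _ => ?_
    rw [Finsupp.prod_fintype _ _ (by simp)]
    rfl
  have hp : p = 0 := by
    refine eq_zero_of_eval_unitary (k := k) p (fun y M => ?_) fun U => ?_
    · simp only [hev, mul_pow, Finset.prod_mul_distrib, Finset.prod_pow_eq_pow_sum, Finset.mul_sum]
      refine Finset.sum_congr rfl fun A _ => ?_
      rw [A.2]
      ring
    · rw [hev]
      exact h U
  funext A
  have := congrArg (MvPolynomial.coeff (Finsupp.equivFunOnFinite.symm A.1)) hp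
  classical
  simpa [p, MvPolynomial.coeff_sum, MvPolynomial.coeff_monomial, Subtype.coe_inj] using this

/-! ### Matrix coefficients of `H` as triples of monomials. -/

section

variable {a b c k : ℕ}

/-- Triples of exponents of monomials of degree `k`. -/
abbrev TriExp (a b c k : ℕ) : Type := MonExp a k × MonExp b k × MonExp c k

/-- A monomial in the entries of a triple of matrices. -/
def triMono (m : TriExp a b c k) (g : H a b c) : ℂ :=
  mono m.1.1 g.1 * (mono m.2.1.1 g.2.1 * mono m.2.2.1 g.2.2)

/-- Independence is applied to one unitary group at a time, with the other matrices fixed. -/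
lemma linearIndependent_triMono :
    LinearIndependent ℂ (triMono : TriExp a b c k → H a b c → ℂ) := by
  rw [Fintype.linearIndependent_iff]
  intro z hz m
  have h0 : ∀ g : H a b c, ∑ A, ∑ B, ∑ C, z (A, B, C) *
      (mono A.1 g.1 * (mono B.1 g.2.1 * mono C.1 g.2.2)) = 0 := by
    intro g
    have := congrFun hz g
    rw [Finset.sum_apply, Fintype.sum_prod_type] at this
    simpa only [Fintype.sum_prod_type, Pi.smul_apply, smul_eq_mul, triMono, Pi.zero_apply] using this
  have h1 : ∀ V W, (fun A => ∑ B, ∑ C, z (A, B, C) *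
      (mono B.1 (V : Matrix.unitaryGroup (Fin b) ℂ) *
        mono C.1 (W : Matrix.unitaryGroup (Fin c) ℂ))) = 0 := by
    intro V W
    refine mono_indep _ fun U => ?_
    rw [← h0 (U, V, W)]
    refine Finset.sum_congr rfl fun A _ => ?_
    rw [Finset.sum_mul]
    refine Finset.sum_congr rfl fun B _ => ?_
    rw [Finset.sum_mul]
    exact Finset.sum_congr rfl fun C _ => by ring
  have h2 : ∀ A W, (fun B => ∑ C, z (A, B, C) *
      mono C.1 (W : Matrix.unitaryGroup (Fin c) ℂ)) = 0 := by
    intro A W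
    refine mono_indep _ fun V => ?_
    rw [← show _ = (0 : ℂ) from congrFun (h1 V W) A]
    refine Finset.sum_congr rfl fun B _ => ?_
    rw [Finset.sum_mul]
    exact Finset.sum_congr rfl fun C _ => by ring
  have h3 : ∀ A B, (fun C => z (A, B, C)) = 0 := fun A B =>
    mono_indep _ fun W => congrFun (h2 A W) B
  exact congrFun (h3 m.1 m.2.1) m.2.2

/-- The row sums of a triple of matrices. -/
def rowSums (m : TriExp a b c k) : (Fin a → ℕ) × (Fin b → ℕ) × (Fin c → ℕ) :=
  (fun i => ∑ j, m.1.1 (i, j), fun i => ∑ j, m.2.1.1 (i, j), fun i => ∑ j, m.2.2.1 (i, j))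

/-- The column sums of a triple of matrices. -/
def colSums (m : TriExp a b c k) : (Fin a → ℕ) × (Fin b → ℕ) × (Fin c → ℕ) :=
  (fun j => ∑ i, m.1.1 (i, j), fun j => ∑ i, m.2.1.1 (i, j), fun j => ∑ i, m.2.2.1 (i, j))

lemma mono_diag_mul {n : ℕ} (A : Fin n × Fin n → ℕ) (t : Fin n → ℂ)
    (M : Matrix (Fin n) (Fin n) ℂ) :
    mono A (Matrix.diagonal t * M) = (∏ i, t i ^ ∑ j, A (i, j)) * mono A M := by
  simp only [mono, entries, Matrix.diagonal_mul, mul_pow, Finset.prod_mul_distrib]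
  congr 1
  rw [Fintype.prod_prod_type]
  exact Finset.prod_congr rfl fun i _ => Finset.prod_pow_eq_pow_sum Finset.univ (fun j => A (i, j)) (t i)

lemma mono_mul_diag {n : ℕ} (A : Fin n × Fin n → ℕ) (t : Fin n → ℂ)
    (M : Matrix (Fin n) (Fin n) ℂ) :
    mono A (M * Matrix.diagonal t) = (∏ j, t j ^ ∑ i, A (i, j)) * mono A M := by
  simp only [mono, entries, Matrix.mul_diagonal, mul_pow, Finset.prod_mul_distrib]
  rw [mul_comm]
  congr 1
  rw [Fintype.prod_prod_type_right]
  exact Finset.prod_congr rfl fun j _ => Finset.prod_pow_eq_pow_sum Finset.univ (fun i => A (i, j)) (t j)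

lemma chi_natWeight (l : (Fin a → ℕ) × (Fin b → ℕ) × (Fin c → ℕ)) (x : Torus a b c) :
    chi (natWeight l) x = (∏ i, (x.1 i : ℂ) ^ l.1 i) * (∏ i, (x.2.1 i : ℂ) ^ l.2.1 i) *
      ∏ i, (x.2.2 i : ℂ) ^ l.2.2 i := by
  simp only [chi_apply, natWeight, zpow_natCast]

/-- A diagonal matrix on the left scales rows, one on the right scales columns. Row sums thus tell
which row of the tensor power a coefficient belongs to, and column sums give its weight under right
translation. -/
lemma triMono_torus_mul (m : TriExp a b c k) (x : Torus a b c) (g : H a b c) :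
    triMono m (torusHom a b c x * g) = chi (natWeight (rowSums m)) x * triMono m g := by
  simp only [triMono, torusHom, MonoidHom.coe_mk, OneHom.coe_mk, Prod.fst_mul, Prod.snd_mul,
    Submonoid.coe_mul, diagU, mono_diag_mul, chi_natWeight, rowSums]
  ring

lemma triMono_mul_torus (m : TriExp a b c k) (x : Torus a b c) (g : H a b c) :
    triMono m (g * torusHom a b c x) = chi (natWeight (colSums m)) x * triMono m g := by
  simp only [triMono, torusHom, MonoidHom.coe_mk, OneHom.coe_mk, Prod.fst_mul, Prod.snd_mul,
    Submonoid.coe_mul, diagU, mono_mul_diag, chi_natWeight, colSums]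
  ring

/-- The number of positions with given letters in two words. -/
def pairCount {n k : ℕ} (u u' : Fin k → Fin n) (r : Fin n × Fin n) : ℕ :=
  ∑ p, if (u p, u' p) = r then 1 else 0

lemma sum_pairCount {n k : ℕ} (u u' : Fin k → Fin n) : ∑ r, pairCount u u' r = k := by
  unfold pairCount
  rw [Finset.sum_comm]
  simp

lemma sum_pairCount_row {n k : ℕ} (u u' : Fin k → Fin n) (i : Fin n) :
    ∑ j, pairCount u u' (i, j) = content u i := by
  unfold pairCount content
  rw [Finset.sum_comm]
  refine Finset.sum_congr rfl fun p _ => ?_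
  by_cases h : u p = i <;> simp [h]

lemma prod_entries_eq_mono {n k : ℕ} (u u' : Fin k → Fin n) (M : Matrix (Fin n) (Fin n) ℂ) :
    ∏ p, M (u p) (u' p) = mono (pairCount u u') M := by
  simp only [mono, pairCount, ← Finset.prod_pow_eq_pow_sum]
  rw [Finset.prod_comm]
  refine Finset.prod_congr rfl fun p _ => ?_
  rw [Finset.prod_eq_single (u p, u' p)]
  · simp [entries]
  · intro i _ hi
    rw [if_neg (Ne.symm hi), pow_zero]
  · simp

/-- The numbers of positions with given letters in the components of two words. -/
def wordPair (w w' : Word a b c k) : TriExp a b c k :=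
  (⟨pairCount (fun p => (w p).1) fun p => (w' p).1, sum_pairCount _ _⟩,
    ⟨pairCount (fun p => (w p).2.1) fun p => (w' p).2.1, sum_pairCount _ _⟩,
    ⟨pairCount (fun p => (w p).2.2) fun p => (w' p).2.2, sum_pairCount _ _⟩)

lemma tensorMat_eq_triMono (g : H a b c) (w w' : Word a b c k) :
    tensorMat g w w' = triMono (wordPair w w') g := by
  rw [tensorMat_apply, prod_entries_eq_mono (fun p => (w p).1),
    prod_entries_eq_mono (fun p => (w p).2.1), prod_entries_eq_mono (fun p => (w p).2.2), mul_assoc]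
  rfl

lemma rowSums_wordPair (w w' : Word a b c k) : rowSums (wordPair w w') = wordContent w := by
  simp only [rowSums, wordPair, sum_pairCount_row, wordContent]

lemma exists_fiber_card {α J : Type} [Fintype α] [Fintype J] [DecidableEq J] (r : J → ℕ)
    (h : ∑ j, r j = Fintype.card α) :
    ∃ f : α → J, ∀ j, (∑ x, if f x = j then 1 else 0) = r j := by
  let e : α ≃ Σ j, Fin (r j) := Fintype.equivOfCardEq (by simp [h])
  refine ⟨fun x => (e x).1, fun j => ?_⟩
  rw [e.sum_comp fun y : Σ j, Fin (r j) => if y.1 = j then 1 else 0, Fintype.sum_sigma,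
    Finset.sum_eq_single j]
  · simp
  · intro i _ hi
    simp [hi]
  · simp

/-- On the positions where `u` has the letter `i`, the letters of `u'` are distributed according to
row `i` of `A`; the hypothesis says that the sizes agree. -/
lemma exists_pairCount_eq {n k : ℕ} (u : Fin k → Fin n) (A : Fin n × Fin n → ℕ)
    (h : ∀ i, ∑ j, A (i, j) = content u i) : ∃ u', pairCount u u' = A := by
  have h1 : ∀ i, ∃ f : {p // u p = i} → Fin n, ∀ j, (∑ x, if f x = j then 1 else 0) = A (i, j) := by
    intro i
    refine exists_fiber_card (fun j => A (i, j)) ?_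
    rw [h, content, Fintype.card_subtype, Finset.card_filter]
  choose f hf using h1
  refine ⟨fun p => f (u p) ⟨p, rfl⟩, funext fun ⟨i, j⟩ => ?_⟩
  rw [← hf i j, pairCount]
  have h2 : ∀ p, (if (u p, f (u p) ⟨p, rfl⟩) = (i, j) then 1 else 0 : ℕ) =
      if hp : u p = i then (if f i ⟨p, hp⟩ = j then 1 else 0) else 0 := by
    intro p
    by_cases hp : u p = i
    · subst hp
      simp
    · simp [hp]
  simp only [h2]
  rw [Finset.sum_dite, Finset.sum_const_zero, add_zero]
  refine Finset.sum_bij' (fun x _ => ⟨x.1, (Finset.mem_filter.1 x.2).2⟩)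
    (fun x _ => ⟨x.1, Finset.mem_filter.2 ⟨Finset.mem_univ _, x.2⟩⟩) ?_ ?_ ?_ ?_ ?_ <;> simp

lemma exists_wordPair_eq (w : Word a b c k) (m : TriExp a b c k) (h : rowSums m = wordContent w) :
    ∃ w', wordPair w w' = m := by
  obtain ⟨u₁, h₁⟩ := exists_pairCount_eq (fun p => (w p).1) m.1.1
    (congrFun (congrArg Prod.fst h))
  obtain ⟨u₂, h₂⟩ := exists_pairCount_eq (fun p => (w p).2.1) m.2.1.1
    (congrFun (congrArg (fun x => x.2.1) h))
  obtain ⟨u₃, h₃⟩ := exists_pairCount_eq (fun p => (w p).2.2) m.2.2.1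
    (congrFun (congrArg (fun x => x.2.2) h))
  exact ⟨fun p => (u₁ p, u₂ p, u₃ p), Prod.ext (Subtype.ext h₁)
    (Prod.ext (Subtype.ext h₂) (Subtype.ext h₃))⟩

lemma exists_wordContent_eq {l : (Fin a → ℕ) × (Fin b → ℕ) × (Fin c → ℕ)}
    (h : HasDegree k (natWeight l : Weight a b c)) : ∃ w : Word a b c k, wordContent w = l := by
  obtain ⟨u₁, h₁⟩ := exists_fiber_card (α := Fin k) l.1
    (by rw [Fintype.card_fin]; have := h.1; simp only [natWeight] at this; exact_mod_cast this)
  obtain ⟨u₂, h₂⟩ := exists_fiber_card (α := Fin k) l.2.1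
    (by rw [Fintype.card_fin]; have := h.2.1; simp only [natWeight] at this; exact_mod_cast this)
  obtain ⟨u₃, h₃⟩ := exists_fiber_card (α := Fin k) l.2.2
    (by rw [Fintype.card_fin]; have := h.2.2; simp only [natWeight] at this; exact_mod_cast this)
  exact ⟨fun p => (u₁ p, u₂ p, u₃ p), Prod.ext (funext h₁) (Prod.ext (funext h₂) (funext h₃))⟩

lemma natWeight_injective : Function.Injective
    (natWeight : (Fin a → ℕ) × (Fin b → ℕ) × (Fin c → ℕ) → Weight a b c) := by
  intro l l' h
  refine Prod.ext (funext fun i => ?_) (Prod.ext (funext fun i => ?_) (funext fun i => ?_))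
  · exact Nat.cast_injective (congrFun (congrArg Prod.fst h) i)
  · exact Nat.cast_injective (congrFun (congrArg (fun x : Weight a b c => x.2.1) h) i)
  · exact Nat.cast_injective (congrFun (congrArg (fun x : Weight a b c => x.2.2) h) i)

lemma matCount_eq_card {n k : ℕ} {r : Fin n → ℕ} (hr : ∑ i, r i = k) (δ : Fin n → ℤ) :
    matCount n (fun i => r i) δ = Nat.card {A : MonExp n k //
      (∀ i, ∑ j, A.1 (i, j) = r i) ∧ ∀ j, ((∑ i, A.1 (i, j) : ℕ) : ℤ) = δ j} := by
  refine Nat.card_congr ⟨fun A => ⟨⟨A.1, ?_⟩, fun i => ?_, fun j => ?_⟩,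
    fun A => ⟨A.1.1, fun i => ?_, fun j => ?_⟩, fun _ => rfl, fun _ => rfl⟩
  · rw [Fintype.sum_prod_type, ← hr]
    refine Finset.sum_congr rfl fun i _ => ?_
    have := A.2.1 i
    dsimp only at this
    exact_mod_cast this
  · have := A.2.1 i
    dsimp only at this
    exact_mod_cast this
  · exact_mod_cast A.2.2 j
  · dsimp only
    exact_mod_cast A.2.1 i
  · exact_mod_cast A.2.2 j

lemma tripleCount_wt (w : Word a b c k) (δ : Weight a b c) : tripleCount (wt w) δ =
    Nat.card {m : {m : TriExp a b c k // rowSums m = wordContent w} //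
      natWeight (colSums m.1) = δ} := by
  have h1 := matCount_eq_card (sum_content fun p => (w p).1) δ.1
  have h2 := matCount_eq_card (sum_content fun p => (w p).2.1) δ.2.1
  have h3 := matCount_eq_card (sum_content fun p => (w p).2.2) δ.2.2
  have h : tripleCount (wt w) δ = _ * (_ * _) :=
    congrArg₂ (· * ·) h1 (congrArg₂ (· * ·) h2 h3)
  rw [h, ← Nat.card_prod, ← Nat.card_prod]
  refine Nat.card_congr ⟨fun x => ⟨⟨(x.1.1, x.2.1.1, x.2.2.1), ?_⟩, ?_⟩,
    fun m => (⟨m.1.1.1, ?_, ?_⟩, ⟨m.1.1.2.1, ?_, ?_⟩, ⟨m.1.1.2.2, ?_, ?_⟩), fun _ => rfl, fun _ => rfl⟩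
  · exact Prod.ext (funext x.1.2.1) (Prod.ext (funext x.2.1.2.1) (funext x.2.2.2.1))
  · exact Prod.ext (funext x.1.2.2) (Prod.ext (funext x.2.1.2.2) (funext x.2.2.2.2))
  · exact congrFun (congrArg Prod.fst m.1.2)
  · exact congrFun (congrArg Prod.fst m.2)
  · exact congrFun (congrArg (fun x => x.2.1) m.1.2)
  · exact congrFun (congrArg (fun x : Weight a b c => x.2.1) m.2)
  · exact congrFun (congrArg (fun x => x.2.2) m.1.2)
  · exact congrFun (congrArg (fun x : Weight a b c => x.2.2) m.2)

end

end Kron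
end

noncomputable section
namespace Kron

open Representation

/-! ### The tensor power and its matrix coefficients -/

section

variable {a b c k : ℕ} {V : Type} [AddCommGroup V] [Module ℂ V]

/-- The `k`-th tensor power of `ℂ^{abc}`, in coordinates. -/
def tensorRep (a b c k : ℕ) : Representation ℂ (H a b c) (Word a b c k → ℂ) where
  toFun g := Matrix.toLin' (tensorMat g)
  map_one' := by rw [tensorMat_one, Matrix.toLin'_one]; rfl
  map_mul' g h := by rw [tensorMat_mul, Matrix.toLin'_mul]; rfl

lemma tensorRep_apply (g : H a b c) (v : Word a b c k → ℂ) :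
    tensorRep a b c k g v = Matrix.mulVec (tensorMat g) v := rfl

lemma conjTranspose_tensorMat_mul (g : H a b c) :
    (tensorMat g : Matrix (Word a b c k) _ ℂ).conjTranspose * tensorMat g = 1 := by
  have h : (tensorMat g : Matrix (Word a b c k) _ ℂ).conjTranspose = tensorMat g⁻¹ := by
    ext w w'
    simp only [Matrix.conjTranspose_apply, tensorMat, Matrix.of_apply, map_inv, star_prod]
    rfl
  rw [h, ← tensorMat_mul, inv_mul_cancel, tensorMat_one]

/-- The matrices of the tensor power are unitary for the standard inner product, which is borrowed
from `EuclideanSpace`. -/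
lemma isSemisimple_tensorRep (a b c k : ℕ) : (tensorRep a b c k).IsSemisimpleRepresentation := by
  let e : EuclideanSpace ℂ (Word a b c k) ≃ₗ[ℂ] (Word a b c k → ℂ) := WithLp.linearEquiv 2 ℂ _
  let ρ : Representation ℂ (H a b c) (EuclideanSpace ℂ (Word a b c k)) :=
    { toFun := fun g => e.symm.toLinearMap ∘ₗ tensorRep a b c k g ∘ₗ e.toLinearMap
      map_one' := by
        ext v
        simp
      map_mul' := fun g h => by
        ext v
        simp }
  have hρ : ρ.IsSemisimpleRepresentation := by
    refine isSemisimple_of_inner ρ fun g u v => ?_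
    rw [EuclideanSpace.inner_eq_star_dotProduct, EuclideanSpace.inner_eq_star_dotProduct]
    change Matrix.mulVec (tensorMat g) (e v) ⬝ᵥ star (Matrix.mulVec (tensorMat g) (e u)) =
      e v ⬝ᵥ star (e u)
    rw [Matrix.star_mulVec, dotProduct_comm, ← Matrix.dotProduct_mulVec, Matrix.mulVec_mulVec,
      conjTranspose_tensorMat_mul, Matrix.one_mulVec, dotProduct_comm]
  refine isSemisimple_of_surjective (ρ := ρ) ⟨e.toLinearMap, fun g => ?_⟩ e.surjective hρ
  ext v
  simp [ρ]

lemma isPoly_tensorRep (a b c k : ℕ) : IsPoly k (tensorRep a b c k) := by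
  intro v l
  have h : (fun g => l (tensorRep a b c k g v)) = ∑ w, ∑ w',
      (l (Pi.single w 1) * v w') • fun g : H a b c => tensorMat g w w' := by
    funext g
    have h1 : tensorRep a b c k g v = ∑ w, (tensorRep a b c k g v) w • Pi.single w 1 := by
      simpa using (pi_eq_sum_univ' (tensorRep a b c k g v))
    rw [h1, map_sum]
    simp only [Finset.sum_apply, Pi.smul_apply, smul_eq_mul, map_smul]
    refine Finset.sum_congr rfl fun w _ => ?_
    rw [tensorRep_apply, Matrix.mulVec, dotProduct, Finset.sum_mul]
    exact Finset.sum_congr rfl fun w' _ => by ring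
  rw [h]
  exact Submodule.sum_mem _ fun w _ => Submodule.sum_mem _ fun w' _ =>
    Submodule.smul_mem _ _ (Submodule.subset_span ⟨(w, w'), rfl⟩)

/-- The right regular representation on functions. -/
def rightRegular (a b c : ℕ) : Representation ℂ (H a b c) (H a b c → ℂ) where
  toFun g := LinearMap.funLeft ℂ ℂ fun h => h * g
  map_one' := by
    ext f h
    simp [LinearMap.funLeft_apply]
  map_mul' g g' := by
    ext f h
    simp [LinearMap.funLeft_apply, mul_assoc]

/-- The coefficients of a row of the tensor power. -/
def rowMap (w : Word a b c k) : IntertwiningMap (tensorRep a b c k) (rightRegular a b c) :=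
  ⟨LinearMap.pi fun g => LinearMap.proj w ∘ₗ tensorRep a b c k g, fun g => by
    refine LinearMap.ext fun v => funext fun h => ?_
    change (tensorRep a b c k h (tensorRep a b c k g v)) w = tensorRep a b c k (h * g) v w
    rw [map_mul, Module.End.mul_apply]⟩

lemma rowMap_apply (w : Word a b c k) (v : Word a b c k → ℂ) (g : H a b c) :
    rowMap w v g = ∑ w', tensorMat g w w' * v w' := rfl

/-- The representation spanned by a row of matrix coefficients of the tensor power. -/
def rowRep (w : Word a b c k) : Representation ℂ (H a b c) (rowMap w).range.toSubmodule :=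
  (rowMap w).range.toRepresentation

/-- The quotient map from the tensor power to the span of a row. -/
def rowMapRange (w : Word a b c k) : IntertwiningMap (tensorRep a b c k) (rowRep w) :=
  ⟨(rowMap w).toLinearMap.codRestrict _ fun v => ⟨v, rfl⟩, fun g =>
    LinearMap.ext fun v => Subtype.ext ((rowMap w).isIntertwining _ _ g v)⟩

lemma rowMapRange_surjective (w : Word a b c k) : Function.Surjective (rowMapRange w) := by
  rintro ⟨_, v, rfl⟩
  exact ⟨v, rfl⟩

instance finite_rowRep (w : Word a b c k) : Module.Finite ℂ (rowMap w).range.toSubmodule :=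
  Module.Finite.of_surjective (rowMapRange w).toLinearMap (rowMapRange_surjective w)

lemma isSemisimple_rowRep (w : Word a b c k) : (rowRep w).IsSemisimpleRepresentation :=
  isSemisimple_of_surjective _ (rowMapRange_surjective w) (isSemisimple_tensorRep a b c k)

lemma isPoly_rowRep (w : Word a b c k) : IsPoly k (rowRep w) :=
  (isPoly_tensorRep a b c k).of_surjective _ (rowMapRange_surjective w)

lemma triMono_mem_range {w : Word a b c k} {m : TriExp a b c k} (hm : rowSums m = wordContent w) :
    triMono m ∈ (rowMap w).range.toSubmodule := by
  obtain ⟨w', rfl⟩ := exists_wordPair_eq w m hm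
  refine ⟨Pi.single w' 1, funext fun g => ?_⟩
  change rowMap w (Pi.single w' 1) g = _
  rw [rowMap_apply, ← tensorMat_eq_triMono]
  simp [Pi.single_apply]

/-- Row `w` consists of the monomials `wordPair w w'`, and by `exists_wordPair_eq` these exhaust the
triples whose row sums are the content of `w`. -/
lemma range_eq_span (w : Word a b c k) : (rowMap w).range.toSubmodule =
    Submodule.span ℂ (Set.range fun m : {m : TriExp a b c k // rowSums m = wordContent w} =>
      (triMono m.1 : H a b c → ℂ)) := by
  apply le_antisymm
  · rintro _ ⟨v, rfl⟩
    have : (rowMap w).toLinearMap v =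
        ∑ w', v w' • (triMono (wordPair w w') : H a b c → ℂ) := by
      funext g
      change rowMap w v g = _
      rw [rowMap_apply, Finset.sum_apply]
      exact Finset.sum_congr rfl fun w' _ => by
        rw [tensorMat_eq_triMono, Pi.smul_apply, smul_eq_mul, mul_comm]
    rw [this]
    exact Submodule.sum_mem _ fun w' _ => Submodule.smul_mem _ _
      (Submodule.subset_span ⟨⟨_, rowSums_wordPair w w'⟩, rfl⟩)
  · rw [Submodule.span_le]
    rintro _ ⟨m, rfl⟩
    exact triMono_mem_range m.2

/-- The independent monomials spanning the row are weight vectors for right translation, with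
weights their column sums. -/
lemma weightMult_rowRep (w : Word a b c k) (δ : Weight a b c) :
    weightMult (rowRep w) δ = tripleCount (wt w) δ := by
  classical
  have hli : LinearIndependent ℂ fun m : {m : TriExp a b c k // rowSums m = wordContent w} =>
      (triMono m.1 : H a b c → ℂ) := linearIndependent_triMono.comp _ Subtype.val_injective
  let B := (Module.Basis.span hli).map (LinearEquiv.ofEq _ _ (range_eq_span w).symm)
  have hB : ∀ m, ((B m : (rowMap w).range.toSubmodule) : H a b c → ℂ) = triMono m.1 := by
    intro m
    simp only [B, Module.Basis.map_apply, LinearEquiv.coe_ofEq_apply, Module.Basis.span_apply]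
  rw [weightMult_eq_card B (fun m => natWeight (colSums m.1)) fun m => ?_, tripleCount_wt]
  rw [mem_weightSpace]
  intro x
  apply Subtype.ext
  funext g
  change (B m).1 (g * torusHom a b c x) = chi (natWeight (colSums m.1)) x * (B m).1 g
  rw [hB, triMono_mul_torus]

/-- Frobenius reciprocity: homomorphisms into the span of a row are functionals of the weight
of that row. -/
lemma finrank_hom_rowRep [Module.Finite ℂ V] {ρ : Representation ℂ (H a b c) V} (hρ : IsPoly k ρ)
    (w : Word a b c k) :
    Module.finrank ℂ (IntertwiningMap ρ (rowRep w)) = weightMult ρ (wt w) := by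
  rw [← finrank_dualWeightSpace hρ]
  have hleft : ∀ f ∈ (rowMap w).range.toSubmodule, ∀ x g,
      f (torusHom a b c x * g) = chi (wt w) x * f g := by
    intro f hf x g
    rw [range_eq_span] at hf
    induction hf using Submodule.span_induction with
    | mem f hf =>
      obtain ⟨m, rfl⟩ := hf
      dsimp only
      rw [triMono_torus_mul, m.2, wt]
    | zero => simp
    | add f f' _ _ hf hf' => rw [Pi.add_apply, Pi.add_apply, hf, hf', mul_add]
    | smul z f _ hf =>
      rw [Pi.smul_apply, Pi.smul_apply, hf, smul_eq_mul, smul_eq_mul]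
      ring
  have hcoe : ∀ (Φ : IntertwiningMap ρ (rowRep w)) (v : V) (g h : H a b c),
      (Φ (ρ g v)).1 h = (Φ v).1 (h * g) := by
    intro Φ v g h
    rw [IntertwiningMap.isIntertwining _ _ Φ g v]
    rfl
  -- Frobenius reciprocity evaluates at the identity of `H`; the inverse sends `l` to the map `v ↦
  -- (g ↦ l (ρ g v))`.
  let F : IntertwiningMap ρ (rowRep w) →ₗ[ℂ] dualWeightSpace ρ (wt w) :=
    { toFun := fun Φ => ⟨LinearMap.proj 1 ∘ₗ (rowMap w).range.toSubmodule.subtype ∘ₗ Φ.toLinearMap,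
        fun x v => by
          change (Φ (ρ (torusHom a b c x) v)).1 1 = chi (wt w) x * (Φ v).1 1
          rw [hcoe, ← hleft _ (Φ v).2, one_mul, mul_one]⟩
      map_add' := fun _ _ => rfl
      map_smul' := fun _ _ => rfl }
  have hF : ∀ Φ v, (F Φ).1 v = (Φ v).1 1 := fun _ _ => rfl
  refine LinearEquiv.finrank_eq (LinearEquiv.ofBijective F ⟨fun Φ Ψ h => ?_, fun l => ?_⟩)
  · apply IntertwiningMap.ext
    refine LinearMap.ext fun v => Subtype.ext (funext fun g => ?_)
    have h1 : (F Φ).1 (ρ g v) = (F Ψ).1 (ρ g v) := by rw [h]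
    rw [hF, hF, hcoe, hcoe, one_mul] at h1
    exact h1
  · have hmem : ∀ v, (fun g => l.1 (ρ g v)) ∈ (rowMap w).range.toSubmodule := by
      intro v
      have h1 := hρ v l.1
      have h2 : polySpace a b c k ≤ Submodule.span ℂ (Set.range
          (triMono : TriExp a b c k → H a b c → ℂ)) := by
        rw [polySpace, Submodule.span_le]
        rintro _ ⟨⟨u, u'⟩, rfl⟩
        refine Submodule.subset_span ⟨wordPair u u', funext fun g => ?_⟩
        exact (tensorMat_eq_triMono g u u').symm
      obtain ⟨z, hz⟩ := (Submodule.mem_span_range_iff_exists_fun ℂ).1 (h2 h1)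
      -- Left translation by the torus multiplies the coefficient function by `chi (wt w)` because
      -- `l` has that weight. Independence then kills every monomial with other row sums, which
      -- places the function in row `w`.
      have h3 : ∀ m x, z m * (chi (natWeight (rowSums m)) x - chi (wt w) x) = 0 := by
        intro m x
        refine Fintype.linearIndependent_iff.1 linearIndependent_triMono
          (fun m => z m * (chi (natWeight (rowSums m)) x - chi (wt w) x)) ?_ m
        funext g
        have h4 := congrFun hz (torusHom a b c x * g)
        have h5 := congrFun hz g
        rw [map_mul, Module.End.mul_apply, l.2] at h4
        rw [← h5, Finset.sum_apply, Finset.sum_apply, Finset.mul_sum, ← sub_eq_zero,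
          ← Finset.sum_sub_distrib] at h4
        rw [Finset.sum_apply, Pi.zero_apply, ← h4]
        refine Finset.sum_congr rfl fun m _ => ?_
        simp only [Pi.smul_apply, smul_eq_mul, triMono_torus_mul]
        ring
      rw [← hz]
      refine Submodule.sum_mem _ fun m _ => ?_
      by_cases hm : z m = 0
      · rw [hm, zero_smul]
        exact Submodule.zero_mem _
      · refine Submodule.smul_mem _ _ (triMono_mem_range ?_)
        apply natWeight_injective
        apply chi_injective
        ext x
        exact sub_eq_zero.1 ((mul_eq_zero.1 (h3 m x)).resolve_left hm)
    let L : V →ₗ[ℂ] (H a b c → ℂ) := LinearMap.pi fun g => l.1 ∘ₗ ρ g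
    refine ⟨⟨L.codRestrict _ hmem, fun g => LinearMap.ext fun v =>
      Subtype.ext (funext fun h => ?_)⟩, ?_⟩
    · change l.1 (ρ h (ρ g v)) = l.1 (ρ (h * g) v)
      rw [map_mul, Module.End.mul_apply]
    · refine Subtype.ext (LinearMap.ext fun v => ?_)
      change l.1 (ρ 1 v) = l.1 v
      rw [map_one, Module.End.one_apply]

end

end Kron
end

noncomputable section
namespace Kron

open Representation

/-! ### Weyl's character formula for irreducible polynomial representations -/

/-- A bundled irreducible polynomial representation. -/
structure PolyIrrep (a b c k : ℕ) where
  /-- the underlying space -/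
  V : Type
  [addCommGroup : AddCommGroup V]
  [module : Module ℂ V]
  [finite : Module.Finite ℂ V]
  /-- the action -/
  rep : Representation ℂ (H a b c) V
  irreducible : rep.IsIrreducible
  poly : IsPoly k rep

attribute [instance] PolyIrrep.addCommGroup PolyIrrep.module PolyIrrep.finite

section

variable {a b c k : ℕ}

/-- Isomorphism of irreducible representations. -/
def polyIrrepSetoid (a b c k : ℕ) {J : Type} (r : J → PolyIrrep a b c k) : Setoid J where
  r i j := Nonempty (Representation.Equiv (r i).rep (r j).rep)
  iseqv := ⟨fun _ => ⟨.refl _⟩, fun ⟨e⟩ => ⟨e.symm⟩, fun ⟨e⟩ ⟨f⟩ => ⟨e.trans f⟩⟩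

lemma matCount_eq_zero {n : ℕ} {δ ε : Fin n → ℤ} {i : Fin n} (h : δ i < 0) : matCount n δ ε = 0 := by
  have : IsEmpty {A : Fin n × Fin n → ℕ //
      (∀ i, ∑ j, (A (i, j) : ℤ) = δ i) ∧ ∀ j, ∑ i, (A (i, j) : ℤ) = ε j} := by
    refine ⟨fun A => ?_⟩
    have h1 := A.2.1 i
    have h2 : (0 : ℤ) ≤ ∑ j, (A.1 (i, j) : ℤ) := Finset.sum_nonneg fun _ _ => Nat.cast_nonneg _
    omega
  rw [matCount, Nat.card_of_isEmpty]

lemma exists_natWeight_eq {δ : Weight a b c} (h1 : ∀ i, 0 ≤ δ.1 i) (h2 : ∀ i, 0 ≤ δ.2.1 i)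
    (h3 : ∀ i, 0 ≤ δ.2.2 i) : ∃ l, natWeight l = δ :=
  ⟨(fun i => (δ.1 i).toNat, fun i => (δ.2.1 i).toNat, fun i => (δ.2.2 i).toNat),
    Prod.ext (funext fun i => Int.toNat_of_nonneg (h1 i))
      (Prod.ext (funext fun i => Int.toNat_of_nonneg (h2 i))
        (funext fun i => Int.toNat_of_nonneg (h3 i)))⟩

lemma exists_natWeight_of_tripleCount_ne_zero {ε δ : Weight a b c} (h : tripleCount ε δ ≠ 0) :
    ∃ l, natWeight l = ε := by
  simp only [tripleCount, mul_ne_zero_iff] at h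
  refine exists_natWeight_eq (fun i => ?_) (fun i => ?_) fun i => ?_ <;> by_contra hi
  · exact h.1 (matCount_eq_zero (not_le.1 hi))
  · exact h.2.1 (matCount_eq_zero (not_le.1 hi))
  · exact h.2.2 (matCount_eq_zero (not_le.1 hi))

lemma exists_word_of_weightMult_ne_zero {V : Type} [AddCommGroup V] [Module ℂ V]
    [Module.Finite ℂ V] {ρ : Representation ℂ (H a b c) V} (h : IsPoly k ρ) {δ : Weight a b c}
    (hδ : weightMult ρ δ ≠ 0) : ∃ w : Word a b c k, wt w = δ := by
  have := mem_wordWeights_of_weightSpace h (weightMult_ne_zero_iff.1 hδ)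
  simpa [wordWeights] using this

/-- An irreducible polynomial representation belongs to a finite family whose weight
multiplicities satisfy the orthogonality relations. -/
theorem exists_orthogonal_family (σ : PolyIrrep a b c k) :
    ∃ (T : Type) (_ : Fintype T) (m : T → Weight a b c → ℕ) (t₀ : T), m t₀ = weightMult σ.rep ∧
      ∀ ε δ, HasDegree k ε → HasDegree k δ → tripleCount ε δ = ∑ t, m t ε * m t δ := by
  classical
  choose n S hS hirr using fun w : Word a b c k =>
    exists_irreducible_isInternal (rowRep w) (isSemisimple_rowRep w)
  -- All constituents of all row representations, together with `σ` itself, so that `σ` need not be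
  -- known in advance to occur in a row.
  let J : Type := Unit ⊕ Σ w : Word a b c k, Fin (n w)
  let r : J → PolyIrrep a b c k := Sum.elim (fun _ => σ) fun j =>
    { V := (S j.1 j.2).toSubmodule
      rep := (S j.1 j.2).toRepresentation
      irreducible := hirr j.1 j.2
      poly := (isPoly_rowRep j.1).sub _ }
  let s : Setoid J := polyIrrepSetoid a b c k r
  let T : Type := Quotient s
  have hT : Fintype T := Fintype.ofFinite T
  let m : T → Weight a b c → ℕ := fun t => weightMult (r t.out).rep
  have hm : ∀ j δ, m (Quotient.mk s j) δ = weightMult (r j).rep δ := by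
    intro j δ
    obtain ⟨e⟩ : Nonempty (Representation.Equiv (r (Quotient.mk s j).out).rep (r j).rep) :=
      Quotient.mk_out (s := s) j
    exact weightMult_congr e δ
  have hword : ∀ t ε, m t ε ≠ 0 → ∃ w : Word a b c k, wt w = ε :=
    fun t ε h => exists_word_of_weightMult_ne_zero (r t.out).poly h
  refine ⟨T, hT, m, Quotient.mk s (Sum.inl ()), funext fun δ => hm _ δ, fun ε δ hε hδ => ?_⟩
  by_cases hw : ∃ w : Word a b c k, wt w = ε
  · obtain ⟨w, rfl⟩ := hw
    -- By Frobenius reciprocity and Schur's lemma, the multiplicity of `t` at `wt w` is the number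
    -- of constituents of row `w` isomorphic to `t`.
    have h1 : ∀ t, m t (wt w) =
        ∑ i : Fin (n w), if Quotient.mk s (Sum.inr ⟨w, i⟩) = t then 1 else 0 := by
      intro t
      change weightMult (r t.out).rep (wt w) = _
      rw [← finrank_hom_rowRep (r t.out).poly, finrank_hom_isInternal (hS w)]
      refine Finset.sum_congr rfl fun i _ => ?_
      rw [finrank_hom_of_irreducible (hirr w i) (r t.out).irreducible]
      congr 1
      refine propext ⟨fun h => ?_, fun h => ?_⟩
      · rw [← Quotient.out_eq t]
        obtain ⟨e⟩ := h
        exact Quotient.sound ⟨e.symm⟩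
      · rw [← h]
        exact Quotient.mk_out (s := s) (Sum.inr ⟨w, i⟩)
    rw [← weightMult_rowRep, weightMult_isInternal (hS w)]
    simp only [h1, Finset.sum_mul]
    rw [Finset.sum_comm]
    refine Finset.sum_congr rfl fun i _ => ?_
    simp only [ite_mul, one_mul, zero_mul]
    rw [Finset.sum_eq_single (Quotient.mk s (Sum.inr ⟨w, i⟩))
      (fun t _ ht => by rw [if_neg (Ne.symm ht)]) (by simp), if_pos rfl]
    exact (hm (Sum.inr ⟨w, i⟩) δ).symm
  · have h0 : ∀ t, m t ε = 0 := fun t => by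
      by_contra h
      exact hw (hword t ε h)
    rw [Finset.sum_eq_zero fun t _ => by rw [h0, zero_mul]]
    -- A nonzero count would make `ε` nonnegative, and a nonnegative weight of degree `k` is the
    -- weight of a word.
    by_contra h
    obtain ⟨l, rfl⟩ := exists_natWeight_of_tripleCount_ne_zero h
    obtain ⟨w, hw'⟩ := exists_wordContent_eq hε
    exact hw ⟨w, by rw [wt, hw']⟩

open scoped Classical in
/-- For an irreducible polynomial representation of degree `k` and a dominant weight `Λ`, the
alternating sum of weight multiplicities at `Λ` is `1` if `Λ` is the highest weight and `0`
otherwise. -/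
theorem weylSum_weightMult_irreducible (σ : PolyIrrep a b c k)
    {l : (Fin a → ℕ) × (Fin b → ℕ) × (Fin c → ℕ)} (hl : NatDominant l)
    (hd : HasDegree k (natWeight l : Weight a b c)) :
    weylSum (fun δ => (weightMult σ.rep δ : ℤ)) (natWeight l) =
      if HasHighestWeight σ.rep (natWeight l) then 1 else 0 := by
  obtain ⟨T, hT, m, t₀, hm, hN⟩ := exists_orthogonal_family σ
  have hnt : Nontrivial σ.V := by
    by_contra h
    have := not_nontrivial_iff_subsingleton.1 h
    have hirr := σ.irreducible
    obtain ⟨S, S', hS⟩ := hirr.exists_pair_ne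
    exact hS (Subrepresentation.toSubmodule_injective (Subsingleton.elim _ _))
  have hw : ∀ δ, m t₀ δ ≠ 0 → ∃ w : Word a b c k, wt w = δ := fun δ h =>
    exists_word_of_weightMult_ne_zero σ.poly (by rwa [← hm])
  obtain ⟨l₀, hl₀, hne, hle, hφ⟩ := exists_highest_of_tripleCount m hN t₀
    ((wordWeights a b c k).finite_toSet.subset fun δ h => by
      obtain ⟨w, rfl⟩ := hw δ h
      simp [wordWeights])
    (by rw [hm]; exact exists_weight σ.poly)
    (fun δ h => by
      obtain ⟨w, rfl⟩ := hw δ h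
      exact ⟨hasDegree_wt w, _, rfl⟩)
    (fun τ δ h => by
      rw [hm, weightMult_ne_zero_iff] at h ⊢
      exact weightSpace_perm₁ τ h)
    (fun τ δ h => by
      rw [hm, weightMult_ne_zero_iff] at h ⊢
      exact weightSpace_perm₂ τ h)
    (fun τ δ h => by
      rw [hm, weightMult_ne_zero_iff] at h ⊢
      exact weightSpace_perm₃ τ h)
  rw [hm] at hne hle hφ
  rw [hφ l hl hd]
  congr 1
  refine propext ⟨?_, fun h => ?_⟩
  · rintro rfl
    exact ⟨weightMult_ne_zero_iff.1 hne, fun β hβ => hle β (weightMult_ne_zero_iff.2 hβ)⟩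
  -- Two distinct highest weights would each exceed the other in height.
  · apply natWeight_injective (a := a) (b := b) (c := c)
    have h1 := hle _ (weightMult_ne_zero_iff.2 h.1)
    have h2 : (natWeight l - natWeight l₀ : Weight a b c) ∈ rootCone a b c :=
      h.2 _ (weightMult_ne_zero_iff.1 hne)
    by_contra hne'
    have h3 := height_pos h1 (sub_ne_zero.2 (Ne.symm hne'))
    have h4 := height_pos h2 (sub_ne_zero.2 hne')
    rw [map_sub] at h3 h4
    omega

end

end Kron
end

noncomputable section
namespace Kron

open Representation

/-! ### The symmetric power -/

/-- The product of the basis vectors indexed by the letters of a word, in the symmetric power. -/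
def symWord {I : Type} [DecidableEq I] {k : ℕ} (w : Fin k → I) : Sym[ℂ]^k (I → ℂ) :=
  SymmetricPower.tprod ℂ fun p => Pi.single (w p) 1

lemma exists_perm_of_content_eq {I : Type} [DecidableEq I] {k : ℕ} {w w' : Fin k → I}
    (h : content w = content w') :
    ∃ e : Equiv.Perm (Fin k), ∀ p, w' (e p) = w p := by
  have h1 : ∀ i, Nonempty ({p // w p = i} ≃ {p // w' p = i}) := by
    intro i
    refine ⟨Fintype.equivOfCardEq ?_⟩
    have := congrFun h i
    simpa only [content, Fintype.card_subtype, Finset.card_filter] using this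
  let E := (Equiv.sigmaFiberEquiv w).symm.trans
    ((Equiv.sigmaCongrRight fun i => (h1 i).some).trans (Equiv.sigmaFiberEquiv w'))
  exact ⟨E, fun p => ((h1 (w p)).some ⟨p, rfl⟩).2⟩

lemma symWord_congr {I : Type} [DecidableEq I] {k : ℕ} {w w' : Fin k → I} (h : content w = content w') :
    symWord w = symWord w' := by
  obtain ⟨e, he⟩ := exists_perm_of_content_eq h
  have h1 : (fun p => Pi.single (w p) 1 : Fin k → I → ℂ) = fun p => Pi.single (w' (e p)) 1 :=
    funext fun p => by rw [he]
  rw [symWord, h1]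
  exact SymmetricPower.tprod_equiv e fun p => (Pi.single (w' p) 1 : I → ℂ)

/-! ### The monomial basis of the symmetric power. -/

section

variable {I : Type} [Fintype I] [DecidableEq I] {k : ℕ}

lemma tprod_eq_sum_symWord (v : Fin k → I → ℂ) :
    SymmetricPower.tprod ℂ v = ∑ w : Fin k → I, (∏ p, v p (w p)) • symWord w := by
  have h : v = fun p => ∑ i, v p i • (Pi.single i 1 : I → ℂ) := funext fun p => by
    simpa using (pi_eq_sum_univ' (v p))
  conv_lhs => rw [h]
  rw [MultilinearMap.map_sum]
  refine Finset.sum_congr rfl fun w _ => ?_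
  exact MultilinearMap.map_smul_univ _ (fun p => v p (w p)) fun p => Pi.single (w p) 1

lemma span_symWord : Submodule.span ℂ (Set.range (symWord : (Fin k → I) → _)) = ⊤ := by
  rw [eq_top_iff, ← SymmetricPower.span_tprod_eq_top ℂ (Fin k) (I → ℂ), Submodule.span_le]
  rintro _ ⟨v, rfl⟩
  rw [tprod_eq_sum_symWord]
  exact Submodule.sum_mem _ fun w _ => Submodule.smul_mem _ _ (Submodule.subset_span ⟨w, rfl⟩)

/-- The linear map from the symmetric power to polynomials which sends a product of vectors to the
product of the corresponding linear forms. -/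
def symToPoly (I : Type) [Fintype I] (k : ℕ) : (Sym[ℂ]^k (I → ℂ)) →ₗ[ℂ] MvPolynomial I ℂ where
  __ := AddCon.lift (addConGen (SymmetricPower.Rel ℂ (Fin k) (I → ℂ)))
    (PiTensorProduct.lift ((MultilinearMap.mkPiAlgebra ℂ (Fin k) (MvPolynomial I ℂ)).compLinearMap
      fun _ => Fintype.linearCombination ℂ MvPolynomial.X)).toAddMonoidHom
    (AddCon.addConGen_le.2 (by
      rintro _ _ ⟨e, v⟩
      simp only [AddCon.ker_rel, LinearMap.toAddMonoidHom_coe, PiTensorProduct.lift.tprod,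
        MultilinearMap.compLinearMap_apply, MultilinearMap.mkPiAlgebra_apply]
      exact (Equiv.prod_comp e _).symm))
  map_smul' r x := by
    induction x using AddCon.induction_on with
    | H x =>
      exact map_smul (PiTensorProduct.lift
        ((MultilinearMap.mkPiAlgebra ℂ (Fin k) (MvPolynomial I ℂ)).compLinearMap
          fun _ => Fintype.linearCombination ℂ MvPolynomial.X)) r x

lemma symToPoly_symWord (w : Fin k → I) :
    symToPoly I k (symWord w) =
      MvPolynomial.monomial (Finsupp.equivFunOnFinite.symm (content w)) 1 := by
  change PiTensorProduct.lift _ (PiTensorProduct.tprod ℂ _) = _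
  rw [PiTensorProduct.lift.tprod]
  simp only [MultilinearMap.compLinearMap_apply, MultilinearMap.mkPiAlgebra_apply,
    Fintype.linearCombination_apply_single, one_smul]
  rw [prod_letters, MvPolynomial.monomial_eq, Finsupp.prod_fintype _ _ fun _ => pow_zero _]
  simp

/-- The exponent vectors of degree `k`. -/
abbrev SymExp (I : Type) [Fintype I] (k : ℕ) : Type := {A : I → ℕ // ∑ i, A i = k}

instance : Finite (SymExp I k) := by
  refine Finite.of_injective (β := I → Fin (k + 1)) (fun A i => ⟨A.1 i, Nat.lt_succ_of_le ?_⟩) ?_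
  · exact (Finset.single_le_sum (fun _ _ => Nat.zero_le _) (Finset.mem_univ i)).trans_eq A.2
  · intro A A' h
    exact Subtype.ext (funext fun i => Fin.mk.inj_iff.1 (congrFun h i))

lemma exists_content_eq (A : SymExp I k) : ∃ w : Fin k → I, content w = A.1 := by
  obtain ⟨w, hw⟩ := exists_fiber_card (α := Fin k) A.1 (by rw [A.2, Fintype.card_fin])
  exact ⟨w, funext hw⟩

/-- The monomial basis of the symmetric power. -/
theorem exists_symBasis (I : Type) [Fintype I] [DecidableEq I] (k : ℕ) :
    ∃ B : Module.Basis (SymExp I k) ℂ (Sym[ℂ]^k (I → ℂ)),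
      ∀ A, ∃ w : Fin k → I, content w = A.1 ∧ B A = symWord w := by
  choose W hW using fun A : SymExp I k => exists_content_eq A
  have hli : LinearIndependent ℂ fun A => symWord (W A) := by
    -- Independence is tested in the polynomial ring, where the images are distinct monomials.
    refine LinearIndependent.of_comp (symToPoly I k) ?_
    have h1 : (symToPoly I k ∘ fun A => symWord (W A)) = fun A =>
        MvPolynomial.monomial (Finsupp.equivFunOnFinite.symm A.1) 1 :=
      funext fun A => by rw [Function.comp_apply, symToPoly_symWord, hW]
    rw [h1]
    exact (MvPolynomial.basisMonomials I ℂ).linearIndependent.comp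
      (fun A : SymExp I k => Finsupp.equivFunOnFinite.symm A.1)
      (Finsupp.equivFunOnFinite.symm.injective.comp Subtype.val_injective)
  have hsp : ⊤ ≤ Submodule.span ℂ (Set.range fun A => symWord (W A)) := by
    rw [← span_symWord, Submodule.span_le]
    rintro _ ⟨w, rfl⟩
    exact Submodule.subset_span ⟨⟨content w, sum_content w⟩, symWord_congr (hW _)⟩
  exact ⟨Module.Basis.mk hli hsp, fun A => ⟨W A, hW A, Module.Basis.mk_apply hli hsp A⟩⟩

end

/-! ### Weights of the symmetric power and lattice points. -/

variable {a b c k : ℕ}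

lemma linearCombination_symWord_tensorRep (g : H a b c) (v : Word a b c k → ℂ) :
    Fintype.linearCombination ℂ symWord (tensorRep a b c k g v) =
      symRes a b c k g (Fintype.linearCombination ℂ symWord v) := by
  have h : symRes a b c k g = symMap k (Matrix.toLin' (tensorHom a b c g : Matrix _ _ ℂ)) := rfl
  simp only [Fintype.linearCombination_apply, map_sum, map_smul, tensorRep_apply, Matrix.mulVec,
    dotProduct, Finset.sum_smul]
  rw [Finset.sum_comm]
  refine Finset.sum_congr rfl fun w _ => ?_
  rw [h, symWord, symMap_tprod, tprod_eq_sum_symWord, Finset.smul_sum]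
  refine Finset.sum_congr rfl fun w' _ => ?_
  rw [smul_smul, mul_comm]
  simp [tensorMat]

/-- The quotient map from the tensor power to the symmetric power. -/
def tensorToSym (a b c k : ℕ) : IntertwiningMap (tensorRep a b c k) (symRes a b c k) where
  toLinearMap := Fintype.linearCombination ℂ symWord
  isIntertwining' g := LinearMap.ext (linearCombination_symWord_tensorRep g)

lemma tensorToSym_surjective : Function.Surjective (tensorToSym a b c k) := by
  have h : LinearMap.range (Fintype.linearCombination ℂ (symWord : Word a b c k → _)) = ⊤ := by
    rw [Fintype.range_linearCombination, span_symWord]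
  exact LinearMap.range_eq_top.1 h

lemma isSemisimple_symRes (a b c k : ℕ) : (symRes a b c k).IsSemisimpleRepresentation :=
  isSemisimple_of_surjective _ tensorToSym_surjective (isSemisimple_tensorRep a b c k)

lemma isPoly_symRes (a b c k : ℕ) : IsPoly k (symRes a b c k) :=
  (isPoly_tensorRep a b c k).of_surjective _ tensorToSym_surjective

lemma symWord_mem_weightSpace (w : Word a b c k) :
    symWord w ∈ weightSpace (symRes a b c k) (wt w) := by
  rw [mem_weightSpace]
  intro x
  have h1 : symWord w = tensorToSym a b c k (Pi.single w 1) := by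
    change _ = Fintype.linearCombination ℂ symWord (Pi.single w 1)
    rw [Fintype.linearCombination_apply_single, one_smul]
  rw [h1, ← IntertwiningMap.isIntertwining, tensorRep_apply, tensorMat_torusHom,
    Matrix.diagonal_mulVec_single, ← map_smul]
  congr 1
  ext w'
  by_cases h : w' = w
  · subst h; simp
  · simp [h]

/-- The marginals of a three-dimensional array. -/
def marginals (A : Fin a × Fin b × Fin c → ℕ) : (Fin a → ℕ) × (Fin b → ℕ) × (Fin c → ℕ) :=
  (fun l => ∑ m, ∑ n, A (l, m, n), fun m => ∑ l, ∑ n, A (l, m, n),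
    fun n => ∑ l, ∑ m, A (l, m, n))

lemma marginals_content (w : Word a b c k) : marginals (content w) = wordContent w := by
  refine Prod.ext (funext fun i => ?_) (Prod.ext (funext fun i => ?_) (funext fun i => ?_)) <;>
  · simp only [marginals, wordContent, content]
    simp only [Finset.sum_comm (t := (Finset.univ : Finset (Fin k)))]
    refine Finset.sum_congr rfl fun p _ => ?_
    simp [Prod.ext_iff, ite_and, Finset.sum_ite_eq]

/-- An integral point with nonnegative coordinates is an array of natural numbers; the total-sum
equation of the polytope is the degree condition on exponents. -/
lemma card_marginals_eq (δ : Weight a b c) :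
    Nat.card {A : SymExp (Fin a × Fin b × Fin c) k // natWeight (marginals A.1) = δ} =
      latticeCount k δ := by
  have hsum : ∀ x : Fin a × Fin b × Fin c → ℝ, ∑ l, ∑ m, ∑ n, x (l, m, n) = ∑ p, x p := fun x => by
    simp only [Fintype.sum_prod_type]
  refine Nat.card_congr (Equiv.ofBijective (fun A => ⟨fun p => (A.1.1 p : ℝ), ?_, fun p =>
    ⟨A.1.1 p, rfl⟩⟩) ⟨?_, ?_⟩)
  · obtain ⟨A, rfl⟩ := A
    refine ⟨fun l m n => Nat.cast_nonneg _, ?_, ?_, ?_, ?_⟩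
    · rw [hsum fun p => (A.1 p : ℝ)]
      exact_mod_cast A.2
    all_goals
      simp [natWeight, marginals]
  · intro A A' h
    refine Subtype.ext (Subtype.ext (funext fun p => ?_))
    exact Nat.cast_injective (R := ℝ) (congrFun (congrArg Subtype.val h) p)
  · rintro ⟨x, ⟨h0, hk, h1, h2, h3⟩, hz⟩
    have hz0 : ∀ p, ∃ n : ℕ, x p = n := fun p => by
      have := h0 p.1 p.2.1 p.2.2
      obtain ⟨z, hz⟩ := hz p
      rw [hz] at this
      obtain ⟨n, rfl⟩ := Int.eq_ofNat_of_zero_le (Int.cast_nonneg_iff.1 this)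
      exact ⟨n, by rw [hz]; simp⟩
    choose n hn using hz0
    obtain rfl : x = fun p => (n p : ℝ) := funext hn
    refine ⟨⟨⟨n, ?_⟩, ?_⟩, rfl⟩
    · rw [hsum fun p => (n p : ℝ)] at hk
      exact_mod_cast hk
    · beta_reduce at h1 h2 h3
      refine Prod.ext (funext fun i => ?_) (Prod.ext (funext fun i => ?_) (funext fun i => ?_)) <;>
        simp only [natWeight, marginals]
      · exact_mod_cast h1 i
      · exact_mod_cast h2 i
      · exact_mod_cast h3 i

/-- Each monomial is a weight vector whose weight is the triple of marginals of its exponent array.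
-/
theorem weightMult_symRes (δ : Weight a b c) :
    weightMult (symRes a b c k) δ = latticeCount k δ := by
  obtain ⟨B, hB⟩ := exists_symBasis (Fin a × Fin b × Fin c) k
  have := Fintype.ofFinite (SymExp (Fin a × Fin b × Fin c) k)
  rw [weightMult_eq_card B (fun A => natWeight (marginals A.1)) (fun A => ?_), card_marginals_eq]
  obtain ⟨w, hw, hBw⟩ := hB A
  rw [hBw, ← hw, marginals_content]
  exact symWord_mem_weightSpace w

end Kron
end

namespace Kron

open Representation

/-! ### Young diagrams and multiplicities -/

lemma sum_rowLen {d : ℕ} {lam : YoungDiagram} (h : lam.colLen 0 ≤ d) :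
    ∑ i : Fin d, lam.rowLen i = lam.card := by
  have h1 : ∀ c ∈ lam.cells, c.1 ∈ Finset.range d := fun c hc => by
    -- The first cell of the row of `c` also lies in the diagram, so the row index is below the
    -- length of the first column.
    have h2 : (c.1, 0) ∈ lam := lam.up_left_mem le_rfl (Nat.zero_le c.2) hc
    exact Finset.mem_range.2 ((YoungDiagram.mem_iff_lt_colLen.1 h2).trans_le h)
  rw [YoungDiagram.card, Finset.card_eq_sum_card_fiberwise h1,
    Finset.sum_range (fun i => (lam.cells.filter fun c => c.1 = i).card)]
  exact Finset.sum_congr rfl fun i _ => lam.rowLen_eq_card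

lemma antitone_rowLen (d : ℕ) (lam : YoungDiagram) : Antitone fun i : Fin d => lam.rowLen i :=
  fun i j hij => lam.rowLen_anti i j hij

section

variable {a b c k : ℕ}

/-- Multiplicities in a polynomial representation as alternating sums of weight multiplicities. -/
theorem mult_eq_weylSum {V : Type} [AddCommGroup V] [Module ℂ V] [Module.Finite ℂ V]
    {ρ : Representation ℂ (H a b c) V} (hρ : IsPoly k ρ) (D : IrredDecomposition ρ)
    {l : (Fin a → ℕ) × (Fin b → ℕ) × (Fin c → ℕ)} (hl : NatDominant l)
    (hd : HasDegree k (natWeight l : Weight a b c)) :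
    (D.mult (natWeight l) : ℤ) = weylSum (fun δ => (weightMult ρ δ : ℤ)) (natWeight l) := by
  classical
  have h1 : (fun δ => (weightMult ρ δ : ℤ)) = fun δ => ∑ i : Fin D.n,
      1 * (weightMult (D.summand i).toRepresentation δ : ℤ) := by
    funext δ
    rw [weightMult_isInternal D.isInternal]
    simp
  rw [h1, weylSum_sum, IrredDecomposition.mult, Nat.card_eq_fintype_card, Fintype.card_subtype,
    Finset.card_filter, Nat.cast_sum]
  refine Finset.sum_congr rfl fun i _ => ?_
  let σ : PolyIrrep a b c k :=
    { V := (D.summand i).toSubmodule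
      rep := (D.summand i).toRepresentation
      irreducible := D.irreducible i
      poly := hρ.sub _ }
  rw [one_mul]
  refine Eq.trans ?_ (weylSum_weightMult_irreducible σ hl hd).symm
  push_cast
  congr

end

end Kron

/-! ### The main theorem. -/

theorem mainTheorem6 (a b c k : ℕ) :
    (∀ δ : Kron.Weight a b c,
      Kron.weightMult (Kron.symRes a b c k) δ = Kron.latticeCount k δ) ∧
    ∀ lam mu nu : YoungDiagram, lam.card = k → mu.card = k → nu.card = k →
      lam.colLen 0 ≤ a → mu.colLen 0 ≤ b → nu.colLen 0 ≤ c →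
      ∃ g : ℕ, Kron.IsKroneckerCoefficient a b c k lam mu nu g ∧
        (g : ℤ) = ∑ γ ∈ Kron.Gam a b c, Kron.coeffC a b c γ *
          (Kron.latticeCount k
            ((Kron.rowVector a lam, Kron.rowVector b mu, Kron.rowVector c nu) + γ) : ℤ) := by
  refine ⟨Kron.weightMult_symRes, fun lam mu nu hlam hmu hnu ha hb hc => ?_⟩
  let l : (Fin a → ℕ) × (Fin b → ℕ) × (Fin c → ℕ) :=
    (fun i => lam.rowLen i, fun i => mu.rowLen i, fun i => nu.rowLen i)
  have hl : Kron.NatDominant l :=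
    ⟨Kron.antitone_rowLen a lam, Kron.antitone_rowLen b mu, Kron.antitone_rowLen c nu⟩
  have hd : Kron.HasDegree k (Kron.natWeight l : Kron.Weight a b c) := by
    refine ⟨?_, ?_, ?_⟩
    · exact (Nat.cast_sum _ _).symm.trans (congrArg Nat.cast ((Kron.sum_rowLen ha).trans hlam))
    · exact (Nat.cast_sum _ _).symm.trans (congrArg Nat.cast ((Kron.sum_rowLen hb).trans hmu))
    · exact (Nat.cast_sum _ _).symm.trans (congrArg Nat.cast ((Kron.sum_rowLen hc).trans hnu))
  -- The right side does not involve `D`, so this gives the formula and the independence of the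
  -- decomposition together.
  have hmult : ∀ D : Kron.IrredDecomposition (Kron.symRes a b c k),
      (D.mult (Kron.natWeight l) : ℤ) = ∑ γ ∈ Kron.Gam a b c, Kron.coeffC a b c γ *
        (Kron.latticeCount k (Kron.natWeight l + γ) : ℤ) := fun D => by
    rw [Kron.mult_eq_weylSum (Kron.isPoly_symRes a b c k) D hl hd,
      ← Kron.sum_coeffC_eq_weylSum fun δ => (Kron.weightMult (Kron.symRes a b c k) δ : ℤ)]
    simp only [Kron.weightMult_symRes]
  obtain ⟨n, S, hS, hirr⟩ :=
    Kron.exists_irreducible_isInternal _ (Kron.isSemisimple_symRes a b c k)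
  let D₀ : Kron.IrredDecomposition (Kron.symRes a b c k) := ⟨n, S, hS, hirr⟩
  exact ⟨D₀.mult (Kron.natWeight l), ⟨⟨D₀⟩, fun D => Nat.cast_injective (R := ℤ)
    ((hmult D).trans (hmult D₀).symm)⟩, hmult D₀⟩
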